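/- Let $n\ge 2$ and $n<p<\infty$. **Setting.** A weight $w$ on $\mathbb R^n$ is a locally integrable function with values in $(0,\infty)$ a.e.; $w\in A_2$ means $[w]_{A_2}:=\sup_Q\big(\frac1{|Q|}\int_Q w\big)\big(\frac1{|Q|}\int_Q w^{-1}\big)<\infty$, the supremum being over all axis-parallel cubes. For a weight $\nu$, a locally integrable $b:\mathbb R^n\to\mathbb C$ and a bounded set $S$ of positive measure put $\nu(S)=\int_S\nu$, $\langle b\rangle_S=\frac1{|S|}\int_S b$ and $\operatorname{osc}_\nu(b,S)=\frac1{\nu(S)}\int_S|b-\langle b\rangle_S|\,dx$. We write $b\in{\rm VMO}_\nu(\mathbb R^n)$ if $\sup_B\operatorname{osc}_\nu(b,B)<\infty$ over all balls $B$, and $\sup_{r_B=a}\operatorname{osc}_\nu(b,B)\to0$ both as $a\to0$ and as $a\to\infty$, and $\sup_{B\subset\mathbb R^n\setminus B(0,a)}\operatorname{osc}_\nu(b,B)\to0$ as $a\to\infty$. A dyadic system $\mathcal D$ consists of the cubes $Q=2^{-k}([0,1)^n+m+\alpha_k)$, $k\in\mathbb Z$, $m\in\mathbb Z^n$, where $\alpha_k\in\mathbb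 R^n$ and $2\alpha_k-\alpha_{k+1}\in\mathbb Z^n$ for all $k$ (so that the cubes are nested); this includes the standard system ($\alpha_k=0$) and the adjacent systems ($\alpha_k=(-1)^k\omega$, $\omega\in\{0,\frac13,\frac23\}^n$). For $Q=I_1\times\dots\times I_n\in\mathcal D$ and $\epsilon\in\{0,1\}^n$ let $h_Q^\epsilon(x)=\prod_i h_{I_i}^{(\epsilon_i)}(x_i)$ with $h_I^{(1)}=|I|^{-1/2}\mathsf 1_I$ and $h_I^{(0)}=|I|^{-1/2}(\mathsf 1_{I_-}-\mathsf 1_{I_+})$, where $I_\mp$ are the left and right halves of $I$. Write $\epsilon\not\equiv1$ if $\epsilon\ne(1,\dots,1)$, and $\langle f,h\rangle=\int fh\,dx$. The paraproducts are $$\Pi_b^{\mathcal D}f=\sum_{Q\in\mathcal D,\ \epsilon\not\equiv1}\langle b,h_Q^\epsilon\rangle\langle f\rangle_Q\,h_Q^\epsilon,\qquad \Pi_b^{*\mathcal D}f=\sum_{Q\in\mathcal D,\ \epsilon\not\equiv1}\langle b,h_Q^\epsilon\rangle\langle f,h_Q^\epsilon\rangle\frac{\mathsf 1_Q}{|Q|},$$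 $$\Gamma_b^{\mathcal D}f=\sum_{Q\in\mathcal D}\ \sum_{\epsilon,\eta\not\equiv1,\ \epsilon\ne\eta}\langle b,h_Q^\epsilon\rangle\langle f,h_Q^\eta\rangle\,h_Q^\epsilon h_Q^\eta .$$ For $T$ one of these, $\lambda^{1/2}T\mu^{-1/2}$ is the operator on $L^2(\mathbb R^n)$ given by the corresponding series, multiplied by $\lambda^{1/2}$ and applied to $\mu^{-1/2}f$, which is to converge unconditionally in $L^2(\mathbb R^n)$ for every $f\in L^2(\mathbb R^n)$ and to define a bounded operator. For a compact operator $A$, $\|A\|_{S^p}=(\sum_k s_k(A)^p)^{1/p}$, where the $s_k(A)$ are the eigenvalues of $|A|=(A^*A)^{1/2}$ with multiplicity; $A\in S^p$ if this is finite. In all other cases (not compact, or no bounded operator is defined) the $S^p$ norm is $\infty$. Finally, $\mathbf B^p_\nu(\mathbb R^n,\mathcal D)$ is the space of locally integrable $b$ with $$\|b\|_{\mathbf B^p_\nu(\mathbb R^n,\mathcal D)}:=\Big(\sum_{Q\in\mathcal D}\operatorname{osc}_\nu(b,Q)^p\Big)^{1/p}<\infty .$$ **Proposition.** Let $\mu,\lambda\in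 A_2$, $\nu=\mu^{1/2}\lambda^{-1/2}$, $b\in{\rm VMO}_\nu(\mathbb R^n)$, and let $\mathcal D$ be a dyadic system. Then each of the operators $\lambda^{1/2}\Pi_b^{\mathcal D}\mu^{-1/2}$, $\lambda^{1/2}\Pi_b^{*\mathcal D}\mu^{-1/2}$ and $\lambda^{1/2}\Gamma_b^{\mathcal D}\mu^{-1/2}$ belongs to $S^p(L^2(\mathbb R^n),L^2(\mathbb R^n))$ if and only if $b\in\mathbf B^p_\nu(\mathbb R^n,\mathcal D)$, and $$C^{-1}\|b\|_{\mathbf B^p_\nu(\mathbb R^n,\mathcal D)}\le\|\lambda^{1/2}T\mu^{-1/2}\|_{S^p(L^2(\mathbb R^n),L^2(\mathbb R^n))}\le C\|b\|_{\mathbf B^p_\nu(\mathbb R^n,\mathcal D)}\qquad\text{for each } T\in\{\Pi_b^{\mathcal D},\Pi_b^{*\mathcal D},\Gamma_b^{\mathcal D}\},$$ where $C$ depends only on $n$, $p$ and an upper bound for $[\mu]_{A_2}$ and $[\lambda]_{A_2}$, and in particular not on $b$ or $\mathcal D$. -/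

import Mathlib

open MeasureTheory Filter Topology
open scoped ENNReal NNReal

noncomputable section

namespace Paraproduct

/-- The Euclidean space `ℝⁿ`, with its Euclidean norm and Lebesgue measure. -/
abbrev Rn (n : ℕ) : Type := EuclideanSpace ℝ (Fin n)

/-- The (complex) Hilbert space `L²(ℝⁿ)`. -/
abbrev L2 (n : ℕ) : Type := Lp ℂ 2 (volume : Measure (Rn n))

/-- The half-open axis-parallel cube `∏ᵢ [aᵢ, aᵢ + ℓ)`. -/
def cube {n : ℕ} (a : Fin n → ℝ) (l : ℝ) : Set (Rn n) :=
  {x | ∀ i, x i ∈ Set.Ico (a i) (a i + l)}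

/-! ### Dyadic systems and Haar functions -/

/-- A dyadic system in `ℝⁿ`: for every `k : ℤ`, the cubes `2⁻ᵏ ([0,1)ⁿ + m + shift k)`, `m ∈ ℤⁿ`,
the generation `k + 1` being a refinement of the generation `k`, which is what `nested` says.
The standard system is `shift = 0`; the adjacent systems `𝒟^ω`, `ω ∈ {0, 1/3, 2/3}ⁿ`, are
`shift k = (-1)ᵏ ω`. -/
structure DyadicSystem (n : ℕ) where
  shift : ℤ → Fin n → ℝ
  nested : ∀ k i, ∃ m : ℤ, 2 * shift k i - shift (k + 1) i = m

/-- The dyadic cubes of a system are indexed by their generation `k` and their position `m`.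
(For `n ≥ 1` different indices give different cubes.) -/
abbrev CubeIndex (n : ℕ) : Type := ℤ × (Fin n → ℤ)

/-- Side length of a dyadic cube. -/
def side {n : ℕ} (Q : CubeIndex n) : ℝ := (2 : ℝ) ^ (-Q.1)

/-- Lower corner of a dyadic cube. -/
def corner {n : ℕ} (D : DyadicSystem n) (Q : CubeIndex n) (i : Fin n) : ℝ :=
  side Q * (Q.2 i + D.shift Q.1 i)

/-- The dyadic cube with index `Q`, as a set. -/
def dyadicCube {n : ℕ} (D : DyadicSystem n) (Q : CubeIndex n) : Set (Rn n) :=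
  cube (corner D Q) (side Q)

/-- The two one-dimensional Haar functions of the interval `I = [a, a + l)`:
`h⁽¹⁾ = |I|^(-1/2) 1_I` and `h⁽⁰⁾ = |I|^(-1/2) (1_{I₋} - 1_{I₊})`. -/
def haar₁ (e : Fin 2) (a l t : ℝ) : ℝ :=
  (Real.sqrt l)⁻¹ *
    (if e = 1 then (Set.Ico a (a + l)).indicator 1 t
     else (Set.Ico a (a + l / 2)).indicator 1 t - (Set.Ico (a + l / 2) (a + l)).indicator 1 t)

/-- The Haar function `h_Q^ε`, `ε ∈ {0,1}ⁿ`; it is cancellative iff `ε ≠ 1`. -/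
def haar {n : ℕ} (D : DyadicSystem n) (Q : CubeIndex n) (ε : Fin n → Fin 2) (x : Rn n) : ℝ :=
  ∏ i, haar₁ (ε i) (corner D Q i) (side Q) (x i)

/-- `⟨f, h_Q^ε⟩ = ∫ f h_Q^ε dx`. -/
def haarCoeff {n : ℕ} (D : DyadicSystem n) (f : Rn n → ℂ) (Q : CubeIndex n)
    (ε : Fin n → Fin 2) : ℂ :=
  ∫ x, f x * (haar D Q ε x : ℂ)

/-! ### Weights -/

/-- A weight: locally integrable, with values in `(0, ∞)` almost everywhere. -/
def IsWeight {n : ℕ} (w : Rn n → ℝ) : Prop :=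
  LocallyIntegrable w ∧ ∀ᵐ x, 0 < w x

/-- The Muckenhoupt constant `[w]_{A₂}`: the supremum over all cubes of
`(⨍_Q w) (⨍_Q w⁻¹)`. A weight is in `A₂` iff this is finite. -/
def A2const {n : ℕ} (w : Rn n → ℝ) : ℝ≥0∞ :=
  ⨆ (a : Fin n → ℝ) (l : ℝ) (_ : 0 < l),
    (⨍⁻ x in cube a l, ENNReal.ofReal (w x) ∂volume) *
      (⨍⁻ x in cube a l, (ENNReal.ofReal (w x))⁻¹ ∂volume)

/-- The Bloom weight `ν = μ^(1/2) λ^(-1/2)`. -/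
def bloom {n : ℕ} (μ lam : Rn n → ℝ) (x : Rn n) : ℝ :=
  μ x ^ (1 / 2 : ℝ) * lam x ^ (-(1 / 2) : ℝ)

/-! ### Weighted oscillation, VMO, dyadic Besov spaces -/

/-- The weighted mean oscillation `w(S)⁻¹ ∫_S |b - ⟨b⟩_S| dx`. -/
def osc {n : ℕ} (w : Rn n → ℝ) (b : Rn n → ℂ) (S : Set (Rn n)) : ℝ≥0∞ :=
  (∫⁻ x in S, ‖b x - ⨍ y in S, b y‖ₑ) / ∫⁻ x in S, ENNReal.ofReal (w x)

/-- `b ∈ BMO_w(ℝⁿ)`. -/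
def MemBMO {n : ℕ} (w : Rn n → ℝ) (b : Rn n → ℂ) : Prop :=
  LocallyIntegrable b ∧ (⨆ (x : Rn n) (r : ℝ) (_ : 0 < r), osc w b (Metric.ball x r)) < ∞

/-- `b ∈ VMO_w(ℝⁿ)`: the mean oscillation vanishes uniformly on small balls, on large balls and
on balls that are far away (from the origin; the choice of this base point is immaterial). -/
def MemVMO {n : ℕ} (w : Rn n → ℝ) (b : Rn n → ℂ) : Prop :=
  MemBMO w b ∧
  Tendsto (fun a : ℝ => ⨆ x : Rn n, osc w b (Metric.ball x a)) (𝓝[>] 0) (𝓝 0) ∧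
  Tendsto (fun a : ℝ => ⨆ x : Rn n, osc w b (Metric.ball x a)) atTop (𝓝 0) ∧
  Tendsto (fun a : ℝ => ⨆ (x : Rn n) (r : ℝ) (_ : 0 < r)
      (_ : Metric.ball x r ⊆ (Metric.ball (0 : Rn n) a)ᶜ), osc w b (Metric.ball x r))
    atTop (𝓝 0)

/-- The norm of the dyadic Besov space `B_w^p(ℝⁿ, 𝒟)`, with the value `∞` outside of the space. -/
def besovNorm {n : ℕ} (D : DyadicSystem n) (w : Rn n → ℝ) (p : ℝ) (b : Rn n → ℂ) : ℝ≥0∞ :=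
  (∑' Q : CubeIndex n, osc w b (dyadicCube D Q) ^ p) ^ (1 / p)

/-- `b ∈ B_w^p(ℝⁿ, 𝒟)`. -/
def MemBesov {n : ℕ} (D : DyadicSystem n) (w : Rn n → ℝ) (p : ℝ) (b : Rn n → ℂ) : Prop :=
  LocallyIntegrable b ∧ besovNorm D w p b < ∞

/-! ### Schatten classes -/

section Schatten

variable {H₁ H₂ : Type*} [NormedAddCommGroup H₁] [InnerProductSpace ℂ H₁] [CompleteSpace H₁]
  [NormedAddCommGroup H₂] [InnerProductSpace ℂ H₂] [CompleteSpace H₂]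

/-- `|T| = (T* T)^(1/2)`. -/
def absOp (T : H₁ →L[ℂ] H₂) : H₁ →L[ℂ] H₁ :=
  CFC.sqrt (ContinuousLinearMap.adjoint T ∘L T)

/-- The Schatten norm `(∑ₖ sₖ(T)^p)^(1/p)` of a compact operator, where the singular values `sₖ(T)`
are the eigenvalues of `|T|`, repeated according to multiplicity (the eigenvalue `0` does not
contribute to the sum). It is `∞` for an operator that is not compact. -/
def schattenNorm (p : ℝ) (T : H₁ →L[ℂ] H₂) : ℝ≥0∞ :=
  open Classical in
  if IsCompactOperator T then
    (∑' s : Set.Ioi (0 : ℝ),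
      (Module.finrank ℂ (Module.End.eigenspace (absOp T : H₁ →ₗ[ℂ] H₁) ((s : ℝ) : ℂ)) : ℝ≥0∞) *
        ENNReal.ofReal ((s : ℝ) ^ p)) ^ (1 / p)
  else ∞

end Schatten

/-! ### Operators given by series -/

/-- The bounded operator `T` on `L²(ℝⁿ)` is the sum of the series of operators `∑ᵢ tᵢ`: for every
`f ∈ L²(ℝⁿ)` the series `∑ᵢ tᵢ f` converges unconditionally in `L²(ℝⁿ)` to `T f`. -/
def IsSeriesSum {n : ℕ} {ι : Type*} (t : ι → (Rn n → ℂ) → Rn n → ℂ) (T : L2 n →L[ℂ] L2 n) : Prop :=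
  ∀ f : L2 n, Tendsto
    (fun s : Finset ι => eLpNorm (fun x => T f x - ∑ i ∈ s, t i (⇑f) x) 2 volume) atTop (𝓝 0)

/-- The operator `∑ᵢ tᵢ` is a bounded operator on `L²(ℝⁿ)` and belongs to the Schatten class. -/
def SeriesMemSchatten {n : ℕ} {ι : Type*} (p : ℝ) (t : ι → (Rn n → ℂ) → Rn n → ℂ) : Prop :=
  ∃ T : L2 n →L[ℂ] L2 n, IsSeriesSum t T ∧ schattenNorm p T < ∞

/-- The Schatten norm of the operator `∑ᵢ tᵢ`. The bounded operator `T` below is unique if it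
exists; the norm is `∞` if the series does not define a bounded operator on `L²(ℝⁿ)`. -/
def seriesSchattenNorm {n : ℕ} {ι : Type*} (p : ℝ) (t : ι → (Rn n → ℂ) → Rn n → ℂ) : ℝ≥0∞ :=
  ⨅ (T : L2 n →L[ℂ] L2 n) (_ : IsSeriesSum t T), schattenNorm p T

/-- The series for `λ^(1/2) A μ^(-1/2)`, where `A = ∑ᵢ tᵢ`. -/
def weighted {n : ℕ} {ι : Type*} (μ lam : Rn n → ℝ) (t : ι → (Rn n → ℂ) → Rn n → ℂ) :
    ι → (Rn n → ℂ) → Rn n → ℂ :=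
  fun i f x => ((lam x ^ (1 / 2 : ℝ) : ℝ) : ℂ) *
    t i (fun y => ((μ y ^ (-(1 / 2) : ℝ) : ℝ) : ℂ) * f y) x

/-! ### The paraproducts -/

/-- Signatures of the cancellative Haar functions. -/
abbrev Canc (n : ℕ) : Type := {ε : Fin n → Fin 2 // ε ≠ 1}

/-- Pairs of different signatures of cancellative Haar functions. -/
abbrev CancPair (n : ℕ) : Type := {e : Canc n × Canc n // e.1 ≠ e.2}

/-- `Π_b f = ∑_{Q, ε ≠ 1} ⟨b, h_Q^ε⟩ ⟨f⟩_Q h_Q^ε`. -/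
def paraTerm {n : ℕ} (D : DyadicSystem n) (b : Rn n → ℂ) :
    CubeIndex n × Canc n → (Rn n → ℂ) → Rn n → ℂ :=
  fun (Q, ε) f x =>
    haarCoeff D b Q ε.1 * (⨍ y in dyadicCube D Q, f y) * (haar D Q ε.1 x : ℂ)

/-- `Π*_b f = ∑_{Q, ε ≠ 1} ⟨b, h_Q^ε⟩ ⟨f, h_Q^ε⟩ 1_Q / |Q|`. -/
def paraStarTerm {n : ℕ} (D : DyadicSystem n) (b : Rn n → ℂ) :
    CubeIndex n × Canc n → (Rn n → ℂ) → Rn n → ℂ :=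
  fun (Q, ε) f x =>
    haarCoeff D b Q ε.1 * haarCoeff D f Q ε.1 *
      ((dyadicCube D Q).indicator 1 x / (volume.real (dyadicCube D Q) : ℂ))

/-- `Γ_b f = ∑_Q ∑_{ε, η ≠ 1, ε ≠ η} ⟨b, h_Q^ε⟩ ⟨f, h_Q^η⟩ h_Q^ε h_Q^η`. -/
def gammaTerm {n : ℕ} (D : DyadicSystem n) (b : Rn n → ℂ) :
    CubeIndex n × CancPair n → (Rn n → ℂ) → Rn n → ℂ :=
  fun (Q, e) f x =>
    haarCoeff D b Q e.1.1.1 * haarCoeff D f Q e.1.2.1 *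
      ((haar D Q e.1.1.1 x : ℂ) * (haar D Q e.1.2.1 x : ℂ))

end Paraproduct

end

/-!
Put `s = μ^(-1/2)` and `r = λ^(1/2)`, so that `s²` and `r²` are `A₂` weights and `ν = (s r)⁻¹`
almost everywhere. Each of the three operators is a series of operators of rank one
`f ↦ κ ⟨f, s φ⟩ r ψ`, where `κ = ⟨b, h_Q^ε⟩` and where `φ` and `ψ` are constant on the children of
`Q`. By the `A₂` condition `ν(Q) (s²(Q) r²(Q))^(1/2)` is comparable to `|Q|²` (`bloom_mul_sqrt`), so
that the natural size `coefSize` of such a term is comparable to `|κ| |Q|^(1/2) / ν(Q)`. The Schatten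
norm turns out to be comparable to the `ℓ^p` norm of these sizes, and this to the Besov norm. As
`p > n ≥ 2`, only exponents `p ≥ 2` matter.

*Upper bound.* Let `β Q` be the size of the terms of the cube `Q`, and let `G` be the majorant
`(1 / s²(Q)) ∑_{R ⊆ Q} β R s²(R)`, added to the analogous one for `r²`. A child has at most a fixed
fraction `δ < 1` of the measure of its parent, so passing to averages over children contracts `ℓ^p`,
and `‖G‖_p ≲ ‖β‖_p` (`exists_majorant`). The terms with `G ≤ t` satisfy a Carleson condition with
constant `t`, so by the Carleson embedding theorem (`tsum_carleson_le`) their sum has norm `≲ t`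
(`norm_sum_rankOne_le`). Removing the finitely many other terms, one sees that the `k`-th singular
value is at most a multiple of the `k`-th largest value of `G` (`schattenNorm_tsum_rankOne_le`).

*Lower bound.* An operator of the class `S^p`, `p ≥ 2`, maps an orthogonal family of the unit ball to
a `p`-summable one (`tsum_enorm_apply_rpow_le`). The operators are applied to weighted step functions
on cubes `P` with vanishing `s²`-mean, which are orthogonal to each other, and the image is paired
with `r⁻¹ h_Q^ε` (for `Γ_b`, with the Haar function whose signature is that of a product), so that by
the orthogonality of Haar functions a single term of the series is seen
(`paraOp_lower`, `paraStarOp_lower`, `gammaOp_lower`). For `Π_b` and its adjoint, `Q` has to be a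
child of `P`, as the average of the test function over `P` itself vanishes.

*Besov norm.* That Haar coefficients are bounded by oscillations is immediate. Conversely, the
oscillation over `Q` is at most the size of the Haar coefficients of `Q` plus the `ν`-average of the
oscillations over the children of `Q` (`osc_le_add_childAvg`). As `b` has vanishing mean oscillation
on small cubes, iterating this bounds the oscillation by the sum of the averages of the coefficients
over all descendants (`MemVMO.osc_le_descTotal`), and the contraction property gives the `ℓ^p` bound.
-/

noncomputable section

namespace Paraproduct

/-! ### Singular values of compact operators -/

section Hilbert

variable {H : Type*} [NormedAddCommGroup H] [InnerProductSpace ℂ H] [CompleteSpace H]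

open ContinuousLinearMap in
/-- The eigenvectors of `|T|` with eigenvalue `s > 0` are those of `T* T` with eigenvalue `s²`. -/
theorem mem_eigenspace_absOp_iff (T : H →L[ℂ] H) {s : ℝ} (hs : 0 < s) (x : H) :
    x ∈ Module.End.eigenspace (absOp T : H →ₗ[ℂ] H) (s : ℂ) ↔
      adjoint T (T x) = ((s : ℂ) ^ 2) • x := by
  have hK : 0 ≤ adjoint T ∘L T :=
    (nonneg_iff_isPositive _).2 (isPositive_adjoint_comp_self T)
  have hmul : absOp T * absOp T = adjoint T ∘L T := CFC.sqrt_mul_sqrt_self _ hK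
  have hpos : (absOp T).IsPositive := (nonneg_iff_isPositive _).1 (CFC.sqrt_nonneg _)
  have happ (y : H) : absOp T (absOp T y) = adjoint T (T y) := congrArg (fun A => A y) hmul
  rw [Module.End.mem_eigenspace_iff, ← happ]
  constructor
  · intro h
    have h' : absOp T x = (s : ℂ) • x := h
    rw [h', map_smul, h', smul_smul, sq]
  · intro h
    -- `|T| + s` is injective, and it annihilates `(|T| - s) x`
    set y := absOp T x - (s : ℂ) • x with hy
    have h1 : absOp T y = -((s : ℂ) • y) := by
      rw [hy, map_sub, map_smul, h, smul_sub, smul_smul, sq]; abel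
    have h2 : 0 ≤ RCLike.re (inner ℂ (absOp T y) y) := hpos.re_inner_nonneg_left y
    have h4 : 0 ≤ -(s * ‖y‖ ^ 2) := by
      have h3 : inner ℂ (absOp T y) y = ((-(s * ‖y‖ ^ 2) : ℝ) : ℂ) := by
        rw [h1, inner_neg_left, inner_smul_left, Complex.conj_ofReal, inner_self_eq_norm_sq_to_K]
        push_cast; rfl
      rw [h3] at h2
      exact h2
    have h5 : ‖y‖ ^ 2 = 0 := by nlinarith [sq_nonneg ‖y‖]
    have h6 : y = 0 := by simpa using h5
    exact sub_eq_zero.1 h6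

/-- The singular value decomposition of a compact operator: an orthonormal basis of eigenvectors
of `T* T`, with eigenvalues `s i ^ 2`. The basis includes one of the kernel, where `s i = 0`. -/
theorem exists_hilbertBasis_singularValues (T : H →L[ℂ] H) (hT : IsCompactOperator T) :
    ∃ (w : Set H) (u : HilbertBasis w ℂ H) (s : w → ℝ), (∀ i, 0 ≤ s i) ∧
      (∀ i, ContinuousLinearMap.adjoint T (T (u i)) = ((s i : ℂ) ^ 2) • u i) ∧
      ∀ p : ℝ, 0 < p → schattenNorm p T ^ p = ∑' i, ENNReal.ofReal (s i ^ p) := by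
  set K : H →L[ℂ] H := ContinuousLinearMap.adjoint T ∘L T with hKdef
  have hKpos : K.IsPositive := ContinuousLinearMap.isPositive_adjoint_comp_self T
  have hKsymm : (K : H →ₗ[ℂ] H).IsSymmetric := hKpos.isSymmetric
  have hKc : IsCompactOperator K := hT.clm_comp (ContinuousLinearMap.adjoint T)
  have hApos : (absOp T).IsPositive :=
    (ContinuousLinearMap.nonneg_iff_isPositive _).1 (CFC.sqrt_nonneg _)
  have hAsymm : (absOp T : H →ₗ[ℂ] H).IsSymmetric := hApos.isSymmetric
  let E : Set.Ioi (0 : ℝ) → Submodule ℂ H := fun s =>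
    Module.End.eigenspace (absOp T : H →ₗ[ℂ] H) ((s : ℝ) : ℂ)
  have hE (s : Set.Ioi (0 : ℝ)) (x : H) : x ∈ E s ↔ K x = (((s : ℝ) : ℂ) ^ 2) • x :=
    mem_eigenspace_absOp_iff T s.2 x
  have hEfin (s : Set.Ioi (0 : ℝ)) : FiniteDimensional ℂ (E s) := by
    have hs : (((s : ℝ) : ℂ) ^ 2) ≠ 0 := by
      have := s.2.out.ne'
      simpa using this
    have h1 := ContinuousLinearMap.finite_dimensional_eigenspace hKc _ hs
    have h2 : E s = Module.End.eigenspace (K : H →ₗ[ℂ] H) (((s : ℝ) : ℂ) ^ 2) := by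
      ext x
      rw [hE, Module.End.mem_eigenspace_iff]; rfl
    rw [h2]; exact h1
  have hOF : OrthogonalFamily ℂ (fun s => E s) (fun s => (E s).subtypeₗᵢ) :=
    hAsymm.orthogonalFamily_eigenspaces.comp (f := fun s : Set.Ioi (0 : ℝ) => ((s : ℝ) : ℂ))
      (Complex.ofReal_injective.comp Subtype.coe_injective)
  have hON := hOF.orthonormal_sigma_orthonormal
    (v_family := fun s => stdOrthonormalBasis ℂ (E s))
    (fun s => (stdOrthonormalBasis ℂ (E s)).orthonormal)
  set e : (Σ s : Set.Ioi (0 : ℝ), Fin (Module.finrank ℂ (E s))) → H :=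
    fun a => (E a.1).subtypeₗᵢ (stdOrthonormalBasis ℂ (E a.1) a.2) with he
  have heinj : Function.Injective e := hON.linearIndependent.injective
  obtain ⟨w, u, hw, hu⟩ := hON.toSubtypeRange.exists_hilbertBasis_extension
  classical
  let s : w → ℝ := fun i => if h : ∃ a, e a = i.1 then (h.choose.1 : ℝ) else 0
  have hse (a) (ha : e a ∈ w) : s ⟨e a, ha⟩ = a.1 := by
    have hex : ∃ a', e a' = e a := ⟨a, rfl⟩
    have : hex.choose = a := heinj hex.choose_spec
    simp only [s, dif_pos hex, this]
  have hs0 (i : w) (hi : ¬ ∃ a, e a = i.1) : s i = 0 := by simp only [s, dif_neg hi]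
  have hui (i : w) : u i = i.1 := by rw [hu]
  refine ⟨w, u, s, ?_, ?_, ?_⟩
  · intro i
    by_cases h : ∃ a, e a = i.1
    · simp only [s, dif_pos h]; exact h.choose.1.2.out.le
    · rw [hs0 i h]
  · intro i
    by_cases h : ∃ a, e a = i.1
    · obtain ⟨a, ha⟩ := h
      have : i = ⟨e a, ha ▸ i.2⟩ := Subtype.ext ha.symm
      rw [hui, this, hse]
      exact (hE a.1 _).1 (stdOrthonormalBasis ℂ (E a.1) a.2).2
    · rw [hs0 i h]
      -- a basis vector orthogonal to all the eigenspaces with positive eigenvalue is in the kernel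
      have horth (t : Set.Ioi (0 : ℝ)) (x : H) (hx : x ∈ E t) : inner ℂ x (u i) = 0 := by
        have hx' : x = ∑ k, inner ℂ (stdOrthonormalBasis ℂ (E t) k) ⟨x, hx⟩ • e ⟨t, k⟩ := by
          have := (stdOrthonormalBasis ℂ (E t)).sum_repr' ⟨x, hx⟩
          have h2 := congrArg (fun z : E t => (z : H)) this
          simpa [he] using h2.symm
        rw [hx', sum_inner]
        refine Finset.sum_eq_zero fun k _ => ?_
        have hne : (⟨e ⟨t, k⟩, hw ⟨_, rfl⟩⟩ : w) ≠ i := fun hh => h ⟨⟨t, k⟩, congrArg Subtype.val hh⟩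
        have : inner ℂ (u ⟨e ⟨t, k⟩, hw ⟨_, rfl⟩⟩) (u i) = 0 := u.orthonormal.2 hne
        rw [hui ⟨e ⟨t, k⟩, hw ⟨_, rfl⟩⟩] at this
        rw [inner_smul_left, this, mul_zero]
      have hmem : K (u i) ∈ (⨆ μ, Module.End.eigenspace (K : H →ₗ[ℂ] H) μ)ᗮ := by
        rw [← Submodule.iInf_orthogonal, Submodule.mem_iInf]
        intro μ x hx
        have hx' : K x = μ • x := Module.End.mem_eigenspace_iff.1 hx
        have h1 : inner ℂ x (K (u i)) = inner ℂ (K x) (u i) := (hKsymm x (u i)).symm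
        rw [h1, hx', inner_smul_left]
        by_cases hx0 : x = 0
        · simp [hx0]
        by_cases hμ : μ = 0
        · simp [hμ]
        have h2 : (μ : ℂ) = ((‖T x‖ / ‖x‖ : ℝ) : ℂ) ^ 2 := by
          have h3 : inner ℂ x (K x) = ((‖T x‖ ^ 2 : ℝ) : ℂ) := by
            rw [hKdef, ContinuousLinearMap.comp_apply, ContinuousLinearMap.adjoint_inner_right,
              inner_self_eq_norm_sq_to_K]; norm_cast
          rw [hx', inner_smul_right, inner_self_eq_norm_sq_to_K] at h3
          have h4 : ((‖x‖ : ℝ) : ℂ) ≠ 0 := by simpa using hx0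
          push_cast at h3 ⊢
          field_simp
          exact h3
        have h5 : 0 < ‖T x‖ / ‖x‖ := by
          refine lt_of_le_of_ne (by positivity) fun hh => hμ ?_
          rw [h2, ← hh]; simp
        rw [horth ⟨_, h5⟩ x ((hE _ x).2 (by rw [hx', h2])), mul_zero]
      rw [ContinuousLinearMap.orthogonalComplement_iSup_eigenspaces_eq_bot hKc hKsymm] at hmem
      have : K (u i) = 0 := by simpa using hmem
      change K (u i) = _
      rw [this]; simp
  · intro p hp
    rw [schattenNorm, if_pos hT, ← ENNReal.rpow_mul, one_div_mul_cancel hp.ne', ENNReal.rpow_one]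
    let g : (Σ s : Set.Ioi (0 : ℝ), Fin (Module.finrank ℂ (E s))) → w :=
      fun a => ⟨e a, hw ⟨a, rfl⟩⟩
    have hg : Function.Injective g := fun a a' h => heinj (congrArg Subtype.val h)
    rw [← hg.tsum_eq (f := fun i => ENNReal.ofReal (s i ^ p))]
    · simp only [g, hse]
      rw [ENNReal.tsum_sigma (fun (a : Set.Ioi (0 : ℝ)) (_ : Fin (Module.finrank ℂ (E a))) =>
        ENNReal.ofReal ((a : ℝ) ^ p))]
      refine tsum_congr fun a => ?_
      rw [tsum_fintype, Finset.sum_const, Finset.card_univ, Fintype.card_fin, nsmul_eq_mul]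
    · intro i hi
      by_contra hcon
      refine hi ?_
      have : ¬ ∃ a, e a = i.1 := fun ⟨a, ha⟩ => hcon ⟨a, Subtype.ext ha⟩
      simp only [hs0 i this, Real.zero_rpow hp.ne', ENNReal.ofReal_zero]

end Hilbert

/-! ### Testing a Schatten class operator on orthogonal families -/

/-- Bessel's inequality for an orthogonal family in the unit ball. -/
theorem tsum_enorm_inner_sq_le {H : Type*} [NormedAddCommGroup H] [InnerProductSpace ℂ H]
    {I : Type*} (e : I → H)
    (horth : ∀ i j, i ≠ j → inner ℂ (e i) (e j) = 0) (hnorm : ∀ i, ‖e i‖ ≤ 1) (x : H) :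
    ∑' i, ‖inner ℂ (e i) x‖ₑ ^ 2 ≤ ‖x‖ₑ ^ 2 := by
  classical
  let v : {i // e i ≠ 0} → H := fun i => ((‖e i‖ : ℂ)⁻¹) • e i
  have hv : Orthonormal ℂ v := by
    refine ⟨fun i => ?_, fun i j hij => ?_⟩
    · have := norm_ne_zero_iff.2 i.2
      simp [v, norm_smul, this]
    · simp only [v, inner_smul_left, inner_smul_right]
      rw [horth i j (fun h => hij (Subtype.ext h))]; simp
  have hle (i : {i // e i ≠ 0}) : ‖inner ℂ (e i) x‖ ≤ ‖inner ℂ (v i) x‖ := by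
    have h0 := norm_pos_iff.2 i.2
    simp only [v, inner_smul_left, norm_mul, map_inv₀, norm_inv, Complex.conj_ofReal,
      Complex.norm_real, norm_norm]
    exact le_mul_of_one_le_left (norm_nonneg _) (one_le_inv₀ h0 |>.2 (hnorm i))
  have hinj : Function.Injective (Subtype.val : {i // e i ≠ 0} → I) := Subtype.val_injective
  rw [← hinj.tsum_eq (f := fun i => ‖inner ℂ (e i) x‖ₑ ^ 2)]
  · refine ENNReal.summable.tsum_le_of_sum_le fun s => ?_
    have h1 : ∑ i ∈ s, ‖inner ℂ (e i) x‖ ^ 2 ≤ ‖x‖ ^ 2 :=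
      (Finset.sum_le_sum fun i _ => pow_le_pow_left₀ (norm_nonneg _) (hle i) 2).trans
        (hv.sum_inner_products_le x)
    have h2 := ENNReal.ofReal_le_ofReal h1
    rw [ENNReal.ofReal_sum_of_nonneg (fun i _ => by positivity)] at h2
    simpa only [ENNReal.ofReal_pow (norm_nonneg _), ofReal_norm] using h2
  · intro i hi
    have : e i ≠ 0 := fun h => hi (by simp [h])
    exact ⟨⟨i, this⟩, rfl⟩

theorem enorm_rpow_eq {H : Type*} [NormedAddCommGroup H] (x : H) (p : ℝ) :
    ‖x‖ₑ ^ p = ENNReal.ofReal (‖x‖ ^ 2) ^ (p / 2) := by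
  rw [ENNReal.ofReal_pow (norm_nonneg _), ofReal_norm, ← ENNReal.rpow_natCast, ← ENNReal.rpow_mul]
  congr 1; push_cast; ring

section Hilbert

variable {H : Type*} [NormedAddCommGroup H] [InnerProductSpace ℂ H] [CompleteSpace H]

/-- Jensen's inequality for a doubly substochastic array. -/
theorem tsum_rpow_tsum_mul_le {I K : Type*} (c : K → I → ℝ≥0∞) (z : K → ℝ≥0∞)
    (hc₁ : ∀ i, ∑' k, c k i ≤ 1) (hc₂ : ∀ k, ∑' i, c k i ≤ 1) {q : ℝ} (hq : 1 ≤ q) :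
    ∑' i, (∑' k, c k i * z k) ^ q ≤ ∑' k, z k ^ q := by
  have hq0 : 0 < q := by linarith
  have h1 (i : I) : (∑' k, c k i * z k) ^ q ≤ ∑' k, c k i * z k ^ q := by
    rw [← ENNReal.le_rpow_inv_iff hq0]
    refine ENNReal.summable.tsum_le_of_sum_le fun s => ?_
    refine (ENNReal.inner_le_weight_mul_Lp_of_nonneg s hq (fun k => c k i) z).trans ?_
    have h2 : (∑ k ∈ s, c k i) ^ (1 - q⁻¹) ≤ 1 :=
      ENNReal.rpow_le_one ((ENNReal.sum_le_tsum s).trans (hc₁ i))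
        (by rw [sub_nonneg]; exact inv_le_one_of_one_le₀ hq)
    calc _ ≤ 1 * (∑ k ∈ s, c k i * z k ^ q) ^ q⁻¹ := by gcongr
      _ ≤ _ := by
        rw [one_mul]
        gcongr
        exact ENNReal.sum_le_tsum s
  calc _ ≤ ∑' i, ∑' k, c k i * z k ^ q := ENNReal.tsum_le_tsum h1
    _ = ∑' k, (∑' i, c k i) * z k ^ q := by
      rw [ENNReal.tsum_comm]; simp only [ENNReal.tsum_mul_right]
    _ ≤ _ := ENNReal.tsum_le_tsum fun k => by
      calc _ ≤ 1 * z k ^ q := by gcongr; exact hc₂ k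
        _ = _ := one_mul _

open ContinuousLinearMap in
/-- Parseval's identity for `T x` in terms of the singular value decomposition of `T`. -/
theorem enorm_apply_sq_eq_tsum {T : H →L[ℂ] H} {w : Set H} (u : HilbertBasis w ℂ H) (s : w → ℝ)
    (hu : ∀ i, adjoint T (T (u i)) = ((s i : ℂ) ^ 2) • u i) (x : H) :
    ENNReal.ofReal (‖T x‖ ^ 2) = ∑' k, ENNReal.ofReal (‖inner ℂ (u k) x‖ ^ 2 * s k ^ 2) := by
  have h1 := u.hasSum_inner_mul_inner x (adjoint T (T x))
  have h2 : inner ℂ x (adjoint T (T x)) = ((‖T x‖ ^ 2 : ℝ) : ℂ) := by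
    rw [adjoint_inner_right, inner_self_eq_norm_sq_to_K]; norm_cast
  have h3 (k : w) : inner ℂ x (u k) * inner ℂ (u k) (adjoint T (T x)) =
      ((‖inner ℂ (u k) x‖ ^ 2 * s k ^ 2 : ℝ) : ℂ) := by
    rw [adjoint_inner_right, ← adjoint_inner_left, hu, inner_smul_left, ← inner_conj_symm x (u k)]
    rw [map_pow, Complex.conj_ofReal, mul_left_comm, Complex.conj_mul']
    push_cast; ring
  rw [h2, funext h3, Complex.hasSum_ofReal] at h1
  rw [← h1.tsum_eq, ENNReal.ofReal_tsum_of_nonneg (fun k => by positivity) h1.summable]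

theorem ofReal_rpow_eq {s : ℝ} (hs : 0 ≤ s) {p : ℝ} (hp : 0 < p) :
    ENNReal.ofReal (s ^ p) = ENNReal.ofReal (s ^ 2) ^ (p / 2) := by
  rw [ENNReal.ofReal_rpow_of_nonneg (by positivity) (by positivity), ← Real.rpow_natCast,
    ← Real.rpow_mul hs]
  congr 2; push_cast; ring

theorem schattenNorm_rpow_of_not_compact {T : H →L[ℂ] H} (hT : ¬ IsCompactOperator T) {p : ℝ}
    (hp : 0 < p) : schattenNorm p T ^ p = ∞ := by
  rw [schattenNorm, if_neg hT, ENNReal.top_rpow_of_pos hp]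

/-- An operator in the Schatten class `S^p`, `p ≥ 2`, maps an orthogonal family in the unit ball
to a `p`-summable family. -/
theorem tsum_enorm_apply_rpow_le {I : Type*} (T : H →L[ℂ] H) (e : I → H)
    (horth : ∀ i j, i ≠ j → inner ℂ (e i) (e j) = 0) (hnorm : ∀ i, ‖e i‖ ≤ 1) {p : ℝ}
    (hp : 2 ≤ p) : ∑' i, ‖T (e i)‖ₑ ^ p ≤ schattenNorm p T ^ p := by
  have hp0 : 0 < p := by linarith
  by_cases hT : IsCompactOperator T
  swap
  · rw [schattenNorm_rpow_of_not_compact hT hp0]; exact le_top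
  obtain ⟨w, u, s, hs, hu, hsum⟩ := exists_hilbertBasis_singularValues T hT
  rw [hsum p hp0]
  have hu1 (k : w) : ‖u k‖ₑ = 1 := by
    rw [← ofReal_norm, u.orthonormal.1 k, ENNReal.ofReal_one]
  simp only [enorm_rpow_eq, enorm_apply_sq_eq_tsum u s hu, ofReal_rpow_eq (hs _) hp0]
  simp only [ENNReal.ofReal_mul (sq_nonneg ‖_‖)]
  refine tsum_rpow_tsum_mul_le _ _ (fun i => ?_) (fun k => ?_) (by linarith)
  · have := tsum_enorm_inner_sq_le u (fun i j h => u.orthonormal.2 h)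
      (fun k => (u.orthonormal.1 k).le) (e i)
    refine le_trans (le_of_eq ?_) (this.trans ?_)
    · exact tsum_congr fun k => by rw [ENNReal.ofReal_pow (norm_nonneg _), ofReal_norm]
    · rw [← ofReal_norm]
      exact pow_le_one₀ zero_le (ENNReal.ofReal_le_one.2 (hnorm i))
  · have := tsum_enorm_inner_sq_le e horth hnorm (u k)
    rw [hu1, one_pow] at this
    refine le_trans (le_of_eq ?_) this
    exact tsum_congr fun k => by
      rw [ENNReal.ofReal_pow (norm_nonneg _), norm_inner_symm, ofReal_norm]

open ContinuousLinearMap in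
/-- The adjoint of an operator in the Schatten class `S^p`, `p ≥ 2`, maps an orthogonal family in
the unit ball to a `p`-summable family. -/
theorem tsum_enorm_adjoint_apply_rpow_le {I : Type*} (T : H →L[ℂ] H) (e : I → H)
    (horth : ∀ i j, i ≠ j → inner ℂ (e i) (e j) = 0) (hnorm : ∀ i, ‖e i‖ ≤ 1) {p : ℝ}
    (hp : 2 ≤ p) : ∑' i, ‖adjoint T (e i)‖ₑ ^ p ≤ schattenNorm p T ^ p := by
  have hp0 : 0 < p := by linarith
  by_cases hT : IsCompactOperator T
  swap
  · rw [schattenNorm_rpow_of_not_compact hT hp0]; exact le_top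
  obtain ⟨w, u, s, hs, hu, hsum⟩ := exists_hilbertBasis_singularValues T hT
  rw [hsum p hp0]
  -- the left singular vectors, with the value `0` for those of the kernel
  let v : w → H := fun k => ((s k : ℂ)⁻¹) • T (u k)
  have hTT (k l : w) : inner ℂ (T (u k)) (T (u l)) = (s l : ℂ) ^ 2 * inner ℂ (u k) (u l) := by
    rw [← adjoint_inner_right, hu, inner_smul_right]
  have hvorth (k l : w) (h : k ≠ l) : inner ℂ (v k) (v l) = 0 := by
    have h0 : inner ℂ (u k) (u l) = 0 := u.orthonormal.2 h
    simp [v, hTT, h0]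
  have hTu (k : w) : ‖T (u k)‖ = s k := by
    have h1 := hTT k k
    rw [inner_self_eq_norm_sq_to_K, inner_self_eq_norm_sq_to_K, u.orthonormal.1 k] at h1
    have h2 : ‖T (u k)‖ ^ 2 = s k ^ 2 := by
      have : ((‖T (u k)‖ ^ 2 : ℝ) : ℂ) = ((s k ^ 2 : ℝ) : ℂ) := by
        push_cast; simpa using h1
      exact_mod_cast this
    exact (pow_left_inj₀ (norm_nonneg _) (hs k) two_ne_zero).1 h2
  have hv (k : w) : T (u k) = (s k : ℂ) • v k := by
    by_cases h0 : s k = 0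
    · have : T (u k) = 0 := by rw [← norm_eq_zero, hTu, h0]
      simp [this, h0]
    · have : (s k : ℂ) ≠ 0 := by exact_mod_cast h0
      simp only [v]
      rw [smul_inv_smul₀ this]
  have hvnorm (k : w) : ‖v k‖ ≤ 1 := by
    simp only [v, norm_smul, norm_inv, Complex.norm_real, Real.norm_of_nonneg (hs k), hTu]
    exact inv_mul_le_one
  have hadj (x : H) : ENNReal.ofReal (‖adjoint T x‖ ^ 2) =
      ∑' k, ENNReal.ofReal (‖inner ℂ (v k) x‖ ^ 2 * s k ^ 2) := by
    have h1 := u.hasSum_inner_mul_inner (adjoint T x) (adjoint T x)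
    have h3 (k : w) : inner ℂ (adjoint T x) (u k) * inner ℂ (u k) (adjoint T x) =
        ((‖inner ℂ (v k) x‖ ^ 2 * s k ^ 2 : ℝ) : ℂ) := by
      rw [← inner_conj_symm (adjoint T x) (u k), adjoint_inner_right, hv, inner_smul_left,
        Complex.conj_mul', norm_mul]
      rw [Complex.conj_ofReal, Complex.norm_real, Real.norm_of_nonneg (hs k)]
      push_cast; ring
    have h2 : inner ℂ (adjoint T x) (adjoint T x) = ((‖adjoint T x‖ ^ 2 : ℝ) : ℂ) := by
      rw [inner_self_eq_norm_sq_to_K]; norm_cast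
    rw [h2, funext h3, Complex.hasSum_ofReal] at h1
    rw [← h1.tsum_eq, ENNReal.ofReal_tsum_of_nonneg (fun k => by positivity) h1.summable]
  simp only [enorm_rpow_eq, hadj, ofReal_rpow_eq (hs _) hp0]
  simp only [ENNReal.ofReal_mul (sq_nonneg ‖_‖)]
  refine tsum_rpow_tsum_mul_le _ _ (fun i => ?_) (fun k => ?_) (by linarith)
  · have := tsum_enorm_inner_sq_le v hvorth hvnorm (e i)
    refine le_trans (le_of_eq ?_) (this.trans ?_)
    · exact tsum_congr fun k => by rw [ENNReal.ofReal_pow (norm_nonneg _), ofReal_norm]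
    · rw [← ofReal_norm]
      exact pow_le_one₀ zero_le (ENNReal.ofReal_le_one.2 (hnorm i))
  · have := tsum_enorm_inner_sq_le e horth hnorm (v k)
    refine le_trans (le_of_eq ?_) (this.trans ?_)
    · exact tsum_congr fun k => by
        rw [ENNReal.ofReal_pow (norm_nonneg _), norm_inner_symm, ofReal_norm]
    · rw [← ofReal_norm]
      exact pow_le_one₀ zero_le (ENNReal.ofReal_le_one.2 (hvnorm k))

/-! ### Schatten norms of sums of operators of rank one -/

/-- The `ℓ^p` norm is monotone in the distribution function. -/
theorem tsum_rpow_le_of_encard_le {I K : Type*} {f : I → ℝ} {g : K → ℝ} (hf : ∀ i, 0 ≤ f i)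
    (hg : ∀ k, 0 ≤ g k) (h : ∀ t : ℝ, 0 < t → {i | t < f i}.encard ≤ {k | t < g k}.encard)
    {p : ℝ} (hp : 0 < p) :
    ∑' i, ENNReal.ofReal (f i ^ p) ≤ ∑' k, ENNReal.ofReal (g k ^ p) := by
  let _ : MeasurableSpace I := ⊤
  let _ : MeasurableSpace K := ⊤
  rw [← lintegral_count, ← lintegral_count,
    lintegral_rpow_eq_lintegral_meas_lt_mul _ (ae_of_all _ hf) (measurable_from_top).aemeasurable hp,
    lintegral_rpow_eq_lintegral_meas_lt_mul _ (ae_of_all _ hg) (measurable_from_top).aemeasurable hp]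
  gcongr ENNReal.ofReal p * ?_
  refine setLIntegral_mono' measurableSet_Ioi fun t ht => ?_
  gcongr ?_ * _
  rw [Measure.count_apply MeasurableSpace.measurableSet_top,
    Measure.count_apply MeasurableSpace.measurableSet_top]
  exact_mod_cast h t ht

open ContinuousLinearMap InnerProductSpace in
/-- The singular values of `F + G` which exceed `‖G‖` are at most as many as the rank of `F`. -/
theorem encard_singularValues_le {ι : Type*} {T : H →L[ℂ] H} {w : Set H} (u : HilbertBasis w ℂ H)
    (s : w → ℝ) (hu : ∀ i, adjoint T (T (u i)) = ((s i : ℂ) ^ 2) • u i) {t : ℝ} (ht : 0 ≤ t)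
    (x y : ι → H) (S : Finset ι) (hG : ‖T - ∑ i ∈ S, rankOne ℂ (x i) (y i)‖ ≤ t) :
    {i | t < s i}.encard ≤ S.card := by
  by_contra! hcon
  have hcon' : ((S.card + 1 : ℕ) : ℕ∞) ≤ {i | t < s i}.encard := by
    push_cast; exact Order.add_one_le_of_lt hcon
  obtain ⟨Z, hZs, hZ⟩ := Set.exists_subset_encard_eq hcon'
  have hZfin : Z.Finite := Set.finite_of_encard_eq_coe hZ
  let _ : Fintype Z := hZfin.fintype
  have hZcard : Fintype.card Z = S.card + 1 := by
    rw [← Nat.card_eq_fintype_card, Nat.card_coe_set_eq, Set.ncard, hZ]; rfl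
  let L : (Z → ℂ) →ₗ[ℂ] H :=
    { toFun := fun c => ∑ k, c k • u k
      map_add' := fun c d => by simp [add_smul, Finset.sum_add_distrib]
      map_smul' := fun a c => by simp [Finset.smul_sum, mul_smul] }
  let A : (Z → ℂ) →ₗ[ℂ] (S → ℂ) := LinearMap.pi fun i => (innerSL ℂ (y i)).toLinearMap ∘ₗ L
  have hker : LinearMap.ker A ≠ ⊥ := by
    apply LinearMap.ker_ne_bot_of_finrank_lt
    simp [hZcard]
  obtain ⟨c, hcA, hc0⟩ := (Submodule.ne_bot_iff _).1 hker
  have hy (i : ι) (hi : i ∈ S) : inner ℂ (y i) (L c) = 0 := congrFun hcA ⟨i, hi⟩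
  have hon : Orthonormal ℂ (fun k : Z => u k) := u.orthonormal.comp _ Subtype.val_injective
  have hLc : ‖L c‖ ^ 2 = ∑ k, ‖c k‖ ^ 2 := by
    have h1 := hon.inner_sum c c Finset.univ
    have h2 : inner ℂ (L c) (L c) = ((‖L c‖ ^ 2 : ℝ) : ℂ) := by
      rw [inner_self_eq_norm_sq_to_K]; norm_cast
    have h3 : ((‖L c‖ ^ 2 : ℝ) : ℂ) = ((∑ k, ‖c k‖ ^ 2 : ℝ) : ℂ) := by
      rw [← h2]; refine h1.trans ?_
      push_cast
      exact Finset.sum_congr rfl fun k _ => Complex.conj_mul' _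
    exact_mod_cast h3
  have hTc : ‖T (L c)‖ ^ 2 = ∑ k : Z, s k ^ 2 * ‖c k‖ ^ 2 := by
    have h0 : adjoint T (T (L c)) = ∑ k : Z, ((s k : ℂ) ^ 2 * c k) • u k := by
      change adjoint T (T (∑ k : Z, c k • u k)) = _
      simp only [map_sum, map_smul, hu, smul_smul]
      exact Finset.sum_congr rfl fun k _ => by rw [mul_comm]
    have h1 := hon.inner_sum c (fun k => (s k : ℂ) ^ 2 * c k) Finset.univ
    have h2 : inner ℂ (L c) (adjoint T (T (L c))) = ((‖T (L c)‖ ^ 2 : ℝ) : ℂ) := by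
      rw [adjoint_inner_right, inner_self_eq_norm_sq_to_K]; norm_cast
    have h3 : ((‖T (L c)‖ ^ 2 : ℝ) : ℂ) = ((∑ k : Z, s k ^ 2 * ‖c k‖ ^ 2 : ℝ) : ℂ) := by
      rw [← h2, h0]; refine h1.trans ?_
      push_cast
      refine Finset.sum_congr rfl fun k _ => ?_
      rw [mul_left_comm, Complex.conj_mul']
    exact_mod_cast h3
  have hTG : ‖T (L c)‖ ≤ t * ‖L c‖ := by
    have h1 : (T - ∑ i ∈ S, rankOne ℂ (x i) (y i)) (L c) = T (L c) := by
      rw [sub_apply, sum_apply, Finset.sum_eq_zero, sub_zero]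
      intro i hi
      rw [rankOne_apply, hy i hi, zero_smul]
    rw [← h1]
    exact le_of_opNorm_le _ hG _
  have hlt : t ^ 2 * ‖L c‖ ^ 2 < ‖T (L c)‖ ^ 2 := by
    rw [hLc, hTc, Finset.mul_sum]
    have hsk (k : Z) : t ^ 2 < s k ^ 2 := pow_lt_pow_left₀ (hZs k.2) ht two_ne_zero
    obtain ⟨k, hk⟩ := Function.ne_iff.1 hc0
    refine Finset.sum_lt_sum (fun k _ => ?_) ⟨k, Finset.mem_univ _, ?_⟩
    · exact mul_le_mul_of_nonneg_right (hsk k).le (by positivity)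
    · exact mul_lt_mul_of_pos_right (hsk k) (by have := norm_pos_iff.2 hk; positivity)
  have := pow_le_pow_left₀ (norm_nonneg _) hTG 2
  rw [mul_pow] at this
  linarith

open ContinuousLinearMap InnerProductSpace in
/-- If the sums of those operators `x i ⊗ y i` of rank one for which `γ i ≤ t` have norm at most
`t`, then the sum of all of them has `k`-th singular value at most the `k`-th largest number
`γ i`, and so its Schatten norm is at most the `ℓ^p` norm of `γ`. -/
theorem schattenNorm_tsum_rankOne_le {ι : Type*} (x y : ι → H) (γ : ι → ℝ) (hγ : ∀ i, 0 ≤ γ i)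
    {p : ℝ} (hp : 0 < p) (hsum : ∑' i, ENNReal.ofReal (γ i ^ p) ≠ ∞)
    (h : ∀ t : ℝ, 0 < t → ∀ S : Finset ι, (∀ i ∈ S, γ i ≤ t) →
      ‖∑ i ∈ S, rankOne ℂ (x i) (y i)‖ ≤ t) :
    Summable (fun i => rankOne ℂ (x i) (y i)) ∧
      schattenNorm p (∑' i, rankOne ℂ (x i) (y i)) ^ p ≤ ∑' i, ENNReal.ofReal (γ i ^ p) := by
  classical
  have hfin (t : ℝ) (ht : 0 < t) : {i | t < γ i}.Finite := by
    have h1 := ENNReal.finite_const_le_of_tsum_ne_top hsum (ε := ENNReal.ofReal (t ^ p))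
      (by simpa using Real.rpow_pos_of_pos ht p)
    refine h1.subset fun i hi => ?_
    exact ENNReal.ofReal_le_ofReal (Real.rpow_le_rpow ht.le (le_of_lt hi) hp.le)
  have hS : Summable (fun i => rankOne ℂ (x i) (y i)) := by
    rw [summable_iff_vanishing_norm]
    intro ε hε
    refine ⟨(hfin (ε / 2) (half_pos hε)).toFinset, fun S hdisj => ?_⟩
    refine lt_of_le_of_lt (h (ε / 2) (half_pos hε) S fun i hi => ?_) (half_lt_self hε)
    by_contra! hcon
    exact Finset.disjoint_left.1 hdisj hi ((hfin _ (half_pos hε)).mem_toFinset.2 hcon)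
  refine ⟨hS, ?_⟩
  set T := ∑' i, rankOne ℂ (x i) (y i) with hT
  have hHS : HasSum (fun i => rankOne ℂ (x i) (y i)) T := hS.hasSum
  have hcomp : IsCompactOperator T := by
    refine isCompactOperator_of_tendsto hHS (Eventually.of_forall fun S => ?_)
    have : ∑ i ∈ S, rankOne ℂ (x i) (y i) ∈ compactOperator (RingHom.id ℂ) H H :=
      Submodule.sum_mem _ fun i _ => by
        change IsCompactOperator (rankOne ℂ (x i) (y i))
        rw [rankOne_def']
        exact (isCompactOperator_of_locallyCompactSpace_dom (innerSL ℂ (y i))).clm_comp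
          (toSpanSingleton ℂ (x i))
    exact this
  obtain ⟨w, u, s, hs, hu, hsv⟩ := exists_hilbertBasis_singularValues T hcomp
  rw [hsv p hp]
  refine tsum_rpow_le_of_encard_le hs hγ (fun t ht => ?_) hp
  have hF := hfin t ht
  rw [hF.encard_eq_coe_toFinset_card]
  refine encard_singularValues_le u s hu ht.le x y hF.toFinset ?_
  have htend : Tendsto (fun S : Finset ι => ∑ i ∈ S, rankOne ℂ (x i) (y i) -
      ∑ i ∈ hF.toFinset, rankOne ℂ (x i) (y i)) atTop
      (𝓝 (T - ∑ i ∈ hF.toFinset, rankOne ℂ (x i) (y i))) := Tendsto.sub_const hHS _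
  refine le_of_tendsto htend.norm ?_
  filter_upwards [eventually_ge_atTop hF.toFinset] with S hS
  rw [← Finset.sum_sdiff_eq_sub hS]
  refine h t ht _ fun i hi => ?_
  have := (Finset.mem_sdiff.1 hi).2
  rw [hF.mem_toFinset] at this
  exact not_lt.1 this

end Hilbert

/-! ### Averaging and Carleson embedding on trees -/

section Tree

variable {I J : Type*} [Fintype J]

/-- The weighted average of `f` over the children `ch Q j` of `Q`, the weight of a vertex `R` being
`v R`. -/
def childAvg (ch : I → J → I) (v : I → ℝ) (f : I → ℝ≥0∞) (Q : I) : ℝ≥0∞ :=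
  ∑ j, ENNReal.ofReal (v (ch Q j) / v Q) * f (ch Q j)

/-- The sum of the averages of `f` over the descendants of `Q` of order less than `k`. -/
def descSum (ch : I → J → I) (v : I → ℝ) (f : I → ℝ≥0∞) : ℕ → I → ℝ≥0∞
  | 0, _ => 0
  | k + 1, Q => f Q + childAvg ch v (descSum ch v f k) Q

/-- The sum over all orders `k` of the averages of `f` over the descendants of `Q` of order `k`;
in other words, `(1 / v Q) ∑_{R ⊆ Q} f R v R`. -/
def descTotal (ch : I → J → I) (v : I → ℝ) (f : I → ℝ≥0∞) (Q : I) : ℝ≥0∞ :=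
  ⨆ k, descSum ch v f k Q

variable {ch : I → J → I} {v : I → ℝ}

theorem childAvg_mono {f g : I → ℝ≥0∞} (h : ∀ Q, f Q ≤ g Q) (Q : I) :
    childAvg ch v f Q ≤ childAvg ch v g Q :=
  Finset.sum_le_sum fun j _ => by gcongr; exact h _

theorem childAvg_add (f g : I → ℝ≥0∞) (Q : I) :
    childAvg ch v (fun R => f R + g R) Q = childAvg ch v f Q + childAvg ch v g Q := by
  simp only [childAvg, mul_add, Finset.sum_add_distrib]

theorem sum_ofReal_div_eq_one (hv : ∀ Q, 0 < v Q) (hadd : ∀ Q, ∑ j, v (ch Q j) = v Q) (Q : I) :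
    ∑ j, ENNReal.ofReal (v (ch Q j) / v Q) = 1 := by
  rw [← ENNReal.ofReal_sum_of_nonneg (fun j _ => (div_pos (hv _) (hv _)).le), ← Finset.sum_div,
    hadd, div_self (hv Q).ne', ENNReal.ofReal_one]

theorem childAvg_const (hv : ∀ Q, 0 < v Q) (hadd : ∀ Q, ∑ j, v (ch Q j) = v Q) (c : ℝ≥0∞) (Q : I) :
    childAvg ch v (fun _ => c) Q = c := by
  rw [childAvg, ← Finset.sum_mul, sum_ofReal_div_eq_one hv hadd, one_mul]

/-- When every child has at most the fraction `δ` of the weight of its parent, averaging over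
children contracts `ℓ^p`. -/
theorem tsum_childAvg_rpow_le (hinj : Function.Injective fun a : I × J => ch a.1 a.2)
    (hv : ∀ Q, 0 < v Q) (hadd : ∀ Q, ∑ j, v (ch Q j) = v Q) {δ : ℝ}
    (hδ : ∀ Q j, v (ch Q j) ≤ δ * v Q) {p : ℝ} (hp : 1 ≤ p) (f : I → ℝ≥0∞) :
    ∑' Q, childAvg ch v f Q ^ p ≤ ENNReal.ofReal δ * ∑' Q, f Q ^ p := by
  calc ∑' Q, childAvg ch v f Q ^ p
      ≤ ∑' Q, ∑ j, ENNReal.ofReal δ * f (ch Q j) ^ p := by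
        refine ENNReal.tsum_le_tsum fun Q => ?_
        refine (ENNReal.rpow_arith_mean_le_arith_mean_rpow _ _ _
          (sum_ofReal_div_eq_one hv hadd Q) hp).trans ?_
        refine Finset.sum_le_sum fun j _ => ?_
        gcongr
        rw [div_le_iff₀ (hv Q)]; exact hδ Q j
    _ = ENNReal.ofReal δ * ∑' a : I × J, f (ch a.1 a.2) ^ p := by
        rw [ENNReal.tsum_prod (f := fun Q j => f (ch Q j) ^ p), ← ENNReal.tsum_mul_left]
        refine tsum_congr fun Q => ?_
        rw [tsum_fintype, Finset.mul_sum]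
    _ ≤ _ := by
        gcongr
        exact ENNReal.tsum_comp_le_tsum_of_injective hinj (fun Q => f Q ^ p)

theorem descSum_mono (f : I → ℝ≥0∞) (Q : I) : Monotone fun k => descSum ch v f k Q := by
  refine monotone_nat_of_le_succ fun k => ?_
  induction k generalizing Q with
  | zero => exact zero_le
  | succ k ih =>
    simp only [descSum]
    gcongr
    exact childAvg_mono ih Q

theorem tsum_descSum_rpow_le (hinj : Function.Injective fun a : I × J => ch a.1 a.2)
    (hv : ∀ Q, 0 < v Q) (hadd : ∀ Q, ∑ j, v (ch Q j) = v Q) {δ : ℝ} (hδ0 : 0 < δ) (hδ1 : δ < 1)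
    (hδ : ∀ Q j, v (ch Q j) ≤ δ * v Q) {p : ℝ} (hp : 1 ≤ p) (f : I → ℝ≥0∞) (k : ℕ) :
    ∑' Q, descSum ch v f k Q ^ p ≤
      ENNReal.ofReal (1 - δ ^ (1 / p)) ^ (-p) * ∑' Q, f Q ^ p := by
  have hp0 : 0 < p := by linarith
  set θ := δ ^ (1 / p) with hθ
  have hθ0 : 0 < θ := Real.rpow_pos_of_pos hδ0 _
  have hθ1 : θ < 1 := Real.rpow_lt_one hδ0.le hδ1 (by positivity)
  have hθp : ENNReal.ofReal δ = ENNReal.ofReal θ ^ p := by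
    rw [ENNReal.ofReal_rpow_of_pos hθ0, hθ, ← Real.rpow_mul hδ0.le, one_div_mul_cancel hp0.ne',
      Real.rpow_one]
  set a := ENNReal.ofReal (1 - θ) with ha
  set b := ENNReal.ofReal θ with hb
  have ha0 : a ≠ 0 := by simpa [ha] using hθ1
  have hb0 : b ≠ 0 := by simpa [hb] using hθ0
  have haT : a ≠ ∞ := ENNReal.ofReal_ne_top
  have hbT : b ≠ ∞ := ENNReal.ofReal_ne_top
  have hab : a + b = 1 := by
    rw [← ENNReal.ofReal_add (by linarith) hθ0.le]; simp
  -- convexity of `t ↦ t ^ p`, at `x / a` and `y / b`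
  have hconv (x y : ℝ≥0∞) : (x + y) ^ p ≤ a * a ^ (-p) * x ^ p + b * b ^ (-p) * y ^ p := by
    have h := ENNReal.rpow_arith_mean_le_arith_mean2_rpow a b (a⁻¹ * x) (b⁻¹ * y) hab hp
    rw [ENNReal.mul_rpow_of_nonneg _ _ hp0.le, ENNReal.mul_rpow_of_nonneg _ _ hp0.le,
      ENNReal.inv_rpow, ENNReal.inv_rpow, ← ENNReal.rpow_neg, ← ENNReal.rpow_neg,
      ← mul_assoc, ← mul_assoc, ← mul_assoc, ← mul_assoc, ENNReal.mul_inv_cancel ha0 haT,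
      ENNReal.mul_inv_cancel hb0 hbT, one_mul, one_mul] at h
    exact h
  induction k with
  | zero =>
    have : ∀ Q, descSum ch v f 0 Q ^ p = 0 := fun Q => by
      simp only [descSum]; exact ENNReal.zero_rpow_of_pos hp0
    simp only [this, tsum_zero]; exact zero_le
  | succ k ih =>
    calc ∑' Q, descSum ch v f (k + 1) Q ^ p
        ≤ ∑' Q, (a * a ^ (-p) * f Q ^ p +
            b * b ^ (-p) * childAvg ch v (descSum ch v f k) Q ^ p) :=
          ENNReal.tsum_le_tsum fun Q => hconv _ _
      _ = a * a ^ (-p) * ∑' Q, f Q ^ p +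
            b * b ^ (-p) * ∑' Q, childAvg ch v (descSum ch v f k) Q ^ p := by
          rw [ENNReal.tsum_add, ENNReal.tsum_mul_left, ENNReal.tsum_mul_left]
      _ ≤ a * a ^ (-p) * ∑' Q, f Q ^ p +
            b * b ^ (-p) * (b ^ p * (a ^ (-p) * ∑' Q, f Q ^ p)) := by
          gcongr
          refine (tsum_childAvg_rpow_le hinj hv hadd hδ hp _).trans ?_
          rw [hθp]; gcongr
      _ = (a + b) * (a ^ (-p) * ∑' Q, f Q ^ p) := by
          have : b ^ (-p) * b ^ p = 1 := by
            rw [← ENNReal.rpow_add _ _ hb0 hbT, neg_add_cancel, ENNReal.rpow_zero]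
          calc _ = a * a ^ (-p) * ∑' Q, f Q ^ p +
                b * (b ^ (-p) * b ^ p) * (a ^ (-p) * ∑' Q, f Q ^ p) := by ring
            _ = _ := by rw [this]; ring
      _ = _ := by rw [hab, one_mul]

/-- The operator `descTotal` is bounded on `ℓ^p`, if every child has at most the fraction `δ < 1` of
the weight of its parent. -/
theorem tsum_descTotal_rpow_le (hinj : Function.Injective fun a : I × J => ch a.1 a.2)
    (hv : ∀ Q, 0 < v Q) (hadd : ∀ Q, ∑ j, v (ch Q j) = v Q) {δ : ℝ} (hδ0 : 0 < δ) (hδ1 : δ < 1)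
    (hδ : ∀ Q j, v (ch Q j) ≤ δ * v Q) {p : ℝ} (hp : 1 ≤ p) (f : I → ℝ≥0∞) :
    ∑' Q, descTotal ch v f Q ^ p ≤
      ENNReal.ofReal (1 - δ ^ (1 / p)) ^ (-p) * ∑' Q, f Q ^ p := by
  refine ENNReal.summable.tsum_le_of_sum_le fun s => ?_
  have hlim : Tendsto (fun k => ∑ Q ∈ s, descSum ch v f k Q ^ p) atTop
      (𝓝 (∑ Q ∈ s, descTotal ch v f Q ^ p)) :=
    tendsto_finsetSum _ fun Q _ =>
      ((ENNReal.continuous_rpow_const).tendsto _).comp (tendsto_atTop_iSup (descSum_mono f Q))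
  exact le_of_tendsto' hlim fun k => (ENNReal.sum_le_tsum s).trans
    (tsum_descSum_rpow_le hinj hv hadd hδ0 hδ1 hδ hp f k)

theorem add_childAvg_descTotal_le (f : I → ℝ≥0∞) (Q : I) :
    f Q + childAvg ch v (descTotal ch v f) Q ≤ descTotal ch v f Q := by
  have h1 : childAvg ch v (descTotal ch v f) Q = ⨆ k, childAvg ch v (descSum ch v f k) Q := by
    simp only [childAvg, descTotal, ENNReal.mul_iSup]
    refine ENNReal.finsetSum_iSup_of_monotone fun j => ?_
    intro k l hkl
    dsimp only
    gcongr
    exact descSum_mono f _ hkl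
  rw [h1, ENNReal.add_iSup]
  exact iSup_le fun k => le_iSup (fun k => descSum ch v f k Q) (k + 1)

/-- The sum of `u` over the descendants of `Q` of order less than `N`. -/
def subtreeSum {M : Type*} [AddCommMonoid M] (ch : I → J → I) (u : I → M) : ℕ → I → M
  | 0, _ => 0
  | N + 1, Q => u Q + ∑ j, subtreeSum ch u N (ch Q j)

/-- The Carleson embedding theorem on the subtree of descendants of a vertex. It follows by
induction from the properties of the Bellman function `4 (F - x² / (v + A))`. -/
theorem subtreeSum_carleson_le {a x F A : I → ℝ} (hv : ∀ Q, 0 < v Q)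
    (haddv : ∀ Q, ∑ j, v (ch Q j) = v Q) (haddx : ∀ Q, ∑ j, x (ch Q j) = x Q)
    (haddF : ∀ Q, ∑ j, F (ch Q j) = F Q) (hx : ∀ Q, x Q ^ 2 ≤ F Q * v Q)
    (ha : ∀ Q, 0 ≤ a Q) (hA0 : ∀ Q, 0 ≤ A Q) (hA : ∀ Q, a Q + ∑ j, A (ch Q j) ≤ A Q)
    (hAv : ∀ Q, A Q ≤ v Q) (N : ℕ) (Q : I) :
    subtreeSum ch (fun Q => a Q * (x Q / v Q) ^ 2) N Q + 4 * (x Q ^ 2 / (v Q + A Q)) ≤ 4 * F Q := by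
  induction N generalizing Q with
  | zero =>
    have h1 : x Q ^ 2 / (v Q + A Q) ≤ F Q := by
      rw [div_le_iff₀ (add_pos_of_pos_of_nonneg (hv Q) (hA0 Q))]
      have hF : 0 ≤ F Q := by
        have := (sq_nonneg (x Q)).trans (hx Q)
        exact nonneg_of_mul_nonneg_left this (hv Q)
      nlinarith [hx Q, mul_nonneg hF (hA0 Q)]
    simp only [subtreeSum]; linarith
  | succ N ih =>
    simp only [subtreeSum]
    have h1 : ∑ j, subtreeSum ch (fun Q => a Q * (x Q / v Q) ^ 2) N (ch Q j) +
        4 * ∑ j, x (ch Q j) ^ 2 / (v (ch Q j) + A (ch Q j)) ≤ 4 * F Q := by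
      rw [← haddF Q, Finset.mul_sum, Finset.mul_sum, ← Finset.sum_add_distrib]
      exact Finset.sum_le_sum fun j _ => ih (ch Q j)
    set W := ∑ j, (v (ch Q j) + A (ch Q j)) with hW
    have h2 : x Q ^ 2 / W ≤ ∑ j, x (ch Q j) ^ 2 / (v (ch Q j) + A (ch Q j)) := by
      rw [← haddx Q]
      exact Finset.sq_sum_div_le_sum_sq_div _ _ fun j _ => add_pos_of_pos_of_nonneg (hv _) (hA0 _)
    have hWv : v Q ≤ W := by
      rw [hW, Finset.sum_add_distrib, haddv]
      have : 0 ≤ ∑ j, A (ch Q j) := Finset.sum_nonneg fun j _ => hA0 _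
      linarith
    have hWA : W + a Q ≤ v Q + A Q := by
      rw [hW, Finset.sum_add_distrib, haddv]
      have := hA Q
      linarith
    have hv0 := hv Q
    have hW0 : 0 < W := hv0.trans_le hWv
    have h3 : a Q * (x Q / v Q) ^ 2 + 4 * (x Q ^ 2 / (v Q + A Q)) ≤ 4 * (x Q ^ 2 / W) := by
      have hVA : 0 < v Q + A Q := by linarith [ha Q]
      have hV2 : v Q + A Q ≤ 2 * v Q := by linarith [hAv Q]
      have h4 : a Q * (1 / v Q) ^ 2 + 4 * (1 / (v Q + A Q)) ≤ 4 * (1 / W) := by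
        have h5 : 4 * (1 / W) - 4 * (1 / (v Q + A Q)) =
            4 * (v Q + A Q - W) / (W * (v Q + A Q)) := by
          field_simp
        have h6 : a Q * (1 / v Q) ^ 2 ≤ 4 * (v Q + A Q - W) / (W * (v Q + A Q)) := by
          rw [le_div_iff₀ (by positivity), div_pow, one_pow, mul_one_div, div_mul_eq_mul_div,
            div_le_iff₀ (by positivity)]
          have h7 : W * (v Q + A Q) ≤ 4 * v Q ^ 2 := by nlinarith [ha Q]
          have h8 : a Q * (W * (v Q + A Q)) ≤ a Q * (4 * v Q ^ 2) :=
            mul_le_mul_of_nonneg_left h7 (ha Q)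
          have h9 : a Q * (4 * v Q ^ 2) ≤ (v Q + A Q - W) * (4 * v Q ^ 2) :=
            mul_le_mul_of_nonneg_right (by linarith) (by positivity)
          linarith
        linarith
      have h10 := mul_le_mul_of_nonneg_left h4 (sq_nonneg (x Q))
      calc _ = x Q ^ 2 * (a Q * (1 / v Q) ^ 2 + 4 * (1 / (v Q + A Q))) := by ring
        _ ≤ _ := h10
        _ = _ := by ring
    linarith

theorem tsum_level_subtreeSum (gen : I → ℤ) (hbij : Function.Bijective fun a : I × J => ch a.1 a.2)
    (hgen : ∀ Q j, gen (ch Q j) = gen Q + 1) (u : I → ℝ≥0∞) (N : ℕ) (k : ℤ) :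
    ∑' Q, (if gen Q = k then subtreeSum ch u N Q else 0) =
      ∑' Q, if k ≤ gen Q ∧ gen Q < k + N then u Q else 0 := by
  induction N generalizing k with
  | zero =>
    have h0 (Q : I) : ¬ (k ≤ gen Q ∧ gen Q < k + (0 : ℕ)) := by push_cast; omega
    simp only [h0, if_false, subtreeSum, ite_self]
  | succ N ih =>
    have h1 : ∑' Q, (if gen Q = k then ∑ j, subtreeSum ch u N (ch Q j) else 0) =
        ∑' Q, if gen Q = k + 1 then subtreeSum ch u N Q else 0 := by
      rw [← (Equiv.ofBijective _ hbij).tsum_eq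
        (fun Q => if gen Q = k + 1 then subtreeSum ch u N Q else 0)]
      simp only [Equiv.ofBijective_apply, hgen, add_left_inj]
      rw [ENNReal.tsum_prod (f := fun Q j => if gen Q = k then subtreeSum ch u N (ch Q j) else 0)]
      refine tsum_congr fun Q => ?_
      rw [tsum_fintype]
      split_ifs <;> simp
    have h2 (Q : I) : (if gen Q = k then subtreeSum ch u (N + 1) Q else 0) =
        (if gen Q = k then u Q else 0) +
          if gen Q = k then ∑ j, subtreeSum ch u N (ch Q j) else 0 := by
      simp only [subtreeSum]
      split_ifs <;> simp
    simp only [h2]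
    rw [ENNReal.tsum_add, h1, ih, ← ENNReal.tsum_add]
    refine tsum_congr fun Q => ?_
    push_cast
    by_cases hQ : gen Q = k
    · rw [if_pos hQ, if_neg (by omega), if_pos (by omega), add_zero]
    · rw [if_neg hQ, zero_add]
      congr 1
      apply propext; omega

/-- A bound for a sum over the whole tree from bounds for all subtrees, when the bounds have uniformly
bounded sums over each generation. -/
theorem tsum_le_of_subtreeSum_le (gen : I → ℤ)
    (hbij : Function.Bijective fun a : I × J => ch a.1 a.2)
    (hgen : ∀ Q j, gen (ch Q j) = gen Q + 1) {u F : I → ℝ≥0∞} {B : ℝ≥0∞}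
    (hF : ∀ k, ∑' Q, (if gen Q = k then F Q else 0) ≤ B)
    (hu : ∀ N Q, subtreeSum ch u N Q ≤ F Q) : ∑' Q, u Q ≤ B := by
  refine ENNReal.summable.tsum_le_of_sum_le fun s => ?_
  obtain ⟨k, hk⟩ : ∃ k : ℕ, ∀ Q ∈ s, (gen Q).natAbs ≤ k :=
    ⟨s.sup fun Q => (gen Q).natAbs, fun Q hQ => Finset.le_sup (f := fun Q => (gen Q).natAbs) hQ⟩
  calc ∑ Q ∈ s, u Q
      = ∑ Q ∈ s, if -(k : ℤ) ≤ gen Q ∧ gen Q < -k + (2 * k + 1 : ℕ) then u Q else 0 := by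
        refine Finset.sum_congr rfl fun Q hQ => ?_
        have := hk Q hQ
        rw [if_pos]; push_cast; omega
    _ ≤ ∑' Q, if -(k : ℤ) ≤ gen Q ∧ gen Q < -k + (2 * k + 1 : ℕ) then u Q else 0 :=
        ENNReal.sum_le_tsum s
    _ = ∑' Q, (if gen Q = -(k : ℤ) then subtreeSum ch u (2 * k + 1) Q else 0) :=
        (tsum_level_subtreeSum gen hbij hgen u _ _).symm
    _ ≤ ∑' Q, (if gen Q = -(k : ℤ) then F Q else 0) := by
        refine ENNReal.tsum_le_tsum fun Q => ?_
        split_ifs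
        · exact hu _ Q
        · exact le_rfl
    _ ≤ B := hF _

theorem ofReal_subtreeSum {u : I → ℝ} (hu : ∀ Q, 0 ≤ u Q) (N : ℕ) (Q : I) :
    0 ≤ subtreeSum ch u N Q ∧
    subtreeSum ch (fun Q => ENNReal.ofReal (u Q)) N Q = ENNReal.ofReal (subtreeSum ch u N Q) := by
  induction N generalizing Q with
  | zero => simp [subtreeSum]
  | succ N ih =>
    have h0 : 0 ≤ ∑ j, subtreeSum ch u N (ch Q j) := Finset.sum_nonneg fun j _ => (ih _).1
    refine ⟨add_nonneg (hu Q) h0, ?_⟩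
    simp only [subtreeSum]
    rw [ENNReal.ofReal_add (hu Q) h0, ENNReal.ofReal_sum_of_nonneg fun j _ => (ih _).1]
    congr 1
    exact Finset.sum_congr rfl fun j _ => (ih _).2

/-- The Carleson embedding theorem for the coefficients `β Q` with `γ Q ≤ t`. Here `G` majorizes
the averages `(1 / v Q) ∑_{R ⊆ Q} β R v R`; as `min G t` is a majorant for the restricted
coefficients, these satisfy the Carleson condition with the constant `t`. -/
theorem tsum_carleson_le (gen : I → ℤ) (hbij : Function.Bijective fun a : I × J => ch a.1 a.2)
    (hgen : ∀ Q j, gen (ch Q j) = gen Q + 1) {β γ G x F : I → ℝ} (hv : ∀ Q, 0 < v Q)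
    (haddv : ∀ Q, ∑ j, v (ch Q j) = v Q) (haddx : ∀ Q, ∑ j, x (ch Q j) = x Q)
    (haddF : ∀ Q, ∑ j, F (ch Q j) = F Q) (hx : ∀ Q, x Q ^ 2 ≤ F Q * v Q)
    (hβ : ∀ Q, 0 ≤ β Q) (hG0 : ∀ Q, 0 ≤ G Q)
    (hG : ∀ Q, β Q * v Q + ∑ j, v (ch Q j) * G (ch Q j) ≤ v Q * G Q) (hGγ : ∀ Q, G Q ≤ γ Q)
    {t : ℝ} (ht : 0 < t) {B : ℝ}
    (hF : ∀ k, ∑' Q, (if gen Q = k then ENNReal.ofReal (F Q) else 0) ≤ ENNReal.ofReal B) :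
    ∑' Q, (if γ Q ≤ t then ENNReal.ofReal (β Q * (x Q ^ 2 / v Q)) else 0) ≤
      ENNReal.ofReal (4 * t * B) := by
  set a : I → ℝ := fun Q => if γ Q ≤ t then β Q * v Q / t else 0 with ha_def
  set A : I → ℝ := fun Q => v Q * (min (G Q) t / t) with hA_def
  have ha (Q : I) : 0 ≤ a Q := by
    simp only [ha_def]
    split_ifs
    · exact div_nonneg (mul_nonneg (hβ Q) (hv Q).le) ht.le
    · exact le_rfl
  have hA0 (Q : I) : 0 ≤ A Q :=
    mul_nonneg (hv Q).le (div_nonneg (le_min (hG0 Q) ht.le) ht.le)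
  have hAv (Q : I) : A Q ≤ v Q :=
    mul_le_of_le_one_right (hv Q).le ((div_le_one ht).2 (min_le_right _ _))
  have hA (Q : I) : a Q + ∑ j, A (ch Q j) ≤ A Q := by
    by_cases hGt : G Q ≤ t
    · have h1 : a Q ≤ β Q * v Q / t := by
        simp only [ha_def]
        split_ifs
        · exact le_rfl
        · exact div_nonneg (mul_nonneg (hβ Q) (hv Q).le) ht.le
      have h2 : ∑ j, A (ch Q j) ≤ (∑ j, v (ch Q j) * G (ch Q j)) / t := by
        rw [Finset.sum_div]
        refine Finset.sum_le_sum fun j _ => ?_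
        rw [mul_div_assoc]
        exact mul_le_mul_of_nonneg_left (div_le_div_of_nonneg_right (min_le_left _ _) ht.le)
          (hv _).le
      have h3 : A Q = v Q * G Q / t := by
        simp only [hA_def, min_eq_left hGt, mul_div_assoc]
      rw [h3]
      refine (add_le_add h1 h2).trans ?_
      rw [← add_div]
      exact div_le_div_of_nonneg_right (hG Q) ht.le
    · have h1 : a Q = 0 := by
        simp only [ha_def]
        rw [if_neg]
        exact fun h => hGt ((hGγ Q).trans h)
      have h3 : A Q = v Q := by
        simp only [hA_def, min_eq_right (not_le.1 hGt).le, div_self ht.ne', mul_one]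
      rw [h1, h3, zero_add]
      exact (Finset.sum_le_sum fun j _ => hAv _).trans (haddv Q).le
  have hu0 (Q : I) : 0 ≤ a Q * (x Q / v Q) ^ 2 := mul_nonneg (ha Q) (sq_nonneg _)
  have hmain : ∑' Q, ENNReal.ofReal (a Q * (x Q / v Q) ^ 2) ≤ ENNReal.ofReal (4 * B) := by
    refine tsum_le_of_subtreeSum_le gen hbij hgen (F := fun Q => ENNReal.ofReal (4 * F Q))
      (fun k => ?_) (fun N Q => ?_)
    · calc _ = ∑' Q, ENNReal.ofReal 4 * (if gen Q = k then ENNReal.ofReal (F Q) else 0) := by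
            refine tsum_congr fun Q => ?_
            rw [ENNReal.ofReal_mul (by norm_num)]
            split_ifs <;> simp
        _ ≤ _ := by
            rw [ENNReal.tsum_mul_left, ENNReal.ofReal_mul (by norm_num)]
            gcongr
            exact hF k
    · rw [(ofReal_subtreeSum hu0 N Q).2]
      refine ENNReal.ofReal_le_ofReal ?_
      have h1 := subtreeSum_carleson_le hv haddv haddx haddF hx ha hA0 hA hAv N Q
      have h2 : 0 ≤ x Q ^ 2 / (v Q + A Q) :=
        div_nonneg (sq_nonneg _) (add_nonneg (hv Q).le (hA0 Q))
      linarith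
  calc _ = ∑' Q, ENNReal.ofReal t * ENNReal.ofReal (a Q * (x Q / v Q) ^ 2) := by
        refine tsum_congr fun Q => ?_
        rw [← ENNReal.ofReal_mul ht.le]
        simp only [ha_def]
        split_ifs
        · congr 1
          have := (hv Q).ne'
          field_simp
        · simp
    _ ≤ ENNReal.ofReal t * ENNReal.ofReal (4 * B) := by
        rw [ENNReal.tsum_mul_left]; gcongr
    _ = _ := by
        rw [← ENNReal.ofReal_mul ht.le]; congr 1; ring

end Tree

/-! ### The tree of dyadic cubes -/

section Dyadic

variable {n : ℕ} (D : DyadicSystem n)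

/-- The position of the cube of generation `k` which contains `x`. -/
def position (k : ℤ) (x : Rn n) (i : Fin n) : ℤ := ⌊(2 : ℝ) ^ k * x i - D.shift k i⌋

/-- The integer `2 α_k - α_{k+1}`. -/
def carry (k : ℤ) (i : Fin n) : ℤ := (D.nested k i).choose

theorem two_mul_shift_sub (k : ℤ) (i : Fin n) :
    2 * D.shift k i - D.shift (k + 1) i = carry D k i := (D.nested k i).choose_spec

/-- The `j`-th child of a dyadic cube, with `j i = 0` for the lower and `j i = 1` for the upper
half of the cube in the `i`-th direction. -/
def child (Q : CubeIndex n) (j : Fin n → Fin 2) : CubeIndex n :=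
  (Q.1 + 1, fun i => 2 * Q.2 i + carry D Q.1 i + ((j i : ℕ) : ℤ))

theorem side_pos (Q : CubeIndex n) : 0 < side Q := zpow_pos two_pos _

theorem side_child (Q : CubeIndex n) (j : Fin n → Fin 2) :
    side (child D Q j) = side Q / 2 := by
  simp only [side, child, neg_add, zpow_add₀ (two_ne_zero' ℝ), zpow_neg_one]
  rfl

theorem mem_dyadicCube_iff {Q : CubeIndex n} {x : Rn n} :
    x ∈ dyadicCube D Q ↔ position D Q.1 x = Q.2 := by
  rw [funext_iff]
  refine forall_congr' fun i => ?_
  have h2 : (2 : ℝ) ^ Q.1 * side Q = 1 := by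
    rw [side, ← zpow_add₀ (two_ne_zero' ℝ), add_neg_cancel, zpow_zero]
  have hs := side_pos Q
  have hp : (0 : ℝ) < 2 ^ Q.1 := zpow_pos two_pos _
  have hx : x i = side Q * ((2 : ℝ) ^ Q.1 * x i) := by
    rw [← mul_assoc, mul_comm (side Q), h2, one_mul]
  rw [position, Int.floor_eq_iff, Set.mem_Ico, corner]
  constructor
  · rintro ⟨h3, h4⟩
    rw [hx] at h3 h4
    have h5 := le_of_mul_le_mul_left h3 hs
    have h6 : side Q * ((2 : ℝ) ^ Q.1 * x i) < side Q * (Q.2 i + D.shift Q.1 i + 1) := by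
      linarith
    have h7 := lt_of_mul_lt_mul_left h6 hs.le
    constructor <;> linarith
  · rintro ⟨h3, h4⟩
    rw [hx]
    have h5 : side Q * (Q.2 i + D.shift Q.1 i) ≤ side Q * ((2 : ℝ) ^ Q.1 * x i) :=
      mul_le_mul_of_nonneg_left (by linarith) hs.le
    have h6 : side Q * ((2 : ℝ) ^ Q.1 * x i) < side Q * (Q.2 i + D.shift Q.1 i + 1) :=
      mul_lt_mul_of_pos_left (by linarith) hs
    constructor <;> linarith

/-- The position of the parent in terms of that of a child; this is where the nestedness of the
system is used. -/
theorem position_eq_ediv (k : ℤ) (x : Rn n) (i : Fin n) :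
    position D k x i = (position D (k + 1) x i - carry D k i) / 2 := by
  have h1 : (2 : ℝ) ^ (k + 1) * x i - D.shift (k + 1) i =
      2 * ((2 : ℝ) ^ k * x i - D.shift k i) + (carry D k i : ℝ) := by
    rw [← two_mul_shift_sub, zpow_add_one₀ (two_ne_zero' ℝ)]; ring
  rw [position, position, h1, Int.floor_add_intCast, add_sub_cancel_right]
  set y := (2 : ℝ) ^ k * x i - D.shift k i
  have h2 := Int.floor_le y
  have h3 := Int.lt_floor_add_one y
  have h4 := Int.floor_le (2 * y)
  have h5 := Int.lt_floor_add_one (2 * y)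
  have h6 : 2 * ⌊y⌋ < ⌊2 * y⌋ + 1 := by
    have : (2 * (⌊y⌋ : ℝ)) < ⌊2 * y⌋ + 1 := by linarith
    exact_mod_cast this
  have h7 : ⌊2 * y⌋ < 2 * ⌊y⌋ + 2 := by
    have : (⌊2 * y⌋ : ℝ) < 2 * ⌊y⌋ + 2 := by linarith
    exact_mod_cast this
  omega

theorem position_eq_of_le {k l : ℤ} (hkl : k ≤ l) {x y : Rn n}
    (h : position D l x = position D l y) : position D k x = position D k y := by
  obtain ⟨d, rfl⟩ := Int.le.dest hkl
  clear hkl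
  induction d with
  | zero => simpa using h
  | succ d ih =>
    refine ih ?_
    funext i
    rw [position_eq_ediv, position_eq_ediv D _ y]
    have : k + (d : ℤ) + 1 = k + ((d + 1 : ℕ) : ℤ) := by push_cast; ring
    rw [this, h]

/-- Every dyadic cube is the child of exactly one cube. -/
theorem child_bijective : Function.Bijective
    fun a : CubeIndex n × (Fin n → Fin 2) => child D a.1 a.2 := by
  constructor
  · rintro ⟨⟨k, m⟩, j⟩ ⟨⟨k', m'⟩, j'⟩ h
    simp only [child, Prod.mk.injEq, add_left_inj] at h
    obtain ⟨rfl, h⟩ := h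
    have h1 (i : Fin n) : m i = m' i ∧ j i = j' i := by
      have := congrFun h i
      have h2 := (j i).2
      have h3 := (j' i).2
      constructor
      · omega
      · apply Fin.ext; omega
    rw [funext fun i => (h1 i).1, funext fun i => (h1 i).2]
  · rintro ⟨k, m⟩
    refine ⟨((k - 1, fun i => (m i - carry D (k - 1) i) / 2),
      fun i => ⟨((m i - carry D (k - 1) i) % 2).toNat, by omega⟩), ?_⟩
    simp only [child, sub_add_cancel, Prod.mk.injEq, true_and]
    funext i
    have : 0 ≤ (m i - carry D (k - 1) i) % 2 := Int.emod_nonneg _ two_ne_zero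
    rw [Int.toNat_of_nonneg this]
    omega

theorem mem_of_mem_child {Q : CubeIndex n} {j : Fin n → Fin 2} {x : Rn n}
    (hx : x ∈ dyadicCube D (child D Q j)) : x ∈ dyadicCube D Q := by
  rw [mem_dyadicCube_iff] at hx ⊢
  funext i
  rw [position_eq_ediv]
  have := congrFun hx i
  simp only [child] at this
  rw [this]
  have := (j i).2
  omega

theorem exists_mem_child {Q : CubeIndex n} {x : Rn n} (hx : x ∈ dyadicCube D Q) :
    ∃ j, x ∈ dyadicCube D (child D Q j) := by
  rw [mem_dyadicCube_iff] at hx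
  refine ⟨fun i => ⟨((position D (Q.1 + 1) x i - carry D Q.1 i) % 2).toNat, by omega⟩, ?_⟩
  rw [mem_dyadicCube_iff]
  funext i
  simp only [child]
  have h1 := congrFun hx i
  rw [position_eq_ediv] at h1
  have : 0 ≤ (position D (Q.1 + 1) x i - carry D Q.1 i) % 2 := Int.emod_nonneg _ two_ne_zero
  rw [Int.toNat_of_nonneg this]
  omega

theorem dyadicCube_eq_iUnion (Q : CubeIndex n) :
    dyadicCube D Q = ⋃ j, dyadicCube D (child D Q j) := by
  ext x
  rw [Set.mem_iUnion]
  exact ⟨exists_mem_child D, fun ⟨_, hj⟩ => mem_of_mem_child D hj⟩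

theorem child_subset (Q : CubeIndex n) (j : Fin n → Fin 2) :
    dyadicCube D (child D Q j) ⊆ dyadicCube D Q := fun _ => mem_of_mem_child D

theorem disjoint_dyadicCube {Q R : CubeIndex n} (hgen : Q.1 = R.1) (hne : Q ≠ R) :
    Disjoint (dyadicCube D Q) (dyadicCube D R) := by
  rw [Set.disjoint_left]
  intro x hQ hR
  rw [mem_dyadicCube_iff] at hQ hR
  refine hne (Prod.ext hgen ?_)
  rw [← hQ, ← hR, hgen]

theorem pairwise_disjoint_child (Q : CubeIndex n) :
    Pairwise fun i j => Disjoint (dyadicCube D (child D Q i)) (dyadicCube D (child D Q j)) := by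
  intro i j hij
  refine disjoint_dyadicCube D rfl fun h => hij ?_
  exact (Prod.mk.inj ((child_bijective D).1 (a₁ := (Q, i)) (a₂ := (Q, j)) h)).2

/-! ### Lebesgue measure of cubes -/

theorem cube_eq_preimage (a : Fin n → ℝ) (l : ℝ) :
    cube a l = (MeasurableEquiv.toLp 2 (Fin n → ℝ)).symm ⁻¹'
      Set.univ.pi fun i => Set.Ico (a i) (a i + l) := by
  ext x
  simp [cube]

theorem measurableSet_cube (a : Fin n → ℝ) (l : ℝ) : MeasurableSet (cube a l) := by
  rw [cube_eq_preimage]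
  exact (MeasurableEquiv.measurable _) (MeasurableSet.univ_pi fun i => measurableSet_Ico)

theorem volume_cube (a : Fin n → ℝ) (l : ℝ) : volume (cube a l) = ENNReal.ofReal l ^ n := by
  rw [cube_eq_preimage,
    (EuclideanSpace.volume_preserving_symm_measurableEquiv_toLp (Fin n)).measure_preimage
      (MeasurableSet.univ_pi fun i => measurableSet_Ico).nullMeasurableSet, Real.volume_pi_Ico]
  simp

theorem measurableSet_dyadicCube (Q : CubeIndex n) : MeasurableSet (dyadicCube D Q) :=
  measurableSet_cube _ _

theorem volume_real_dyadicCube (Q : CubeIndex n) : volume.real (dyadicCube D Q) = side Q ^ n := by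
  rw [Measure.real, dyadicCube, volume_cube, ENNReal.toReal_pow,
    ENNReal.toReal_ofReal (side_pos Q).le]

theorem volume_cube_lt_top (a : Fin n → ℝ) (l : ℝ) : volume (cube a l) < ∞ := by
  rw [volume_cube]; exact ENNReal.pow_lt_top ENNReal.ofReal_lt_top

theorem cube_subset_ball (a : Fin n → ℝ) {l : ℝ} (hl : 0 < l) :
    cube a l ⊆ Metric.ball (WithLp.toLp 2 a) ((n + 1) * l) := by
  intro x hx
  rw [Metric.mem_ball, EuclideanSpace.dist_eq]
  have hx' (i : Fin n) : dist (x i) (a i) ^ 2 ≤ l ^ 2 := by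
    have := hx i
    rw [Real.dist_eq, sq_abs]
    rw [Set.mem_Ico] at this
    nlinarith
  have h1 : ∑ i, dist (x i) (a i) ^ 2 ≤ n * l ^ 2 := by
    calc _ ≤ ∑ _i : Fin n, l ^ 2 := Finset.sum_le_sum fun i _ => hx' i
      _ = _ := by simp
  refine (Real.sqrt_le_sqrt h1).trans_lt ?_
  rw [Real.sqrt_lt' (by positivity)]
  have : (0 : ℝ) ≤ n := Nat.cast_nonneg n
  nlinarith [sq_pos_of_pos hl, mul_nonneg this (sq_nonneg l), mul_nonneg (mul_nonneg this this) (sq_nonneg l)]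

theorem ball_subset_cube (x : Rn n) (r : ℝ) :
    Metric.ball x r ⊆ cube (fun i => x i - r) (2 * r) := by
  intro y hy i
  rw [Metric.mem_ball, dist_eq_norm] at hy
  have h1 : ‖(y - x) i‖ ≤ ‖y - x‖ := PiLp.norm_apply_le _ i
  have h2 : |y i - x i| < r := by
    have : (y - x) i = y i - x i := rfl
    rw [this, Real.norm_eq_abs] at h1
    linarith
  rw [abs_lt] at h2
  rw [Set.mem_Ico]
  constructor <;> linarith

theorem integrableOn_cube {E : Type*} [NormedAddCommGroup E] {f : Rn n → E}
    (hf : LocallyIntegrable f) (a : Fin n → ℝ) {l : ℝ} (hl : 0 < l) : IntegrableOn f (cube a l) :=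
  (hf.integrableOn_isCompact (isCompact_closedBall _ _)).mono_set
    ((cube_subset_ball a hl).trans Metric.ball_subset_closedBall)

theorem sum_integral_child {E : Type*} [NormedAddCommGroup E] [NormedSpace ℝ E] {f : Rn n → E}
    {Q : CubeIndex n} (hf : IntegrableOn f (dyadicCube D Q)) :
    ∑ j, ∫ x in dyadicCube D (child D Q j), f x = ∫ x in dyadicCube D Q, f x := by
  rw [dyadicCube_eq_iUnion D Q, integral_iUnion_fintype (fun j => measurableSet_dyadicCube D _)
    (pairwise_disjoint_child D Q) fun j => hf.mono_set (child_subset D Q j)]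

theorem tsum_level_lintegral_le (f : Rn n → ℝ≥0∞) (k : ℤ) :
    ∑' Q : CubeIndex n, (if Q.1 = k then ∫⁻ x in dyadicCube D Q, f x else 0) ≤ ∫⁻ x, f x := by
  rw [ENNReal.tsum_prod (f := fun l m => if l = k then ∫⁻ x in dyadicCube D (l, m), f x else 0),
    tsum_eq_single k (fun l hl => by simp [hl])]
  simp only [if_true]
  rw [← lintegral_iUnion (fun m => measurableSet_dyadicCube D _)]
  · exact setLIntegral_le_lintegral _ _
  · intro m m' hm
    exact disjoint_dyadicCube D rfl fun h => hm (Prod.mk.inj h).2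

/-! ### Step functions and Haar functions -/

/-- The function with the value `c j` on the `j`-th child of `Q`, and `0` off `Q`. -/
def step (Q : CubeIndex n) (c : (Fin n → Fin 2) → ℝ) (x : Rn n) : ℝ :=
  ∑ j, (dyadicCube D (child D Q j)).indicator (fun _ => c j) x

theorem step_of_mem {Q : CubeIndex n} {j : Fin n → Fin 2} {x : Rn n}
    (hx : x ∈ dyadicCube D (child D Q j)) (c : (Fin n → Fin 2) → ℝ) : step D Q c x = c j := by
  rw [step, Finset.sum_eq_single j, Set.indicator_of_mem hx]
  · intro i _ hij
    exact Set.indicator_of_notMem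
      (fun hi => Set.disjoint_left.1 (pairwise_disjoint_child D Q hij) hi hx) _
  · simp

theorem step_of_notMem {Q : CubeIndex n} {x : Rn n} (hx : x ∉ dyadicCube D Q)
    (c : (Fin n → Fin 2) → ℝ) : step D Q c x = 0 :=
  Finset.sum_eq_zero fun _ _ => Set.indicator_of_notMem (fun h => hx (mem_of_mem_child D h)) _

theorem step_mul_step (Q : CubeIndex n) (c d : (Fin n → Fin 2) → ℝ) (x : Rn n) :
    step D Q c x * step D Q d x = step D Q (fun j => c j * d j) x := by
  by_cases hx : x ∈ dyadicCube D Q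
  · obtain ⟨j, hj⟩ := exists_mem_child D hx
    simp only [step_of_mem D hj]
  · simp only [step_of_notMem D hx, mul_zero]

theorem step_const (Q : CubeIndex n) (c : ℝ) (x : Rn n) :
    step D Q (fun _ => c) x = (dyadicCube D Q).indicator (fun _ => c) x := by
  by_cases hx : x ∈ dyadicCube D Q
  · obtain ⟨j, hj⟩ := exists_mem_child D hx
    rw [step_of_mem D hj, Set.indicator_of_mem hx]
  · rw [step_of_notMem D hx, Set.indicator_of_notMem hx]

theorem abs_step_le (Q : CubeIndex n) {c : (Fin n → Fin 2) → ℝ} {A : ℝ} (hc : ∀ j, |c j| ≤ A)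
    (x : Rn n) : |step D Q c x| ≤ (dyadicCube D Q).indicator (fun _ => A) x := by
  by_cases hx : x ∈ dyadicCube D Q
  · obtain ⟨j, hj⟩ := exists_mem_child D hx
    rw [step_of_mem D hj, Set.indicator_of_mem hx]
    exact hc j
  · rw [step_of_notMem D hx, Set.indicator_of_notMem hx, abs_zero]

theorem step_eq_of_position_eq (Q : CubeIndex n) (c : (Fin n → Fin 2) → ℝ) {x y : Rn n}
    (h : position D (Q.1 + 1) x = position D (Q.1 + 1) y) : step D Q c x = step D Q c y := by
  have h' (j : Fin n → Fin 2) :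
      x ∈ dyadicCube D (child D Q j) ↔ y ∈ dyadicCube D (child D Q j) := by
    rw [mem_dyadicCube_iff, mem_dyadicCube_iff]
    change position D (Q.1 + 1) x = _ ↔ position D (Q.1 + 1) y = _
    rw [h]
  refine Finset.sum_congr rfl fun j _ => ?_
  by_cases hx : x ∈ dyadicCube D (child D Q j)
  · rw [Set.indicator_of_mem hx, Set.indicator_of_mem ((h' j).1 hx)]
  · rw [Set.indicator_of_notMem hx, Set.indicator_of_notMem fun hy => hx ((h' j).2 hy)]

theorem integral_mul_step {f : Rn n → ℂ} {Q : CubeIndex n} (hf : IntegrableOn f (dyadicCube D Q))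
    (c : (Fin n → Fin 2) → ℝ) :
    ∫ x, f x * (step D Q c x : ℂ) = ∑ j, (c j : ℂ) * ∫ x in dyadicCube D (child D Q j), f x := by
  have h1 (x : Rn n) : f x * (step D Q c x : ℂ) =
      ∑ j, (dyadicCube D (child D Q j)).indicator (fun x => (c j : ℂ) * f x) x := by
    rw [step, Complex.ofReal_sum, Finset.mul_sum]
    refine Finset.sum_congr rfl fun j _ => ?_
    by_cases hx : x ∈ dyadicCube D (child D Q j)
    · rw [Set.indicator_of_mem hx, Set.indicator_of_mem hx, mul_comm]
    · rw [Set.indicator_of_notMem hx, Set.indicator_of_notMem hx]; simp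
  simp only [h1]
  rw [integral_finsetSum]
  · refine Finset.sum_congr rfl fun j _ => ?_
    rw [integral_indicator (measurableSet_dyadicCube D _), integral_const_mul]
  · intro j _
    have : IntegrableOn (fun x => (c j : ℂ) * f x) (dyadicCube D (child D Q j)) :=
      Integrable.const_mul (hf.mono_set (child_subset D Q j)) _
    exact this.integrable_indicator (measurableSet_dyadicCube D _)

end Dyadic

/-- The sign of the Haar function of signature `ε` on the `j`-th child of a cube. -/
def haarSign {n : ℕ} (ε j : Fin n → Fin 2) : ℝ :=
  ∏ i, if ε i = 1 then 1 else if j i = 0 then 1 else -1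

/-- The signature of the product of the Haar functions of signatures `ε` and `η` of a cube. -/
def mulSig {n : ℕ} (ε η : Fin n → Fin 2) : Fin n → Fin 2 := fun i => if ε i = η i then 1 else 0

theorem abs_haarSign {n : ℕ} (ε j : Fin n → Fin 2) : |haarSign ε j| = 1 := by
  rw [haarSign, Finset.abs_prod]
  refine Finset.prod_eq_one fun i _ => ?_
  split_ifs <;> simp

theorem haarSign_one {n : ℕ} (j : Fin n → Fin 2) : haarSign 1 j = 1 := by simp [haarSign]

theorem haarSign_mul {n : ℕ} (ε η j : Fin n → Fin 2) :
    haarSign ε j * haarSign η j = haarSign (mulSig ε η) j := by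
  rw [haarSign, haarSign, haarSign, ← Finset.prod_mul_distrib]
  have key (a b c : Fin 2) : ((if a = 1 then (1 : ℝ) else if c = 0 then 1 else -1) *
      if b = 1 then 1 else if c = 0 then 1 else -1) =
      if (if a = b then (1 : Fin 2) else 0) = 1 then 1 else if c = 0 then 1 else -1 := by
    fin_cases a <;> fin_cases b <;> fin_cases c <;> simp
  exact Finset.prod_congr rfl fun i _ => key _ _ _

/-- The signs `haarSign ε j`, as a matrix indexed by `ε` and `j`, have orthogonal rows. -/
theorem sum_haarSign_mul {n : ℕ} (ε η : Fin n → Fin 2) :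
    ∑ j, haarSign ε j * haarSign η j = if ε = η then 2 ^ n else 0 := by
  simp only [haarSign, ← Finset.prod_mul_distrib]
  rw [← Fintype.piFinset_univ, ← Finset.prod_univ_sum (fun _ => Finset.univ) (fun i c =>
    (if ε i = 1 then (1 : ℝ) else if c = 0 then 1 else -1) *
      if η i = 1 then 1 else if c = 0 then 1 else -1)]
  have h1 (i : Fin n) : ∑ c : Fin 2, ((if ε i = 1 then (1 : ℝ) else if c = 0 then 1 else -1) *
      if η i = 1 then 1 else if c = 0 then 1 else -1) = if ε i = η i then 2 else 0 := by
    generalize ε i = a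
    generalize η i = b
    fin_cases a <;> fin_cases b <;> norm_num
  simp only [h1]
  split_ifs with h
  · simp [h]
  · obtain ⟨i, hi⟩ := Function.ne_iff.1 h
    exact Finset.prod_eq_zero (Finset.mem_univ i) (if_neg hi)

theorem sum_haarSign {n : ℕ} {ε : Fin n → Fin 2} (hε : ε ≠ 1) : ∑ j, haarSign ε j = 0 := by
  have := sum_haarSign_mul ε 1
  simpa [haarSign_one, hε] using this

/-- The signs `haarSign ε j`, as a matrix indexed by `ε` and `j`, have orthogonal columns. -/
theorem sum_haarSign_mul_right {n : ℕ} (j j' : Fin n → Fin 2) :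
    ∑ ε, haarSign ε j * haarSign ε j' = if j = j' then 2 ^ n else 0 := by
  simp only [haarSign, ← Finset.prod_mul_distrib]
  rw [← Fintype.piFinset_univ, ← Finset.prod_univ_sum (fun _ => Finset.univ) (fun i c =>
    (if c = 1 then (1 : ℝ) else if j i = 0 then 1 else -1) *
      if c = 1 then 1 else if j' i = 0 then 1 else -1)]
  have h1 (i : Fin n) : ∑ c : Fin 2, ((if c = 1 then (1 : ℝ) else if j i = 0 then 1 else -1) *
      if c = 1 then 1 else if j' i = 0 then 1 else -1) = if j i = j' i then 2 else 0 := by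
    generalize j i = a
    generalize j' i = b
    fin_cases a <;> fin_cases b <;> norm_num
  simp only [h1]
  split_ifs with h
  · simp [h]
  · obtain ⟨i, hi⟩ := Function.ne_iff.1 h
    exact Finset.prod_eq_zero (Finset.mem_univ i) (if_neg hi)

theorem mulSig_mulSig {n : ℕ} (ε η : Fin n → Fin 2) : mulSig (mulSig ε η) η = ε := by
  funext i
  have key (a b : Fin 2) :
      (if (if a = b then (1 : Fin 2) else 0) = b then (1 : Fin 2) else 0) = a := by
    fin_cases a <;> fin_cases b <;> simp
  exact key _ _

theorem mulSig_ne_one {n : ℕ} {ε η : Fin n → Fin 2} (h : ε ≠ η) : mulSig ε η ≠ 1 := by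
  obtain ⟨i, hi⟩ := Function.ne_iff.1 h
  intro h1
  have := congrFun h1 i
  simp [mulSig, hi] at this

theorem haar_eq_step {n : ℕ} (D : DyadicSystem n) (Q : CubeIndex n) (ε : Fin n → Fin 2) (x : Rn n) :
    haar D Q ε x = step D Q (fun j => (Real.sqrt (side Q ^ n))⁻¹ * haarSign ε j) x := by
  by_cases hx : x ∈ dyadicCube D Q
  · obtain ⟨j, hj⟩ := exists_mem_child D hx
    rw [step_of_mem D hj, haar]
    have h1 : (Real.sqrt (side Q ^ n))⁻¹ = ∏ _i : Fin n, (Real.sqrt (side Q))⁻¹ := by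
      rw [Finset.prod_const, Finset.card_univ, Fintype.card_fin, inv_pow]
      congr 1
      rw [Real.sqrt_eq_iff_mul_self_eq (by have := side_pos Q; positivity) (by positivity),
        ← mul_pow, Real.mul_self_sqrt (side_pos Q).le]
    rw [haarSign, h1, ← Finset.prod_mul_distrib]
    refine Finset.prod_congr rfl fun i _ => ?_
    have h2 := hj i
    have h3 := hx i
    have hs := side_pos Q
    have h4 : corner D (child D Q j) i = corner D Q i + ((j i : ℕ) : ℝ) * (side Q / 2) := by
      rw [corner, corner, side_child]
      have := two_mul_shift_sub D Q.1 i
      simp only [child]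
      push_cast
      rw [← this]; ring
    rw [h4, side_child] at h2
    rw [haar₁]
    congr 1
    rw [Set.mem_Ico] at h2
    by_cases hε : ε i = 1
    · rw [if_pos hε, if_pos hε, Set.indicator_of_mem h3]; rfl
    rw [if_neg hε, if_neg hε]
    generalize j i = c at h2
    fin_cases c
    · simp only [Fin.zero_eta, Nat.cast_zero, zero_mul, add_zero, if_true] at h2 ⊢
      rw [Set.indicator_of_mem (Set.mem_Ico.2 h2), Set.indicator_of_notMem]
      · simp
      · rw [Set.mem_Ico]; intro h; linarith [h.1, h2.2]
    · simp only [Fin.mk_one, Nat.cast_one, one_mul, one_ne_zero, if_false] at h2 ⊢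
      rw [Set.indicator_of_notMem, Set.indicator_of_mem]
      · simp
      · rw [Set.mem_Ico]; constructor <;> linarith [h2.1, h2.2]
      · rw [Set.mem_Ico]; intro h; linarith [h.2, h2.1]
  · rw [step_of_notMem D hx, haar]
    obtain ⟨i, hi⟩ := not_forall.1 hx
    refine Finset.prod_eq_zero (Finset.mem_univ i) ?_
    have hs := side_pos Q
    rw [haar₁, Set.indicator_of_notMem hi, Set.indicator_of_notMem, Set.indicator_of_notMem]
    · simp
    · intro h; rw [Set.mem_Ico] at h hi; exact hi ⟨by linarith [h.1], h.2⟩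
    · intro h; rw [Set.mem_Ico] at h hi; exact hi ⟨h.1, by linarith [h.2]⟩

/-! ### Square roots of Muckenhoupt weights -/

/-- The Cauchy-Schwarz inequality for nonnegative functions, in terms of integrals of squares. -/
theorem sq_integral_mul_le {α : Type*} [MeasurableSpace α] {m : Measure α} {f g : α → ℝ}
    (hf0 : ∀ᵐ x ∂m, 0 ≤ f x) (hg0 : ∀ᵐ x ∂m, 0 ≤ g x) (hf : MemLp f 2 m) (hg : MemLp g 2 m) :
    (∫ x, f x * g x ∂m) ^ 2 ≤ (∫ x, f x ^ 2 ∂m) * ∫ x, g x ^ 2 ∂m := by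
  have hpq : (2 : ℝ).HolderConjugate 2 := Real.HolderConjugate.two_two
  have h2 : ENNReal.ofReal 2 = 2 := by simp
  have h := integral_mul_le_Lp_mul_Lq_of_nonneg hpq hf0 hg0 (by rwa [h2]) (by rwa [h2])
  simp only [Real.rpow_two, ← Real.sqrt_eq_rpow] at h
  have h0 : 0 ≤ ∫ x, f x * g x ∂m := by
    refine integral_nonneg_of_ae ?_
    filter_upwards [hf0, hg0] with x h1 h2 using mul_nonneg h1 h2
  calc _ ≤ (√(∫ x, f x ^ 2 ∂m) * √(∫ x, g x ^ 2 ∂m)) ^ 2 := pow_le_pow_left₀ h0 h 2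
    _ = _ := by
      rw [mul_pow, Real.sq_sqrt (integral_nonneg fun x => sq_nonneg _),
        Real.sq_sqrt (integral_nonneg fun x => sq_nonneg _)]

/-- `s` is the square root of a weight in `A₂` with constant at most `M`. Working with the square
roots `s = μ^(-1/2)` and `r = λ^(1/2)` makes the role of `μ` and `λ` symmetric, and this condition
is invariant under `s ↦ s⁻¹`. -/
structure HalfWeight {n : ℕ} (M : ℝ) (s : Rn n → ℝ) : Prop where
  aem : AEMeasurable s
  pos : ∀ᵐ x, 0 < s x
  int : ∀ (a : Fin n → ℝ) (l : ℝ), 0 < l → IntegrableOn (fun x => s x ^ 2) (cube a l)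
  int_inv : ∀ (a : Fin n → ℝ) (l : ℝ), 0 < l → IntegrableOn (fun x => (s x)⁻¹ ^ 2) (cube a l)
  a2 : ∀ (a : Fin n → ℝ) (l : ℝ), 0 < l →
    (∫ x in cube a l, s x ^ 2) * (∫ x in cube a l, (s x)⁻¹ ^ 2) ≤ M * (l ^ n) ^ 2

theorem HalfWeight.inv {n : ℕ} {M : ℝ} {s : Rn n → ℝ} (hs : HalfWeight M s) :
    HalfWeight M (fun x => (s x)⁻¹) where
  aem := hs.aem.inv
  pos := hs.pos.mono fun _ h => inv_pos.2 h
  int := hs.int_inv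
  int_inv := by simpa only [inv_inv] using hs.int
  a2 := fun a l hl => by simpa only [inv_inv, mul_comm] using hs.a2 a l hl

theorem HalfWeight.congr {n : ℕ} {M : ℝ} {s s' : Rn n → ℝ} (hs : HalfWeight M s)
    (h : s =ᵐ[volume] s') : HalfWeight M s' := by
  have h2 : (fun x => s x ^ 2) =ᵐ[volume] fun x => s' x ^ 2 := h.mono fun x hx => by
    simp only [hx]
  have h3 : (fun x => (s x)⁻¹ ^ 2) =ᵐ[volume] fun x => (s' x)⁻¹ ^ 2 := h.mono fun x hx => by
    simp only [hx]
  refine ⟨hs.aem.congr h, ?_, fun a l hl => ?_, fun a l hl => ?_, fun a l hl => ?_⟩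
  · filter_upwards [h, hs.pos] with x hx h0
    rwa [← hx]
  · exact (hs.int a l hl).congr (ae_restrict_of_ae h2)
  · exact (hs.int_inv a l hl).congr (ae_restrict_of_ae h3)
  · rw [← integral_congr_ae (ae_restrict_of_ae h2), ← integral_congr_ae (ae_restrict_of_ae h3)]
    exact hs.a2 a l hl

section Weight

variable {n : ℕ} {M : ℝ} {s r : Rn n → ℝ}

theorem volume_real_cube (a : Fin n → ℝ) {l : ℝ} (hl : 0 < l) :
    volume.real (cube a l) = l ^ n := by
  rw [Measure.real, volume_cube, ENNReal.toReal_pow, ENNReal.toReal_ofReal hl.le]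

theorem volume_cube_ne_zero (a : Fin n → ℝ) {l : ℝ} (hl : 0 < l) : volume (cube a l) ≠ 0 := by
  rw [volume_cube]
  exact pow_ne_zero _ (by simpa using hl)

theorem setIntegral_cube_pos {f : Rn n → ℝ} {a : Fin n → ℝ} {l : ℝ} (hl : 0 < l)
    (hf : IntegrableOn f (cube a l)) (hpos : ∀ᵐ x, 0 < f x) : 0 < ∫ x in cube a l, f x := by
  rw [setIntegral_pos_iff_support_of_nonneg_ae
    (ae_restrict_of_ae (hpos.mono fun _ h => h.le)) hf]
  have h1 : volume (Function.support f ∩ cube a l) = volume (cube a l) := by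
    refine measure_congr ?_
    filter_upwards [hpos] with x hx
    exact propext ⟨fun h => h.2, fun h => ⟨hx.ne', h⟩⟩
  rw [h1]
  exact pos_iff_ne_zero.2 (volume_cube_ne_zero a hl)

theorem HalfWeight.memLp (hs : HalfWeight M s) (a : Fin n → ℝ) {l : ℝ} (hl : 0 < l) :
    MemLp s 2 (volume.restrict (cube a l)) :=
  (memLp_two_iff_integrable_sq hs.aem.aestronglyMeasurable.restrict).2 (hs.int a l hl)

theorem HalfWeight.integral_pos (hs : HalfWeight M s) (a : Fin n → ℝ) {l : ℝ} (hl : 0 < l) :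
    0 < ∫ x in cube a l, s x ^ 2 :=
  setIntegral_cube_pos hl (hs.int a l hl) (hs.pos.mono fun _ h => by positivity)

theorem HalfWeight.sq_le (hs : HalfWeight M s) (a : Fin n → ℝ) {l : ℝ} (hl : 0 < l) :
    (l ^ n) ^ 2 ≤ (∫ x in cube a l, s x ^ 2) * ∫ x in cube a l, (s x)⁻¹ ^ 2 := by
  have h := sq_integral_mul_le (ae_restrict_of_ae (hs.pos.mono fun _ h => h.le))
    (ae_restrict_of_ae (hs.inv.pos.mono fun _ h => h.le)) (hs.memLp a hl) (hs.inv.memLp a hl)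
  refine le_trans (le_of_eq ?_) h
  have : ∫ x in cube a l, s x * (s x)⁻¹ = ∫ x in cube a l, (1 : ℝ) := by
    refine integral_congr_ae (ae_restrict_of_ae ?_)
    filter_upwards [hs.pos] with x hx using mul_inv_cancel₀ hx.ne'
  rw [this, setIntegral_const, volume_real_cube a hl, smul_eq_mul, mul_one]

/-- The doubling property of `A₂` weights. -/
theorem HalfWeight.doubling (hs : HalfWeight M s) {a a' : Fin n → ℝ} {l l' : ℝ} (hl : 0 < l)
    (hl' : 0 < l') (hsub : cube a l ⊆ cube a' l') :
    (l ^ n) ^ 2 * ∫ x in cube a' l', s x ^ 2 ≤ M * (l' ^ n) ^ 2 * ∫ x in cube a l, s x ^ 2 := by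
  have h1 := hs.sq_le a hl
  have h2 := hs.a2 a' l' hl'
  have h3 : ∫ x in cube a l, (s x)⁻¹ ^ 2 ≤ ∫ x in cube a' l', (s x)⁻¹ ^ 2 :=
    setIntegral_mono_set (hs.int_inv a' l' hl') (ae_of_all _ fun x => sq_nonneg _)
      hsub.eventuallyLE
  have h4 := hs.integral_pos a hl
  have h5 := hs.integral_pos a' hl'
  calc _ ≤ ((∫ x in cube a l, s x ^ 2) * ∫ x in cube a l, (s x)⁻¹ ^ 2) *
        ∫ x in cube a' l', s x ^ 2 := by gcongr
    _ ≤ ((∫ x in cube a l, s x ^ 2) * ∫ x in cube a' l', (s x)⁻¹ ^ 2) *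
        ∫ x in cube a' l', s x ^ 2 := by gcongr
    _ = (∫ x in cube a l, s x ^ 2) *
        ((∫ x in cube a' l', s x ^ 2) * ∫ x in cube a' l', (s x)⁻¹ ^ 2) := by ring
    _ ≤ (∫ x in cube a l, s x ^ 2) * (M * (l' ^ n) ^ 2) := by gcongr
    _ = _ := by ring

/-! ### The Bloom weight -/

theorem HalfWeight.memLp_mul (hs : HalfWeight M s) (hr : HalfWeight M r) (a : Fin n → ℝ) {l : ℝ}
    (hl : 0 < l) : IntegrableOn (fun x => s x * r x) (cube a l) :=
  (hs.memLp a hl).integrable_mul (hr.memLp a hl)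

/-- Two-sided comparison of the measure of a cube for the weight `(s r)⁻¹` with that for `s²` and
`r²`. -/
theorem bloom_mul_sqrt (hs : HalfWeight M s) (hr : HalfWeight M r) (hM : 0 ≤ M) {ν : Rn n → ℝ}
    (hν : ν =ᵐ[volume] fun x => (s x)⁻¹ * (r x)⁻¹) (a : Fin n → ℝ) {l : ℝ} (hl : 0 < l) :
    (l ^ n) ^ 2 ≤ (∫ x in cube a l, ν x) *
        √((∫ x in cube a l, s x ^ 2) * ∫ x in cube a l, r x ^ 2) ∧
      (∫ x in cube a l, ν x) * √((∫ x in cube a l, s x ^ 2) * ∫ x in cube a l, r x ^ 2) ≤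
        M * (l ^ n) ^ 2 := by
  have hint := hs.memLp_mul hr a hl
  have hintν := hs.inv.memLp_mul hr.inv a hl
  have hS := hs.integral_pos a hl
  have hR := hr.integral_pos a hl
  rw [integral_congr_ae (ae_restrict_of_ae hν)]
  have hN : 0 < ∫ x in cube a l, (s x)⁻¹ * (r x)⁻¹ := setIntegral_cube_pos hl hintν (by
    filter_upwards [hs.pos, hr.pos] with x h1 h2; positivity)
  constructor
  · have h1 : (∫ x in cube a l, s x * r x) ≤
        √((∫ x in cube a l, s x ^ 2) * ∫ x in cube a l, r x ^ 2) :=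
      Real.le_sqrt_of_sq_le (sq_integral_mul_le (ae_restrict_of_ae (hs.pos.mono fun _ h => h.le))
        (ae_restrict_of_ae (hr.pos.mono fun _ h => h.le)) (hs.memLp a hl) (hr.memLp a hl))
    -- the Cauchy-Schwarz inequality for `1 = (s r)^(1/2) (s r)^(-1/2)`
    have hsq : ∀ᵐ x, √(s x * r x) ^ 2 = s x * r x := by
      filter_upwards [hs.pos, hr.pos] with x h1 h2
      exact Real.sq_sqrt (by positivity)
    have hsq' : ∀ᵐ x, √((s x)⁻¹ * (r x)⁻¹) ^ 2 = (s x)⁻¹ * (r x)⁻¹ := by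
      filter_upwards [hs.pos, hr.pos] with x h1 h2
      exact Real.sq_sqrt (by positivity)
    have hm1 : MemLp (fun x => √(s x * r x)) 2 (volume.restrict (cube a l)) :=
      (memLp_two_iff_integrable_sq
        (hs.aem.mul hr.aem).sqrt.aestronglyMeasurable.restrict).2
        (hint.congr (ae_restrict_of_ae (hsq.mono fun x hx => hx.symm)))
    have hm2 : MemLp (fun x => √((s x)⁻¹ * (r x)⁻¹)) 2 (volume.restrict (cube a l)) :=
      (memLp_two_iff_integrable_sq
        (hs.inv.aem.mul hr.inv.aem).sqrt.aestronglyMeasurable.restrict).2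
        (hintν.congr (ae_restrict_of_ae (hsq'.mono fun x hx => hx.symm)))
    have h2 := sq_integral_mul_le (ae_of_all _ fun x => Real.sqrt_nonneg _)
      (ae_of_all _ fun x => Real.sqrt_nonneg _) hm1 hm2
    have h3 : ∫ x in cube a l, √(s x * r x) * √((s x)⁻¹ * (r x)⁻¹) = l ^ n := by
      have : ∫ x in cube a l, √(s x * r x) * √((s x)⁻¹ * (r x)⁻¹) = ∫ x in cube a l, (1 : ℝ) := by
        refine integral_congr_ae (ae_restrict_of_ae ?_)
        filter_upwards [hs.pos, hr.pos] with x h1 h2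
        rw [← Real.sqrt_mul (by positivity), ← mul_inv, mul_inv_cancel₀ (by positivity),
          Real.sqrt_one]
      rw [this, setIntegral_const, volume_real_cube a hl, smul_eq_mul, mul_one]
    rw [h3, integral_congr_ae (ae_restrict_of_ae hsq),
      integral_congr_ae (ae_restrict_of_ae hsq')] at h2
    calc _ ≤ _ := h2
      _ ≤ _ := by rw [mul_comm]; gcongr
  · have h1 := sq_integral_mul_le (ae_restrict_of_ae (hs.inv.pos.mono fun _ h => h.le))
      (ae_restrict_of_ae (hr.inv.pos.mono fun _ h => h.le)) (hs.inv.memLp a hl) (hr.inv.memLp a hl)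
    refine le_of_sq_le_sq ?_ (by positivity)
    rw [mul_pow, Real.sq_sqrt (by positivity)]
    have hs2 := hs.a2 a l hl
    have hr2 := hr.a2 a l hl
    have hS' := hs.inv.integral_pos a hl
    have hR' := hr.inv.integral_pos a hl
    calc _ ≤ ((∫ x in cube a l, (s x)⁻¹ ^ 2) * ∫ x in cube a l, (r x)⁻¹ ^ 2) *
          ((∫ x in cube a l, s x ^ 2) * ∫ x in cube a l, r x ^ 2) := by gcongr
      _ = ((∫ x in cube a l, s x ^ 2) * ∫ x in cube a l, (s x)⁻¹ ^ 2) *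
          ((∫ x in cube a l, r x ^ 2) * ∫ x in cube a l, (r x)⁻¹ ^ 2) := by ring
      _ ≤ (M * (l ^ n) ^ 2) * (M * (l ^ n) ^ 2) := by gcongr
      _ = _ := by ring

/-- The doubling property of the Bloom weight. -/
theorem bloom_doubling (hs : HalfWeight M s) (hr : HalfWeight M r) (hM : 0 ≤ M) {ν : Rn n → ℝ}
    (hν : ν =ᵐ[volume] fun x => (s x)⁻¹ * (r x)⁻¹) {a a' : Fin n → ℝ} {l l' : ℝ} (hl : 0 < l)
    (hl' : 0 < l') (hsub : cube a l ⊆ cube a' l') :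
    (l ^ n) ^ 2 * ∫ x in cube a' l', ν x ≤ M * (l' ^ n) ^ 2 * ∫ x in cube a l, ν x := by
  have h1 := (bloom_mul_sqrt hs hr hM hν a hl).1
  have h2 := (bloom_mul_sqrt hs hr hM hν a' hl').2
  have hmono {f : Rn n → ℝ} (hf : HalfWeight M f) :
      ∫ x in cube a l, f x ^ 2 ≤ ∫ x in cube a' l', f x ^ 2 :=
    setIntegral_mono_set (hf.int a' l' hl') (ae_of_all _ fun x => sq_nonneg _) hsub.eventuallyLE
  have hS := hs.integral_pos a hl
  have hR := hr.integral_pos a hl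
  set g := √((∫ x in cube a l, s x ^ 2) * ∫ x in cube a l, r x ^ 2) with hg
  set g' := √((∫ x in cube a' l', s x ^ 2) * ∫ x in cube a' l', r x ^ 2) with hg'
  have hgg : g ≤ g' := Real.sqrt_le_sqrt (mul_le_mul (hmono hs) (hmono hr) hR.le
    (hS.le.trans (hmono hs)))
  have hν0 (b : Fin n → ℝ) (k : ℝ) : 0 ≤ ∫ x in cube b k, ν x := by
    refine integral_nonneg_of_ae (ae_restrict_of_ae ?_)
    filter_upwards [hν, hs.pos, hr.pos] with x hx h1 h2
    rw [hx]; simp only [Pi.zero_apply]; positivity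
  have hg0 : 0 ≤ g := Real.sqrt_nonneg _
  have hN := hν0 a l
  have hN' := hν0 a' l'
  calc _ ≤ ((∫ x in cube a l, ν x) * g) * ∫ x in cube a' l', ν x := by gcongr
    _ ≤ ((∫ x in cube a l, ν x) * g') * ∫ x in cube a' l', ν x := by gcongr
    _ = (∫ x in cube a l, ν x) * ((∫ x in cube a' l', ν x) * g') := by ring
    _ ≤ (∫ x in cube a l, ν x) * (M * (l' ^ n) ^ 2) := by gcongr
    _ = _ := by ring

end Weight

theorem isWeight_halfWeight {n : ℕ} {w : Rn n → ℝ} (hw : IsWeight w) {M : ℝ≥0}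
    (hA : A2const w ≤ M) : HalfWeight (M : ℝ) fun x => w x ^ (1 / 2 : ℝ) := by
  have haem : AEMeasurable w := hw.1.aestronglyMeasurable.aemeasurable
  have hsq : ∀ᵐ x, (w x ^ (1 / 2 : ℝ)) ^ 2 = w x := by
    filter_upwards [hw.2] with x hx
    rw [← Real.sqrt_eq_rpow, Real.sq_sqrt hx.le]
  have hsq' : ∀ᵐ x, (w x ^ (1 / 2 : ℝ))⁻¹ ^ 2 = (w x)⁻¹ := by
    filter_upwards [hw.2] with x hx
    rw [← Real.sqrt_eq_rpow, inv_pow, Real.sq_sqrt hx.le]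
  have hmain (a : Fin n → ℝ) (l : ℝ) (hl : 0 < l) : IntegrableOn w (cube a l) ∧
      IntegrableOn (fun x => (w x)⁻¹) (cube a l) ∧
      (∫ x in cube a l, w x) * (∫ x in cube a l, (w x)⁻¹) ≤ M * (l ^ n) ^ 2 := by
    have hint := integrableOn_cube hw.1 a hl
    have h0 := setIntegral_cube_pos hl hint hw.2
    have hle : (⨍⁻ x in cube a l, ENNReal.ofReal (w x) ∂volume) *
        (⨍⁻ x in cube a l, (ENNReal.ofReal (w x))⁻¹ ∂volume) ≤ M := by
      refine le_trans ?_ hA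
      rw [A2const]
      refine le_iSup_of_le a (le_iSup_of_le l ?_)
      rw [iSup_pos hl]
    rw [setLAverage_eq, setLAverage_eq] at hle
    have hV0 := volume_cube_ne_zero a hl
    have hVT := (volume_cube_lt_top a l).ne
    set V := volume (cube a l) with hV
    have hP : ∫⁻ x in cube a l, ENNReal.ofReal (w x) = ENNReal.ofReal (∫ x in cube a l, w x) :=
      (ofReal_integral_eq_lintegral_ofReal hint
        (ae_restrict_of_ae (hw.2.mono fun _ h => h.le))).symm
    have hR : ∫⁻ x in cube a l, (ENNReal.ofReal (w x))⁻¹ =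
        ∫⁻ x in cube a l, ENNReal.ofReal (w x)⁻¹ :=
      lintegral_congr_ae (ae_restrict_of_ae (hw.2.mono fun x h =>
        (ENNReal.ofReal_inv_of_pos h).symm))
    rw [hP, hR] at hle
    set R := ∫⁻ x in cube a l, ENNReal.ofReal (w x)⁻¹ with hRdef
    have hle' : ENNReal.ofReal (∫ x in cube a l, w x) * R ≤ M * V ^ 2 := by
      have hVV : V⁻¹ * V = 1 := ENNReal.inv_mul_cancel hV0 hVT
      calc _ = ENNReal.ofReal (∫ x in cube a l, w x) * R * ((V⁻¹ * V) * (V⁻¹ * V)) := by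
            rw [hVV, one_mul, mul_one]
        _ = (ENNReal.ofReal (∫ x in cube a l, w x) / V * (R / V)) * (V * V) := by
            rw [div_eq_mul_inv, div_eq_mul_inv]; ring
        _ ≤ M * (V * V) := by gcongr
        _ = _ := by rw [sq]
    have hRT : R ≠ ∞ := by
      intro hT
      rw [hT, ENNReal.mul_top (by simpa using h0)] at hle'
      exact (ENNReal.mul_lt_top ENNReal.coe_lt_top (ENNReal.pow_lt_top hVT.lt_top)).not_ge hle'
    have hnn : 0 ≤ᵐ[volume.restrict (cube a l)] fun x => (w x)⁻¹ :=
      ae_restrict_of_ae (hw.2.mono fun _ h => inv_nonneg.2 h.le)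
    have hintR : IntegrableOn (fun x => (w x)⁻¹) (cube a l) := by
      refine ⟨haem.inv.aestronglyMeasurable.restrict, ?_⟩
      rw [hasFiniteIntegral_iff_ofReal hnn]
      exact hRT.lt_top
    refine ⟨hint, hintR, ?_⟩
    rw [hRdef, ← ofReal_integral_eq_lintegral_ofReal hintR hnn, ← ENNReal.ofReal_mul h0.le, hV,
      volume_cube] at hle'
    have hM : (M : ℝ≥0∞) = ENNReal.ofReal M := ENNReal.ofReal_coe_nnreal.symm
    rw [hM, ← ENNReal.ofReal_pow hl.le, ← ENNReal.ofReal_pow (by positivity),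
      ← ENNReal.ofReal_mul (NNReal.coe_nonneg M), ENNReal.ofReal_le_ofReal_iff (by positivity)] at hle'
    exact hle'
  refine ⟨haem.pow_const _, hw.2.mono fun x h => Real.rpow_pos_of_pos h _, fun a l hl => ?_,
    fun a l hl => ?_, fun a l hl => ?_⟩
  · exact (hmain a l hl).1.congr (ae_restrict_of_ae (hsq.mono fun x h => h.symm))
  · exact (hmain a l hl).2.1.congr (ae_restrict_of_ae (hsq'.mono fun x h => h.symm))
  · rw [integral_congr_ae (ae_restrict_of_ae hsq), integral_congr_ae (ae_restrict_of_ae hsq')]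
    exact (hmain a l hl).2.2

theorem HalfWeight.mono {n : ℕ} {M M' : ℝ} {s : Rn n → ℝ} (hs : HalfWeight M s) (h : M ≤ M') :
    HalfWeight M' s :=
  ⟨hs.aem, hs.pos, hs.int, hs.int_inv, fun a l hl => (hs.a2 a l hl).trans (by gcongr)⟩

/-! ### Superharmonic majorants -/

/-- A superharmonic majorant of a `p`-summable sequence on a tree, with control of its norm. -/
theorem exists_majorant {I J : Type*} [Fintype J] {ch : I → J → I} {v : I → ℝ}
    (hinj : Function.Injective fun a : I × J => ch a.1 a.2)
    (hv : ∀ Q, 0 < v Q) (hadd : ∀ Q, ∑ j, v (ch Q j) = v Q) {δ : ℝ} (hδ0 : 0 < δ) (hδ1 : δ < 1)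
    (hδ : ∀ Q j, v (ch Q j) ≤ δ * v Q) {p : ℝ} (hp : 1 ≤ p) {β : I → ℝ} (hβ : ∀ Q, 0 ≤ β Q)
    (hsum : ∑' Q, ENNReal.ofReal (β Q ^ p) ≠ ∞) :
    ∃ G : I → ℝ, (∀ Q, 0 ≤ G Q) ∧
      (∀ Q, β Q * v Q + ∑ j, v (ch Q j) * G (ch Q j) ≤ v Q * G Q) ∧
      ∑' Q, ENNReal.ofReal (G Q ^ p) ≤
        ENNReal.ofReal (1 - δ ^ (1 / p)) ^ (-p) * ∑' Q, ENNReal.ofReal (β Q ^ p) := by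
  have hp0 : 0 < p := by linarith
  set f : I → ℝ≥0∞ := fun Q => ENNReal.ofReal (β Q) with hf
  have hfp (Q : I) : f Q ^ p = ENNReal.ofReal (β Q ^ p) :=
    ENNReal.ofReal_rpow_of_nonneg (hβ Q) hp0.le
  have hbound := tsum_descTotal_rpow_le hinj hv hadd hδ0 hδ1 hδ hp f
  simp only [hfp] at hbound
  have hθ : δ ^ (1 / p) < 1 := Real.rpow_lt_one hδ0.le hδ1 (by positivity)
  have hCT : ENNReal.ofReal (1 - δ ^ (1 / p)) ^ (-p) ≠ ∞ := by
    rw [ENNReal.rpow_neg, Ne, ENNReal.inv_eq_top]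
    have : 0 < ENNReal.ofReal (1 - δ ^ (1 / p)) := ENNReal.ofReal_pos.2 (by linarith)
    exact (ENNReal.rpow_pos this ENNReal.ofReal_ne_top).ne'
  have hT : ∑' Q, descTotal ch v f Q ^ p ≠ ∞ :=
    ne_top_of_le_ne_top (ENNReal.mul_ne_top hCT hsum) hbound
  have hfin (Q : I) : descTotal ch v f Q ≠ ∞ := by
    intro h
    have := ENNReal.ne_top_of_tsum_ne_top hT Q
    rw [h, ENNReal.top_rpow_of_pos hp0] at this
    exact this rfl
  refine ⟨fun Q => (descTotal ch v f Q).toReal, fun Q => ENNReal.toReal_nonneg, fun Q => ?_, ?_⟩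
  · have h := add_childAvg_descTotal_le (ch := ch) (v := v) f Q
    have h2 (R : I) : descTotal ch v f R = ENNReal.ofReal (descTotal ch v f R).toReal :=
      (ENNReal.ofReal_toReal (hfin R)).symm
    rw [childAvg] at h
    have h3 : ∑ j, ENNReal.ofReal (v (ch Q j) / v Q) * descTotal ch v f (ch Q j) =
        ENNReal.ofReal (∑ j, v (ch Q j) / v Q * (descTotal ch v f (ch Q j)).toReal) := by
      rw [ENNReal.ofReal_sum_of_nonneg fun j _ =>
        mul_nonneg (div_nonneg (hv _).le (hv _).le) ENNReal.toReal_nonneg]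
      refine Finset.sum_congr rfl fun j _ => ?_
      rw [ENNReal.ofReal_mul (div_nonneg (hv _).le (hv _).le), ← h2]
    have h4 : 0 ≤ ∑ j, v (ch Q j) / v Q * (descTotal ch v f (ch Q j)).toReal :=
      Finset.sum_nonneg fun j _ =>
        mul_nonneg (div_nonneg (hv _).le (hv _).le) ENNReal.toReal_nonneg
    rw [h3, hf, ← ENNReal.ofReal_add (hβ Q) h4, h2 Q,
      ENNReal.ofReal_le_ofReal_iff ENNReal.toReal_nonneg] at h
    have h5 := mul_le_mul_of_nonneg_left h (hv Q).le
    refine le_trans (le_of_eq ?_) h5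
    rw [mul_add, mul_comm, Finset.mul_sum]
    congr 1
    refine Finset.sum_congr rfl fun j _ => ?_
    have := (hv Q).ne'
    field_simp
  · refine le_trans (le_of_eq ?_) hbound
    refine tsum_congr fun Q => ?_
    rw [← ENNReal.ofReal_rpow_of_nonneg ENNReal.toReal_nonneg hp0.le,
      ENNReal.ofReal_toReal (hfin Q)]

/-- For a doubling measure, a child has at most a fixed fraction of the measure of its parent, since
it has a sibling. -/
theorem child_le_of_doubling {I J : Type*} [Fintype J] [Nontrivial J] {ch : I → J → I} {v : I → ℝ}
    (hadd : ∀ Q, ∑ j, v (ch Q j) = v Q) (hv : ∀ Q, 0 < v Q) {K : ℝ} (hK : 0 < K)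
    (hd : ∀ Q j, v Q ≤ K * v (ch Q j)) (Q : I) (j : J) : v (ch Q j) ≤ (1 - K⁻¹) * v Q := by
  classical
  obtain ⟨i, hij⟩ := exists_ne j
  have h1 : v (ch Q j) + v (ch Q i) ≤ v Q := by
    rw [← hadd Q, ← Finset.sum_pair (f := fun k => v (ch Q k)) hij.symm]
    exact Finset.sum_le_sum_of_subset_of_nonneg (Finset.subset_univ _) fun k _ _ => (hv _).le
  have h2 : K⁻¹ * v Q ≤ v (ch Q i) := by
    rw [inv_mul_le_iff₀ hK]; exact hd Q i
  linarith

section Weight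

variable {n : ℕ} {M : ℝ} {s r : Rn n → ℝ} (D : DyadicSystem n)

/-! ### Weighted measures of dyadic cubes -/

/-- The measure of a dyadic cube for the weight `s²`. -/
def mass (s : Rn n → ℝ) (Q : CubeIndex n) : ℝ := ∫ x in dyadicCube D Q, s x ^ 2

theorem HalfWeight.mass_pos (hs : HalfWeight M s) (Q : CubeIndex n) : 0 < mass D s Q :=
  hs.integral_pos _ (side_pos Q)

theorem HalfWeight.integrableOn (hs : HalfWeight M s) (Q : CubeIndex n) :
    IntegrableOn (fun x => s x ^ 2) (dyadicCube D Q) := hs.int _ _ (side_pos Q)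

theorem HalfWeight.sum_mass_child (hs : HalfWeight M s) (Q : CubeIndex n) :
    ∑ j, mass D s (child D Q j) = mass D s Q :=
  sum_integral_child D (hs.integrableOn D Q)

theorem le_of_child_doubling {Q : CubeIndex n} {j : Fin n → Fin 2} {V V' : ℝ}
    (h : (side (child D Q j) ^ n) ^ 2 * V ≤ M * (side Q ^ n) ^ 2 * V') : V ≤ M * 4 ^ n * V' := by
  have hs := side_pos Q
  have h4 : (4 : ℝ) ^ n = (2 ^ n) ^ 2 := by
    rw [← pow_mul, mul_comm, pow_mul]; norm_num
  rw [side_child, div_pow, div_pow, div_mul_eq_mul_div, div_le_iff₀ (by positivity)] at h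
  rw [h4]
  have h5 : (side Q ^ n) ^ 2 * V ≤ (side Q ^ n) ^ 2 * (M * (2 ^ n) ^ 2 * V') := by
    refine h.trans (le_of_eq ?_); ring
  exact le_of_mul_le_mul_left h5 (by positivity)

theorem HalfWeight.mass_le_mass_child (hs : HalfWeight M s) (Q : CubeIndex n) (j : Fin n → Fin 2) :
    mass D s Q ≤ M * 4 ^ n * mass D s (child D Q j) :=
  le_of_child_doubling D (hs.doubling (side_pos _) (side_pos Q) (child_subset D Q j))

theorem HalfWeight.mass_mul_le (hs : HalfWeight M s) (Q : CubeIndex n) :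
    mass D s Q * mass D (fun x => (s x)⁻¹) Q ≤ M * (side Q ^ n) ^ 2 := hs.a2 _ _ (side_pos Q)

/-! ### Weighted step functions as elements of `L²` -/

theorem HalfWeight.memLp_step (hs : HalfWeight M s) (Q : CubeIndex n) (c : (Fin n → Fin 2) → ℝ) :
    MemLp (fun x => ((s x * step D Q c x : ℝ) : ℂ)) 2 volume := by
  have h1 : MemLp (fun x => s x * step D Q c x) 2 volume := by
    have h2 (x : Rn n) : s x * step D Q c x =
        ∑ j, (dyadicCube D (child D Q j)).indicator (fun x => c j * s x) x := by
      rw [step, Finset.mul_sum]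
      refine Finset.sum_congr rfl fun j _ => ?_
      by_cases hx : x ∈ dyadicCube D (child D Q j)
      · rw [Set.indicator_of_mem hx, Set.indicator_of_mem hx, mul_comm]
      · rw [Set.indicator_of_notMem hx, Set.indicator_of_notMem hx, mul_zero]
    simp only [h2]
    refine memLp_finsetSum _ fun j _ => ?_
    rw [memLp_indicator_iff_restrict (measurableSet_dyadicCube D _)]
    exact (hs.memLp _ (side_pos _)).const_mul _
  exact h1.ofReal

/-- The element `s · step D Q c` of `L²`. -/
def HalfWeight.vec (hs : HalfWeight M s) (Q : CubeIndex n) (c : (Fin n → Fin 2) → ℝ) : L2 n :=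
  (hs.memLp_step D Q c).toLp _

theorem HalfWeight.coeFn_vec (hs : HalfWeight M s) (Q : CubeIndex n) (c : (Fin n → Fin 2) → ℝ) :
    hs.vec D Q c =ᵐ[volume] fun x => ((s x * step D Q c x : ℝ) : ℂ) :=
  (hs.memLp_step D Q c).coeFn_toLp

theorem HalfWeight.inner_vec (hs : HalfWeight M s) (Q : CubeIndex n) (c : (Fin n → Fin 2) → ℝ)
    (f : L2 n) : inner ℂ (hs.vec D Q c) f = ∫ x, ((s x * step D Q c x : ℝ) : ℂ) * f x := by
  rw [L2.inner_def]
  refine integral_congr_ae ?_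
  filter_upwards [hs.coeFn_vec D Q c] with x hx
  rw [hx, RCLike.inner_apply, Complex.conj_ofReal, mul_comm]

theorem HalfWeight.inner_vec_vec (hs : HalfWeight M s) (hr : HalfWeight M r) (Q R : CubeIndex n)
    (c d : (Fin n → Fin 2) → ℝ) : inner ℂ (hs.vec D Q c) (hr.vec D R d) =
      ((∫ x, s x * r x * (step D Q c x * step D R d x) : ℝ) : ℂ) := by
  rw [hs.inner_vec, ← integral_complex_ofReal]
  refine integral_congr_ae ?_
  filter_upwards [hr.coeFn_vec D R d] with x hx
  rw [hx]; push_cast; ring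

theorem integral_mul_step_real {f : Rn n → ℝ} {Q : CubeIndex n}
    (hf : IntegrableOn f (dyadicCube D Q)) (c : (Fin n → Fin 2) → ℝ) :
    ∫ x, f x * step D Q c x = ∑ j, c j * ∫ x in dyadicCube D (child D Q j), f x := by
  have h := integral_mul_step D (f := fun x => (f x : ℂ)) hf.ofReal c
  have h1 : ∀ x, (f x : ℂ) * (step D Q c x : ℂ) = ((f x * step D Q c x : ℝ) : ℂ) := fun x => by
    push_cast; rfl
  simp only [h1, integral_complex_ofReal] at h
  exact_mod_cast h

theorem integral_step_mul_step_same {w : Rn n → ℝ} {Q : CubeIndex n}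
    (hw : IntegrableOn w (dyadicCube D Q)) (c d : (Fin n → Fin 2) → ℝ) :
    ∫ x, w x * (step D Q c x * step D Q d x) =
      ∑ j, c j * d j * ∫ x in dyadicCube D (child D Q j), w x := by
  simp only [step_mul_step]
  exact integral_mul_step_real D hw _

/-- A step function with vanishing mean is orthogonal to the step functions on larger cubes. -/
theorem integral_step_mul_step_of_lt {w : Rn n → ℝ} {Q R : CubeIndex n} (hQR : R.1 < Q.1)
    (hw : IntegrableOn w (dyadicCube D Q)) {c : (Fin n → Fin 2) → ℝ} (d : (Fin n → Fin 2) → ℝ)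
    (hc : ∑ j, c j * ∫ x in dyadicCube D (child D Q j), w x = 0) :
    ∫ x, w x * (step D Q c x * step D R d x) = 0 := by
  -- the coarser step function is constant on the finer cube
  obtain ⟨a, ha⟩ : ∃ a, ∀ x ∈ dyadicCube D Q, step D R d x = a := by
    by_cases h : (dyadicCube D Q).Nonempty
    · obtain ⟨y, hy⟩ := h
      refine ⟨step D R d y, fun x hx => step_eq_of_position_eq D R d ?_⟩
      refine position_eq_of_le D (Int.add_one_le_of_lt hQR) ?_
      rw [mem_dyadicCube_iff] at hx hy
      rw [hx, hy]
    · exact ⟨0, fun x hx => absurd ⟨x, hx⟩ h⟩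
  have h1 (x : Rn n) : w x * (step D Q c x * step D R d x) = a * (w x * step D Q c x) := by
    by_cases hx : x ∈ dyadicCube D Q
    · rw [ha x hx]; ring
    · rw [step_of_notMem D hx]; ring
  simp only [h1]
  rw [integral_const_mul, integral_mul_step_real D hw, hc, mul_zero]

/-- Step functions with vanishing means on their cubes are orthogonal if the cubes differ. -/
theorem integral_step_mul_step_of_ne {w : Rn n → ℝ} {Q R : CubeIndex n} (hne : Q ≠ R)
    (hw : ∀ Q, IntegrableOn w (dyadicCube D Q)) {c d : (Fin n → Fin 2) → ℝ}
    (hc : ∑ j, c j * ∫ x in dyadicCube D (child D Q j), w x = 0)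
    (hd : ∑ j, d j * ∫ x in dyadicCube D (child D R j), w x = 0) :
    ∫ x, w x * (step D Q c x * step D R d x) = 0 := by
  rcases lt_trichotomy Q.1 R.1 with h | h | h
  · have := integral_step_mul_step_of_lt D h (hw R) c hd
    simpa only [mul_comm (step D R d _)] using this
  · have h1 (x : Rn n) : w x * (step D Q c x * step D R d x) = 0 := by
      by_cases hx : x ∈ dyadicCube D Q
      · rw [step_of_notMem D (Set.disjoint_left.1 (disjoint_dyadicCube D h hne) hx)]; ring
      · rw [step_of_notMem D hx]; ring
    simp only [h1, integral_zero]
  · exact integral_step_mul_step_of_lt D h (hw Q) d hc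

theorem HalfWeight.inner_vec_self_of_ne (hs : HalfWeight M s) {Q R : CubeIndex n} (hne : Q ≠ R)
    {c d : (Fin n → Fin 2) → ℝ} (hc : ∑ j, c j * mass D s (child D Q j) = 0)
    (hd : ∑ j, d j * mass D s (child D R j) = 0) :
    inner ℂ (hs.vec D Q c) (hs.vec D R d) = 0 := by
  rw [hs.inner_vec_vec D hs]
  simp only [← sq (s _)]
  rw [integral_step_mul_step_of_ne D hne (hs.integrableOn D) hc hd, Complex.ofReal_zero]

/-- The weight cancels in the pairing of `s φ` with `s⁻¹ ψ`. -/
theorem HalfWeight.inner_vec_inv (hs : HalfWeight M s) (Q R : CubeIndex n)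
    (c d : (Fin n → Fin 2) → ℝ) : inner ℂ (hs.vec D Q c) (hs.inv.vec D R d) =
      ((∫ x, 1 * (step D Q c x * step D R d x) : ℝ) : ℂ) := by
  rw [hs.inner_vec_vec D hs.inv]
  congr 1
  refine integral_congr_ae ?_
  filter_upwards [hs.pos] with x hx
  rw [mul_inv_cancel₀ hx.ne']

theorem integrableOn_one (Q : CubeIndex n) :
    IntegrableOn (fun _ : Rn n => (1 : ℝ)) (dyadicCube D Q) :=
  integrableOn_const (volume_cube_lt_top _ _).ne

theorem integral_one_child (Q : CubeIndex n) (j : Fin n → Fin 2) :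
    ∫ _ in dyadicCube D (child D Q j), (1 : ℝ) = side Q ^ n / 2 ^ n := by
  rw [setIntegral_const, volume_real_dyadicCube, side_child, smul_eq_mul, mul_one, div_pow]

theorem HalfWeight.inner_vec_inv_self (hs : HalfWeight M s) (Q : CubeIndex n)
    (c d : (Fin n → Fin 2) → ℝ) : inner ℂ (hs.vec D Q c) (hs.inv.vec D Q d) =
      ((side Q ^ n / 2 ^ n * ∑ j, c j * d j : ℝ) : ℂ) := by
  rw [hs.inner_vec_inv, integral_step_mul_step_same D (integrableOn_one D Q), Finset.mul_sum]
  congr 1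
  refine Finset.sum_congr rfl fun j _ => ?_
  rw [integral_one_child]; ring

theorem HalfWeight.inner_vec_inv_of_ne (hs : HalfWeight M s) {Q R : CubeIndex n} (hne : Q ≠ R)
    {c d : (Fin n → Fin 2) → ℝ} (hc : ∑ j, c j = 0) (hd : ∑ j, d j = 0) :
    inner ℂ (hs.vec D Q c) (hs.inv.vec D R d) = 0 := by
  rw [hs.inner_vec_inv, integral_step_mul_step_of_ne D hne (integrableOn_one D), Complex.ofReal_zero]
  · simp only [integral_one_child, ← Finset.sum_mul, hc, zero_mul]
  · simp only [integral_one_child, ← Finset.sum_mul, hd, zero_mul]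

theorem HalfWeight.norm_vec_sq (hs : HalfWeight M s) (Q : CubeIndex n)
    (c : (Fin n → Fin 2) → ℝ) :
    ‖hs.vec D Q c‖ ^ 2 = ∑ j, c j ^ 2 * mass D s (child D Q j) := by
  have h1 := hs.inner_vec_vec D hs Q Q c c
  simp only [← sq (s _)] at h1
  rw [integral_step_mul_step_same D (hs.integrableOn D Q), inner_self_eq_norm_sq_to_K] at h1
  have h2 : ((‖hs.vec D Q c‖ ^ 2 : ℝ) : ℂ) =
      ((∑ j, c j * c j * ∫ x in dyadicCube D (child D Q j), s x ^ 2 : ℝ) : ℂ) := by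
    rw [← h1]; push_cast; rfl
  rw [Complex.ofReal_inj.1 h2]
  exact Finset.sum_congr rfl fun j _ => by rw [sq, mass]

theorem HalfWeight.norm_vec_le (hs : HalfWeight M s) (Q : CubeIndex n)
    {c : (Fin n → Fin 2) → ℝ} {A : ℝ} (hA : 0 ≤ A) (hc : ∀ j, |c j| ≤ A) :
    ‖hs.vec D Q c‖ ≤ A * √(mass D s Q) := by
  refine le_of_sq_le_sq ?_ (by positivity)
  rw [mul_pow, Real.sq_sqrt (hs.mass_pos D Q).le, hs.norm_vec_sq, ← hs.sum_mass_child D Q,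
    Finset.mul_sum]
  refine Finset.sum_le_sum fun j _ => ?_
  have := (hs.mass_pos D (child D Q j)).le
  have h2 : c j ^ 2 ≤ A ^ 2 := sq_le_sq.2 (by rw [abs_of_nonneg hA]; exact hc j)
  exact mul_le_mul_of_nonneg_right h2 this

/-! ### The integrals `∫_Q s |f|` -/

theorem HalfWeight.integrableOn_mul_norm (hs : HalfWeight M s) (f : L2 n) (Q : CubeIndex n) :
    IntegrableOn (fun x => s x * ‖f x‖) (dyadicCube D Q) :=
  (hs.memLp _ (side_pos Q)).integrable_mul ((Lp.memLp f).norm.restrict _)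

theorem HalfWeight.norm_inner_vec_le (hs : HalfWeight M s) (Q : CubeIndex n)
    {c : (Fin n → Fin 2) → ℝ} {A : ℝ} (hc : ∀ j, |c j| ≤ A) (f : L2 n) :
    ‖inner ℂ (hs.vec D Q c) f‖ ≤ A * ∫ x in dyadicCube D Q, s x * ‖f x‖ := by
  rw [hs.inner_vec]
  refine (norm_integral_le_integral_norm _).trans ?_
  rw [← integral_const_mul, ← integral_indicator (measurableSet_dyadicCube D Q)]
  have hint : IntegrableOn (fun x => A * (s x * ‖f x‖)) (dyadicCube D Q) :=
    Integrable.const_mul (hs.integrableOn_mul_norm D f Q) A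
  refine integral_mono_of_nonneg (ae_of_all _ fun x => norm_nonneg _)
    (hint.integrable_indicator (measurableSet_dyadicCube D Q)) ?_
  filter_upwards [hs.pos] with x hx
  have h1 := abs_step_le D Q hc x
  rw [norm_mul, Complex.norm_real, norm_mul, Real.norm_eq_abs, Real.norm_eq_abs, abs_of_pos hx]
  by_cases hxQ : x ∈ dyadicCube D Q
  · rw [Set.indicator_of_mem hxQ] at h1 ⊢
    calc _ ≤ s x * A * ‖f x‖ := by gcongr
      _ = _ := by ring
  · rw [Set.indicator_of_notMem hxQ, step_of_notMem D hxQ]; simp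

theorem HalfWeight.sq_integral_mul_norm_le (hs : HalfWeight M s) (f : L2 n) (Q : CubeIndex n) :
    (∫ x in dyadicCube D Q, s x * ‖f x‖) ^ 2 ≤
      (∫ x in dyadicCube D Q, ‖f x‖ ^ 2) * mass D s Q := by
  rw [mul_comm]
  exact sq_integral_mul_le (ae_restrict_of_ae (hs.pos.mono fun _ h => h.le))
    (ae_of_all _ fun x => norm_nonneg _) (hs.memLp _ (side_pos Q)) ((Lp.memLp f).norm.restrict _)

theorem integrable_norm_sq (f : L2 n) : Integrable (fun x => ‖f x‖ ^ 2) :=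
  (memLp_two_iff_integrable_sq_norm (Lp.aestronglyMeasurable f)).1 (Lp.memLp f)

theorem integral_norm_sq (f : L2 n) : ∫ x, ‖f x‖ ^ 2 = ‖f‖ ^ 2 := by
  have h1 : inner ℂ f f = ((∫ x, ‖f x‖ ^ 2 : ℝ) : ℂ) := by
    rw [L2.inner_def, ← integral_complex_ofReal]
    refine integral_congr_ae (ae_of_all _ fun x => ?_)
    simp only [inner_self_eq_norm_sq_to_K]; push_cast; rfl
  rw [inner_self_eq_norm_sq_to_K] at h1
  have h2 : ((‖f‖ ^ 2 : ℝ) : ℂ) = ((∫ x, ‖f x‖ ^ 2 : ℝ) : ℂ) := by rw [← h1]; push_cast; rfl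
  exact (Complex.ofReal_inj.1 h2).symm

theorem tsum_level_norm_sq_le (f : L2 n) (k : ℤ) :
    ∑' Q : CubeIndex n, (if Q.1 = k then ENNReal.ofReal (∫ x in dyadicCube D Q, ‖f x‖ ^ 2) else 0) ≤
      ENNReal.ofReal (‖f‖ ^ 2) := by
  have h := tsum_level_lintegral_le D (fun x => ENNReal.ofReal (‖f x‖ ^ 2)) k
  rw [← ofReal_integral_eq_lintegral_ofReal (integrable_norm_sq f)
    (ae_of_all _ fun x => sq_nonneg _), integral_norm_sq] at h
  refine le_trans (le_of_eq ?_) h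
  refine tsum_congr fun Q => ?_
  rw [ofReal_integral_eq_lintegral_ofReal (integrable_norm_sq f).integrableOn
    (ae_of_all _ fun x => sq_nonneg _)]

end Weight

section Upper

variable {n : ℕ} {M : ℝ} {s r : Rn n → ℝ} (D : DyadicSystem n)

/-! ### The upper bound for Schatten norms -/

/-- The upper bound for the fraction of the measure of a cube which a child may have, for `A₂`
weights. -/
def decay (n : ℕ) (M : ℝ) : ℝ := 1 - (M * 4 ^ n)⁻¹

/-- The constant in `exists_majorant` for `A₂` weights. -/
def majorantConst (n : ℕ) (M p : ℝ) : ℝ≥0∞ := ENNReal.ofReal (1 - decay n M ^ (1 / p)) ^ (-p)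

theorem one_lt_mul_four_pow (hn : 1 ≤ n) (hM : 1 ≤ M) : 1 < M * 4 ^ n :=
  (one_lt_pow₀ (by norm_num) (by omega)).trans_le (le_mul_of_one_le_left (by positivity) hM)

theorem decay_pos (hn : 1 ≤ n) (hM : 1 ≤ M) : 0 < decay n M := by
  rw [decay, sub_pos]
  exact inv_lt_one_of_one_lt₀ (one_lt_mul_four_pow hn hM)

theorem decay_lt_one (hM : 1 ≤ M) : decay n M < 1 := by
  rw [decay, sub_lt_self_iff]; positivity

theorem majorantConst_ne_top (hn : 1 ≤ n) (hM : 1 ≤ M) {p : ℝ} (hp : 0 < p) :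
    majorantConst n M p ≠ ∞ := by
  have h := Real.rpow_lt_one (decay_pos hn hM).le (decay_lt_one (n := n) hM)
    (show 0 < 1 / p by positivity)
  rw [majorantConst, ENNReal.rpow_neg, Ne, ENNReal.inv_eq_top]
  exact (ENNReal.rpow_pos (ENNReal.ofReal_pos.2 (by linarith)) ENNReal.ofReal_ne_top).ne'

theorem nontrivial_children (hn : 1 ≤ n) : Nontrivial (Fin n → Fin 2) := by
  have : Nonempty (Fin n) := ⟨⟨0, hn⟩⟩
  infer_instance

theorem HalfWeight.exists_majorant (hs : HalfWeight M s) (hn : 1 ≤ n) (hM : 1 ≤ M) {p : ℝ}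
    (hp : 1 ≤ p) {β : CubeIndex n → ℝ} (hβ : ∀ Q, 0 ≤ β Q)
    (hsum : ∑' Q, ENNReal.ofReal (β Q ^ p) ≠ ∞) :
    ∃ G : CubeIndex n → ℝ, (∀ Q, 0 ≤ G Q) ∧
      (∀ Q, β Q * mass D s Q + ∑ j, mass D s (child D Q j) * G (child D Q j) ≤
        mass D s Q * G Q) ∧
      ∑' Q, ENNReal.ofReal (G Q ^ p) ≤ majorantConst n M p * ∑' Q, ENNReal.ofReal (β Q ^ p) := by
  have := nontrivial_children hn
  exact Paraproduct.exists_majorant (child_bijective D).1 (hs.mass_pos D) (hs.sum_mass_child D)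
    (decay_pos hn hM) (decay_lt_one hM)
    (child_le_of_doubling (hs.sum_mass_child D) (hs.mass_pos D) (by positivity)
      (hs.mass_le_mass_child D)) hp hβ hsum

/-- The Carleson embedding theorem for `f ↦ s |f|` and the terms with `γ ≤ t`. -/
theorem HalfWeight.sum_carleson_le (hs : HalfWeight M s) {F : Type*} [Fintype F]
    {β γ G : CubeIndex n → ℝ} (hβ : ∀ Q, 0 ≤ β Q) (hG0 : ∀ Q, 0 ≤ G Q)
    (hG : ∀ Q, β Q * mass D s Q + ∑ j, mass D s (child D Q j) * G (child D Q j) ≤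
      mass D s Q * G Q) (hGγ : ∀ Q, G Q ≤ γ Q) {t : ℝ} (ht : 0 < t) (f : L2 n)
    (S : Finset (CubeIndex n × F)) (hS : ∀ i ∈ S, γ i.1 ≤ t) :
    ∑ i ∈ S, β i.1 * ((∫ x in dyadicCube D i.1, s x * ‖f x‖) ^ 2 / mass D s i.1) ≤
      Fintype.card F * (4 * t * ‖f‖ ^ 2) := by
  have h := tsum_carleson_le (ch := child D) (J := Fin n → Fin 2) Prod.fst (child_bijective D)
    (fun Q j => rfl) (hs.mass_pos D) (hs.sum_mass_child D)
    (fun Q => sum_integral_child D (hs.integrableOn_mul_norm D f Q))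
    (fun Q => sum_integral_child D (integrable_norm_sq f).integrableOn)
    (hs.sq_integral_mul_norm_le D f) hβ hG0 hG hGγ ht (tsum_level_norm_sq_le D f)
  have hnn (Q : CubeIndex n) :
      0 ≤ β Q * ((∫ x in dyadicCube D Q, s x * ‖f x‖) ^ 2 / mass D s Q) :=
    mul_nonneg (hβ Q) (div_nonneg (sq_nonneg _) (hs.mass_pos D Q).le)
  rw [← ENNReal.ofReal_le_ofReal_iff (by positivity),
    ENNReal.ofReal_sum_of_nonneg fun i _ => hnn i.1, ENNReal.ofReal_mul (Nat.cast_nonneg _),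
    ENNReal.ofReal_natCast]
  set u : CubeIndex n → ℝ≥0∞ := fun Q => if γ Q ≤ t then ENNReal.ofReal
    (β Q * ((∫ x in dyadicCube D Q, s x * ‖f x‖) ^ 2 / mass D s Q)) else 0 with hu
  calc _ = ∑ i ∈ S, u i.1 := Finset.sum_congr rfl fun i hi => by simp only [hu, if_pos (hS i hi)]
    _ ≤ ∑' i : CubeIndex n × F, u i.1 := ENNReal.sum_le_tsum S
    _ = Fintype.card F * ∑' Q, u Q := by
      rw [ENNReal.tsum_prod (f := fun Q (_ : F) => u Q), ← ENNReal.tsum_mul_left]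
      refine tsum_congr fun Q => ?_
      rw [tsum_fintype, Finset.sum_const, Finset.card_univ, nsmul_eq_mul]
    _ ≤ _ := by gcongr

open InnerProductSpace in
/-- The sum of the terms for which the majorants are at most a multiple of `t` has norm at most `t`,
by the Cauchy-Schwarz inequality and the Carleson embedding theorem for `s²` and for `r²`. -/
theorem norm_sum_rankOne_le (hs : HalfWeight M s) (hr : HalfWeight M r) {F : Type*} [Fintype F]
    {κ : CubeIndex n × F → ℂ} {c d : CubeIndex n × F → (Fin n → Fin 2) → ℝ}
    {A B : CubeIndex n × F → ℝ} (hc : ∀ i j, |c i j| ≤ A i) (hd : ∀ i j, |d i j| ≤ B i)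
    {β G₁ G₂ : CubeIndex n → ℝ} (hβ : ∀ Q, 0 ≤ β Q)
    (hκ : ∀ i, ‖κ i‖ * (A i * B i) * √(mass D s i.1 * mass D r i.1) ≤ β i.1)
    (hG₁0 : ∀ Q, 0 ≤ G₁ Q)
    (hG₁ : ∀ Q, β Q * mass D s Q + ∑ j, mass D s (child D Q j) * G₁ (child D Q j) ≤
      mass D s Q * G₁ Q) (hG₂0 : ∀ Q, 0 ≤ G₂ Q)
    (hG₂ : ∀ Q, β Q * mass D r Q + ∑ j, mass D r (child D Q j) * G₂ (child D Q j) ≤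
      mass D r Q * G₂ Q) {t : ℝ} (ht : 0 < t)
    (S : Finset (CubeIndex n × F))
    (hS : ∀ i ∈ S, 4 * (Fintype.card F + 1) * (G₁ i.1 + G₂ i.1) ≤ t) :
    ‖∑ i ∈ S, rankOne ℂ (κ i • hr.vec D i.1 (d i)) (hs.vec D i.1 (c i))‖ ≤ t := by
  set N : ℝ := (Fintype.card F : ℝ) with hN
  have hN0 : 0 ≤ N := Nat.cast_nonneg _
  set τ := t / (4 * (N + 1)) with hτ
  have hτ0 : 0 < τ := by positivity
  have hτt : N * (4 * τ) ≤ t := by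
    have h1 : 4 * (N + 1) * τ = t := by rw [hτ]; field_simp
    nlinarith
  have hS' : ∀ i ∈ S, G₁ i.1 + G₂ i.1 ≤ τ := fun i hi => by
    rw [hτ, le_div_iff₀ (by positivity), mul_comm]; exact hS i hi
  have hsumle {w : Rn n → ℝ} (hw : HalfWeight M w) {G : CubeIndex n → ℝ} (hG0 : ∀ Q, 0 ≤ G Q)
      (hG : ∀ Q, β Q * mass D w Q + ∑ j, mass D w (child D Q j) * G (child D Q j) ≤
        mass D w Q * G Q) (hGG : ∀ Q, G Q ≤ G₁ Q + G₂ Q) (f : L2 n) :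
      ∑ i ∈ S, β i.1 * ((∫ x in dyadicCube D i.1, w x * ‖f x‖) ^ 2 / mass D w i.1) ≤
        t * ‖f‖ ^ 2 := by
    refine (hw.sum_carleson_le D hβ hG0 hG hGG hτ0 f S hS').trans ?_
    calc _ = N * (4 * τ) * ‖f‖ ^ 2 := by ring
      _ ≤ _ := by gcongr
  have hform (f g : L2 n) :
      ‖inner ℂ g ((∑ i ∈ S, rankOne ℂ (κ i • hr.vec D i.1 (d i)) (hs.vec D i.1 (c i))) f)‖ ≤
        t * ‖f‖ * ‖g‖ := by
    rw [sum_apply, inner_sum]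
    refine (norm_sum_le _ _).trans ?_
    set X : CubeIndex n → ℝ := fun Q => ∫ x in dyadicCube D Q, s x * ‖f x‖ with hX
    set Y : CubeIndex n → ℝ := fun Q => ∫ x in dyadicCube D Q, r x * ‖g x‖ with hY
    have hX0 (Q : CubeIndex n) : 0 ≤ X Q := integral_nonneg_of_ae (ae_restrict_of_ae
      (hs.pos.mono fun x hx => mul_nonneg hx.le (norm_nonneg _)))
    have hY0 (Q : CubeIndex n) : 0 ≤ Y Q := integral_nonneg_of_ae (ae_restrict_of_ae
      (hr.pos.mono fun x hx => mul_nonneg hx.le (norm_nonneg _)))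
    have hterm (i : CubeIndex n × F) :
        ‖inner ℂ g (rankOne ℂ (κ i • hr.vec D i.1 (d i)) (hs.vec D i.1 (c i)) f)‖ ≤
        √(β i.1 * (X i.1 ^ 2 / mass D s i.1)) * √(β i.1 * (Y i.1 ^ 2 / mass D r i.1)) := by
      have hA0 : 0 ≤ A i := (abs_nonneg _).trans (hc i 0)
      have hB0 : 0 ≤ B i := (abs_nonneg _).trans (hd i 0)
      have hm := hs.mass_pos D i.1
      have hm' := hr.mass_pos D i.1
      have h1 := hs.norm_inner_vec_le D i.1 (hc i) f
      have h2 := hr.norm_inner_vec_le D i.1 (hd i) g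
      rw [rankOne_apply, inner_smul_right, inner_smul_right, norm_mul, norm_mul,
        norm_inner_symm g]
      calc _ ≤ (A i * X i.1) * (‖κ i‖ * (B i * Y i.1)) := by
            gcongr
            exact mul_nonneg hA0 (hX0 _)
        _ = (‖κ i‖ * (A i * B i) * √(mass D s i.1 * mass D r i.1)) *
              (X i.1 / √(mass D s i.1) * (Y i.1 / √(mass D r i.1))) := by
            rw [Real.sqrt_mul hm.le]
            field_simp
        _ ≤ β i.1 * (X i.1 / √(mass D s i.1) * (Y i.1 / √(mass D r i.1))) := by
            gcongr
            · exact mul_nonneg (div_nonneg (hX0 _) (Real.sqrt_nonneg _))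
                (div_nonneg (hY0 _) (Real.sqrt_nonneg _))
            · exact hκ i
        _ = _ := by
            rw [Real.sqrt_mul (hβ _), Real.sqrt_mul (hβ _), Real.sqrt_div (sq_nonneg _),
              Real.sqrt_div (sq_nonneg _), Real.sqrt_sq (hX0 _), Real.sqrt_sq (hY0 _),
              mul_mul_mul_comm, Real.mul_self_sqrt (hβ _)]
    refine (Finset.sum_le_sum fun i _ => hterm i).trans ?_
    refine (Real.sum_sqrt_mul_sqrt_le _
      (fun i => mul_nonneg (hβ _) (div_nonneg (sq_nonneg _) (hs.mass_pos D _).le))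
      (fun i => mul_nonneg (hβ _) (div_nonneg (sq_nonneg _) (hr.mass_pos D _).le))).trans ?_
    calc _ ≤ √(t * ‖f‖ ^ 2) * √(t * ‖g‖ ^ 2) := by
          gcongr
          · exact hsumle hs hG₁0 hG₁ (fun Q => le_add_of_nonneg_right (hG₂0 Q)) f
          · exact hsumle hr hG₂0 hG₂ (fun Q => le_add_of_nonneg_left (hG₁0 Q)) g
      _ = _ := by
          rw [Real.sqrt_mul ht.le, Real.sqrt_mul ht.le, Real.sqrt_sq (norm_nonneg _),
            Real.sqrt_sq (norm_nonneg _), mul_mul_mul_comm, Real.mul_self_sqrt ht.le]; ring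
  refine ContinuousLinearMap.opNorm_le_bound _ ht.le fun f => ?_
  set T := ∑ i ∈ S, rankOne ℂ (κ i • hr.vec D i.1 (d i)) (hs.vec D i.1 (c i))
  have h1 := hform f (T f)
  have h2 : ‖inner ℂ (T f) (T f)‖ = ‖T f‖ * ‖T f‖ := by
    rw [inner_self_eq_norm_sq_to_K, norm_pow, RCLike.norm_ofReal, abs_norm, sq]
  rw [h2] at h1
  by_cases h0 : ‖T f‖ = 0
  · rw [h0]; positivity
  · exact le_of_mul_le_mul_right h1 (lt_of_le_of_ne (norm_nonneg _) (Ne.symm h0))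

open InnerProductSpace in
/-- The upper bound for operators of paraproduct type. The `i`-th term is the operator
`f ↦ κ ⟨f, s φ⟩ r ψ` of rank one, where `φ` and `ψ` are step functions on a cube bounded by `A`
and `B`. -/
theorem exists_schattenNorm_tsum_le (n : ℕ) (hn : 1 ≤ n) {M : ℝ} (hM : 1 ≤ M) {p : ℝ} (hp : 1 ≤ p)
    (F : Type) [Fintype F] : ∃ C : ℝ≥0∞, C ≠ ∞ ∧ ∀ (D : DyadicSystem n) (s r : Rn n → ℝ)
      (hs : HalfWeight M s) (hr : HalfWeight M r) (κ : CubeIndex n × F → ℂ)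
      (c d : CubeIndex n × F → (Fin n → Fin 2) → ℝ) (A B : CubeIndex n × F → ℝ)
      (β : CubeIndex n → ℝ), (∀ i j, |c i j| ≤ A i) → (∀ i j, |d i j| ≤ B i) → (∀ Q, 0 ≤ β Q) →
      (∀ i, ‖κ i‖ * (A i * B i) * √(mass D s i.1 * mass D r i.1) ≤ β i.1) →
      ∑' Q, ENNReal.ofReal (β Q ^ p) ≠ ∞ →
      Summable (fun i => rankOne ℂ (κ i • hr.vec D i.1 (d i)) (hs.vec D i.1 (c i))) ∧
        schattenNorm p (∑' i, rankOne ℂ (κ i • hr.vec D i.1 (d i)) (hs.vec D i.1 (c i))) ^ p ≤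
          C * ∑' Q, ENNReal.ofReal (β Q ^ p) := by
  have hp0 : 0 < p := by linarith
  set K : ℝ := 4 * (Fintype.card F + 1) with hK
  have hK0 : 0 < K := by positivity
  set L := majorantConst n M p with hL
  have hLT : L ≠ ∞ := majorantConst_ne_top hn hM hp0
  refine ⟨Fintype.card F * (ENNReal.ofReal (K ^ p) * (2 ^ (p - 1) * (L + L))), ?_, ?_⟩
  · refine ENNReal.mul_ne_top (ENNReal.natCast_ne_top _) (ENNReal.mul_ne_top ENNReal.ofReal_ne_top
      (ENNReal.mul_ne_top ?_ (ENNReal.add_ne_top.2 ⟨hLT, hLT⟩)))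
    exact ENNReal.rpow_ne_top_of_nonneg (by linarith) (by simp)
  intro D s r hs hr κ c d A B β hc hd hβ hκ hsum
  obtain ⟨G₁, hG₁0, hG₁, hG₁p⟩ := hs.exists_majorant D hn hM hp hβ hsum
  obtain ⟨G₂, hG₂0, hG₂, hG₂p⟩ := hr.exists_majorant D hn hM hp hβ hsum
  set γ : CubeIndex n × F → ℝ := fun i => K * (G₁ i.1 + G₂ i.1) with hγ
  have hγp : ∑' i, ENNReal.ofReal (γ i ^ p) ≤
      Fintype.card F * (ENNReal.ofReal (K ^ p) * (2 ^ (p - 1) * (L + L))) *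
        ∑' Q, ENNReal.ofReal (β Q ^ p) := by
    have h1 (Q : CubeIndex n) : ENNReal.ofReal ((K * (G₁ Q + G₂ Q)) ^ p) ≤
        ENNReal.ofReal (K ^ p) * (2 ^ (p - 1) *
          (ENNReal.ofReal (G₁ Q ^ p) + ENNReal.ofReal (G₂ Q ^ p))) := by
      rw [Real.mul_rpow hK0.le (add_nonneg (hG₁0 Q) (hG₂0 Q)),
        ENNReal.ofReal_mul (by positivity), ← ENNReal.ofReal_rpow_of_nonneg
          (add_nonneg (hG₁0 Q) (hG₂0 Q)) hp0.le, ENNReal.ofReal_add (hG₁0 Q) (hG₂0 Q),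
        ← ENNReal.ofReal_rpow_of_nonneg (hG₁0 Q) hp0.le,
        ← ENNReal.ofReal_rpow_of_nonneg (hG₂0 Q) hp0.le]
      gcongr
      exact ENNReal.rpow_add_le_mul_rpow_add_rpow _ _ hp
    calc ∑' i, ENNReal.ofReal (γ i ^ p)
        = Fintype.card F * ∑' Q, ENNReal.ofReal ((K * (G₁ Q + G₂ Q)) ^ p) := by
          rw [ENNReal.tsum_prod (f := fun Q (_ : F) => ENNReal.ofReal ((K * (G₁ Q + G₂ Q)) ^ p)),
            ← ENNReal.tsum_mul_left]
          refine tsum_congr fun Q => ?_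
          rw [tsum_fintype, Finset.sum_const, Finset.card_univ, nsmul_eq_mul]
      _ ≤ Fintype.card F * ∑' Q, ENNReal.ofReal (K ^ p) * (2 ^ (p - 1) *
          (ENNReal.ofReal (G₁ Q ^ p) + ENNReal.ofReal (G₂ Q ^ p))) := by
          gcongr with Q; exact h1 Q
      _ = Fintype.card F * (ENNReal.ofReal (K ^ p) * (2 ^ (p - 1) *
          (∑' Q, ENNReal.ofReal (G₁ Q ^ p) + ∑' Q, ENNReal.ofReal (G₂ Q ^ p)))) := by
          rw [ENNReal.tsum_mul_left, ENNReal.tsum_mul_left, ENNReal.tsum_add]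
      _ ≤ Fintype.card F * (ENNReal.ofReal (K ^ p) * (2 ^ (p - 1) *
          (L * ∑' Q, ENNReal.ofReal (β Q ^ p) + L * ∑' Q, ENNReal.ofReal (β Q ^ p)))) := by
          gcongr
      _ = _ := by ring
  have hγT : ∑' i, ENNReal.ofReal (γ i ^ p) ≠ ∞ := by
    refine ne_top_of_le_ne_top (ENNReal.mul_ne_top ?_ hsum) hγp
    refine ENNReal.mul_ne_top (ENNReal.natCast_ne_top _) (ENNReal.mul_ne_top ENNReal.ofReal_ne_top
      (ENNReal.mul_ne_top ?_ (ENNReal.add_ne_top.2 ⟨hLT, hLT⟩)))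
    exact ENNReal.rpow_ne_top_of_nonneg (by linarith) (by simp)
  have h := schattenNorm_tsum_rankOne_le (fun i => κ i • hr.vec D i.1 (d i))
    (fun i => hs.vec D i.1 (c i)) γ
    (fun i => mul_nonneg hK0.le (add_nonneg (hG₁0 _) (hG₂0 _))) hp0 hγT
    (fun t ht S hS => norm_sum_rankOne_le D hs hr hc hd hβ hκ hG₁0 hG₁ hG₂0 hG₂ ht S hS)
  exact ⟨h.1, h.2.trans hγp⟩

end Upper

section Lower

variable {n : ℕ} {M : ℝ} {s r : Rn n → ℝ} (D : DyadicSystem n)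

/-! ### The lower bounds for Schatten norms -/

/-- The values of the Haar function `h_Q^ε` on the children of `Q`. -/
def haarVal (Q : CubeIndex n) (ε j : Fin n → Fin 2) : ℝ := (√(side Q ^ n))⁻¹ * haarSign ε j

theorem side_pow_pos (Q : CubeIndex n) : 0 < side Q ^ n := pow_pos (side_pos Q) n

theorem abs_haarVal (Q : CubeIndex n) (ε j : Fin n → Fin 2) :
    |haarVal Q ε j| = (√(side Q ^ n))⁻¹ := by
  rw [haarVal, abs_mul, abs_haarSign, mul_one, abs_of_nonneg (by positivity)]

theorem sum_haarVal_mul (Q : CubeIndex n) (ε η : Fin n → Fin 2) :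
    ∑ j, haarVal Q ε j * haarVal Q η j = if ε = η then 2 ^ n / side Q ^ n else 0 := by
  have h (j : Fin n → Fin 2) : haarVal Q ε j * haarVal Q η j =
      (side Q ^ n)⁻¹ * (haarSign ε j * haarSign η j) := by
    rw [haarVal, haarVal, mul_mul_mul_comm, ← mul_inv, Real.mul_self_sqrt (side_pow_pos Q).le]
  simp only [h]
  rw [← Finset.mul_sum, sum_haarSign_mul]
  split_ifs
  · rw [inv_mul_eq_div]
  · rw [mul_zero]

theorem sum_haarVal (Q : CubeIndex n) {ε : Fin n → Fin 2} (hε : ε ≠ 1) :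
    ∑ j, haarVal Q ε j = 0 := by
  simp only [haarVal]
  rw [← Finset.mul_sum, sum_haarSign hε, mul_zero]

/-- The orthogonality of Haar functions. -/
theorem HalfWeight.inner_haarVal (hs : HalfWeight M s) (Q R : CubeIndex n)
    {ε η : Fin n → Fin 2} (hε : ε ≠ 1) (hη : η ≠ 1) (a : ℝ) :
    inner ℂ (hs.vec D R fun j => a * haarVal R η j) (hs.inv.vec D Q (haarVal Q ε)) =
      if R = Q ∧ η = ε then (a : ℂ) else 0 := by
  by_cases hRQ : R = Q
  · subst hRQ
    rw [hs.inner_vec_inv_self]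
    simp only [mul_assoc]
    rw [← Finset.mul_sum, sum_haarVal_mul]
    by_cases h : η = ε
    · rw [if_pos h, if_pos ⟨trivial, h⟩]
      have := (side_pow_pos R).ne'
      congr 1
      field_simp
    · rw [if_neg h, if_neg fun h' => h h'.2]; simp
  · rw [if_neg fun h => hRQ h.1, hs.inner_vec_inv_of_ne D hRQ _ (sum_haarVal Q hε)]
    rw [← Finset.mul_sum, sum_haarVal R hη, mul_zero]

/-- The size `|b| |Q|^(-3/2) (s²(Q) r²(Q))^(1/2)` of a coefficient `b` for the cube `Q`. It bounds the
norm of the corresponding operators of rank one, and for `A₂` weights it is comparable to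
`|b| |Q|^(1/2) / ν(Q)`, where `ν = (s r)⁻¹`. -/
def coefSize (s r : Rn n → ℝ) (Q : CubeIndex n) (b : ℂ) : ℝ :=
  ‖b‖ * ((side Q ^ n)⁻¹ * (√(side Q ^ n))⁻¹) * √(mass D s Q * mass D r Q)

theorem coefSize_nonneg (s r : Rn n → ℝ) (Q : CubeIndex n) (b : ℂ) : 0 ≤ coefSize D s r Q b := by
  have := side_pow_pos Q
  rw [coefSize]; positivity

theorem coefSize_symm (s r : Rn n → ℝ) (Q : CubeIndex n) (b : ℂ) :
    coefSize D s r Q b = coefSize D r s Q b := by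
  rw [coefSize, coefSize, mul_comm (mass D s Q)]

theorem HalfWeight.norm_inv_haarVal_le (hs : HalfWeight M s) (Q : CubeIndex n)
    (ε : Fin n → Fin 2) : ‖hs.inv.vec D Q (haarVal Q ε)‖ ≤
      (√(side Q ^ n))⁻¹ * √(mass D (fun x => (s x)⁻¹) Q) :=
  hs.inv.norm_vec_le D Q (by positivity) fun j => (abs_haarVal Q ε j).le

theorem coefSize_le (hs : HalfWeight M s) (hr : HalfWeight M r) (hM : 0 ≤ M) {Q : CubeIndex n}
    {b : ℂ} {K X : ℝ} (hK : 0 < K) (hX : 0 ≤ X) (h : ‖b‖ * (√(mass D s Q) / (side Q ^ n * K)) ≤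
      X * ((√(side Q ^ n))⁻¹ * √(mass D (fun x => (r x)⁻¹) Q))) :
    coefSize D s r Q b ≤ K * √M * X := by
  have hm := side_pow_pos Q
  have h1 : √(mass D r Q) * √(mass D (fun x => (r x)⁻¹) Q) ≤ √M * side Q ^ n := by
    rw [← Real.sqrt_mul (hr.mass_pos D Q).le]
    refine (Real.sqrt_le_sqrt (hr.mass_mul_le D Q)).trans ?_
    rw [Real.sqrt_mul hM, Real.sqrt_sq hm.le]
  have hsm : 0 < √(side Q ^ n) := Real.sqrt_pos.2 hm
  calc coefSize D s r Q b = (‖b‖ * (√(mass D s Q) / (side Q ^ n * K))) *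
        (K * (√(side Q ^ n))⁻¹ * √(mass D r Q)) := by
        rw [coefSize, Real.sqrt_mul (hs.mass_pos D Q).le]
        field_simp
    _ ≤ (X * ((√(side Q ^ n))⁻¹ * √(mass D (fun x => (r x)⁻¹) Q))) *
        (K * (√(side Q ^ n))⁻¹ * √(mass D r Q)) := by gcongr
    _ = X * K * ((√(side Q ^ n))⁻¹ * (√(side Q ^ n))⁻¹) *
        (√(mass D r Q) * √(mass D (fun x => (r x)⁻¹) Q)) := by ring
    _ ≤ X * K * ((√(side Q ^ n))⁻¹ * (√(side Q ^ n))⁻¹) * (√M * side Q ^ n) := by gcongr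
    _ = _ := by
        rw [← mul_inv, Real.mul_self_sqrt hm.le]
        field_simp

open InnerProductSpace in
/-- A matrix coefficient of a sum of operators of rank one, when only one term contributes. -/
theorem inner_hasSum_rankOne {H ι : Type*} [NormedAddCommGroup H] [InnerProductSpace ℂ H]
    {x y : ι → H} {f g z : H} (h : HasSum (fun i => rankOne ℂ (x i) (y i) f) z) (i : ι)
    (h0 : ∀ k, k ≠ i → inner ℂ (y k) f * inner ℂ g (x k) = 0) :
    inner ℂ g z = inner ℂ (y i) f * inner ℂ g (x i) := by
  have h1 : HasSum (fun k => inner ℂ (y k) f * inner ℂ g (x k)) (inner ℂ g z) := by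
    have := h.mapL (innerSL ℂ g)
    simpa [inner_smul_right] using this
  exact h1.unique (hasSum_single i h0)

/-- The values on the children of `P` of the function `1_Q / v(Q) - 1_P / v(P)`, times
`v(Q)^(1/2)`, where `Q` is the `j`-th child of `P`, and `v` is the measure with density `s²`.
In contrast to `1_Q`, this function has `v`-mean zero, so that it is orthogonal to the analogous
functions for other cubes `P`. -/
def bump (s : Rn n → ℝ) (P : CubeIndex n) (j k : Fin n → Fin 2) : ℝ :=
  √(mass D s (child D P j)) *
    ((if k = j then (mass D s (child D P j))⁻¹ else 0) - (mass D s P)⁻¹)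

theorem HalfWeight.sum_bump (hs : HalfWeight M s) (P : CubeIndex n) (j : Fin n → Fin 2) :
    ∑ k, bump D s P j k * mass D s (child D P k) = 0 := by
  have h1 := (hs.mass_pos D P).ne'
  have h2 := (hs.mass_pos D (child D P j)).ne'
  simp only [bump, mul_assoc, sub_mul, ite_mul, zero_mul]
  rw [← Finset.mul_sum, Finset.sum_sub_distrib, Finset.sum_ite_eq' Finset.univ j,
    if_pos (Finset.mem_univ j), ← Finset.mul_sum, hs.sum_mass_child, inv_mul_cancel₀ h1,
    inv_mul_cancel₀ h2, sub_self, mul_zero]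

theorem HalfWeight.norm_bump_le (hs : HalfWeight M s) (P : CubeIndex n) (j : Fin n → Fin 2) :
    ‖hs.vec D P (bump D s P j)‖ ≤ 1 := by
  have h1 := hs.mass_pos D P
  have h2 := hs.mass_pos D (child D P j)
  refine le_of_sq_le_sq ?_ zero_le_one
  rw [hs.norm_vec_sq]
  set u := mass D s (child D P j) with hu
  set v := mass D s P with hv
  have h3 (k : Fin n → Fin 2) : bump D s P j k ^ 2 * mass D s (child D P k) =
      u * ((if k = j then (u⁻¹ ^ 2 - 2 * u⁻¹ * v⁻¹) * mass D s (child D P k) else 0) +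
        v⁻¹ ^ 2 * mass D s (child D P k)) := by
    rw [bump, mul_pow, Real.sq_sqrt h2.le]
    split_ifs <;> ring
  simp only [h3]
  rw [← Finset.mul_sum, Finset.sum_add_distrib, Finset.sum_ite_eq' Finset.univ j,
    if_pos (Finset.mem_univ j), ← Finset.mul_sum, hs.sum_mass_child, ← hu, ← hv]
  have h4 : u * ((u⁻¹ ^ 2 - 2 * u⁻¹ * v⁻¹) * u + v⁻¹ ^ 2 * v) = 1 - u * v⁻¹ := by
    field_simp; ring
  rw [h4]
  have : 0 < u * v⁻¹ := by positivity
  linarith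

theorem HalfWeight.inner_vec_bump_self (hs : HalfWeight M s) {P R : CubeIndex n} (h : P ≠ R)
    (j : Fin n → Fin 2) :
    inner ℂ (hs.vec D P (bump D s P j)) (hs.vec D R (bump D s R j)) = 0 :=
  hs.inner_vec_self_of_ne D h (hs.sum_bump D P j) (hs.sum_bump D R j)

theorem HalfWeight.inner_const_bump (hs : HalfWeight M s) (P : CubeIndex n) (j : Fin n → Fin 2)
    (a : ℝ) : inner ℂ (hs.vec D (child D P j) fun _ => a) (hs.vec D P (bump D s P j)) =
      ((a * (√(mass D s (child D P j)) * (1 - mass D s (child D P j) / mass D s P)) : ℝ) : ℂ) := by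
  have h1 := (hs.mass_pos D P).ne'
  have h2 := (hs.mass_pos D (child D P j)).ne'
  rw [hs.inner_vec_vec]
  simp only [← sq (s _)]
  have h3 (x : Rn n) : s x ^ 2 * (step D (child D P j) (fun _ => a) x * step D P (bump D s P j) x) =
      s x ^ 2 * step D (child D P j) (fun _ => a * bump D s P j j) x := by
    by_cases hx : x ∈ dyadicCube D (child D P j)
    · rw [step_of_mem D hx, step_const, step_const, Set.indicator_of_mem hx,
        Set.indicator_of_mem hx]
    · rw [step_of_notMem D hx, step_of_notMem D hx, zero_mul]
  simp only [h3]
  rw [integral_mul_step_real D (hs.integrableOn D _), ← Finset.mul_sum]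
  congr 1
  have h4 := hs.sum_mass_child D (child D P j)
  simp only [mass] at h4
  rw [h4, bump, if_pos rfl]
  change _ * mass D s (child D P j) = _
  field_simp

theorem one_sub_div_ge (hs : HalfWeight M s) (hn : 1 ≤ n) (hM : 1 ≤ M) (P : CubeIndex n)
    (j : Fin n → Fin 2) :
    (M * 4 ^ n)⁻¹ ≤ 1 - mass D s (child D P j) / mass D s P := by
  have := nontrivial_children hn
  have h := child_le_of_doubling (hs.sum_mass_child D) (hs.mass_pos D)
    (by positivity : 0 < M * 4 ^ n) (hs.mass_le_mass_child D) P j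
  have h1 : mass D s (child D P j) / mass D s P ≤ 1 - (M * 4 ^ n)⁻¹ := by
    rw [div_le_iff₀ (hs.mass_pos D P)]; exact h
  linarith

theorem ofReal_rpow_le_of_le {a C : ℝ} {H : Type*} [NormedAddCommGroup H] {x : H} {p : ℝ}
    (hp : 0 < p) (ha0 : 0 ≤ a) (hC : 0 ≤ C) (h : a ≤ C * ‖x‖) :
    ENNReal.ofReal (a ^ p) ≤ ENNReal.ofReal (C ^ p) * ‖x‖ₑ ^ p := by
  rw [← ENNReal.ofReal_rpow_of_nonneg ha0 hp.le, ← ENNReal.ofReal_rpow_of_nonneg hC hp.le,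
    ← ENNReal.mul_rpow_of_nonneg _ _ hp.le, ← ofReal_norm, ← ENNReal.ofReal_mul hC]
  gcongr

theorem tsum_child (u : CubeIndex n → ℝ≥0∞) : ∑' Q, u Q = ∑ j, ∑' P, u (child D P j) := by
  rw [← (Equiv.ofBijective _ (child_bijective D)).tsum_eq u]
  simp only [Equiv.ofBijective_apply]
  rw [ENNReal.tsum_prod (f := fun P j => u (child D P j)), ENNReal.tsum_comm, tsum_fintype]

open InnerProductSpace in
/-- The lower bound for `Π_b`: the operator is applied to the function `bump` of the parent of `Q`,
which has a nonzero average over `Q`. -/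
theorem paraOp_lower (hs : HalfWeight M s) (hr : HalfWeight M r) (hn : 1 ≤ n) (hM : 1 ≤ M)
    {p : ℝ} (hp : 2 ≤ p) (b : CubeIndex n → (Fin n → Fin 2) → ℂ) {T : L2 n →L[ℂ] L2 n}
    (hT : ∀ f, HasSum (fun i : CubeIndex n × Canc n => rankOne ℂ
      (b i.1 i.2.1 • hr.vec D i.1 (haarVal i.1 i.2.1)) (hs.vec D i.1 fun _ => (side i.1 ^ n)⁻¹) f)
      (T f)) (ε : Canc n) :
    ∑' Q, ENNReal.ofReal (coefSize D s r Q (b Q ε.1) ^ p) ≤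
      Fintype.card (Fin n → Fin 2) * (ENNReal.ofReal ((M * 4 ^ n * √M) ^ p) *
        schattenNorm p T ^ p) := by
  have hp0 : 0 < p := by linarith
  rw [tsum_child D]
  have hj (j : Fin n → Fin 2) :
      ∑' P, ENNReal.ofReal (coefSize D s r (child D P j) (b (child D P j) ε.1) ^ p) ≤
        ENNReal.ofReal ((M * 4 ^ n * √M) ^ p) * schattenNorm p T ^ p := by
    have h := tsum_enorm_apply_rpow_le T (fun P => hs.vec D P (bump D s P j))
      (fun P R hPR => hs.inner_vec_bump_self D hPR j) (fun P => hs.norm_bump_le D P j) hp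
    refine le_trans ?_ (mul_le_mul_right h _)
    rw [← ENNReal.tsum_mul_left]
    refine ENNReal.tsum_le_tsum fun P => ofReal_rpow_le_of_le hp0 (coefSize_nonneg D _ _ _ _)
      (by positivity) ?_
    set Q := child D P j with hQ
    refine coefSize_le D hs hr (by positivity) (by positivity) (norm_nonneg _) ?_
    have h1 := inner_hasSum_rankOne (hT (hs.vec D P (bump D s P j)))
      (g := hr.inv.vec D Q (haarVal Q ε.1)) (Q, ε) (fun k hk => by
        have h2 := hr.inner_haarVal D Q k.1 ε.2 k.2.2 1
        simp only [one_mul] at h2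
        rw [if_neg fun h' => hk (Prod.ext h'.1 (Subtype.ext h'.2))] at h2
        rw [inner_smul_right, inner_eq_zero_symm.1 h2]; simp)
    have h2 := hr.inner_haarVal D Q Q ε.2 ε.2 1
    simp only [one_mul] at h2
    rw [if_pos ⟨trivial, trivial⟩, Complex.ofReal_one] at h2
    have h3 := congrArg (fun z : ℂ => ‖z‖) h1
    simp only at h3
    rw [inner_smul_right, norm_mul, norm_mul, norm_inner_symm _ (hr.vec D Q _), h2, norm_one,
      mul_one, hQ, hs.inner_const_bump, Complex.norm_real, ← hQ] at h3
    have h4 := one_sub_div_ge D hs hn hM P j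
    rw [← hQ] at h4
    have hm := side_pow_pos Q
    calc _ ≤ ‖(side Q ^ n)⁻¹ * (√(mass D s Q) * (1 - mass D s Q / mass D s P))‖ * ‖b Q ε.1‖ := by
          rw [mul_comm]
          gcongr
          refine le_trans ?_ (le_abs_self _)
          calc _ = (side Q ^ n)⁻¹ * (√(mass D s Q) * (M * 4 ^ n)⁻¹) := by field_simp
            _ ≤ _ := by gcongr
      _ = _ := h3.symm
      _ ≤ ‖hr.inv.vec D Q (haarVal Q ε.1)‖ * ‖T (hs.vec D P (bump D s P j))‖ := norm_inner_le_norm _ _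
      _ ≤ _ := by
          rw [mul_comm]
          gcongr
          exact hr.norm_inv_haarVal_le D Q ε.1
  calc _ ≤ ∑ _j : Fin n → Fin 2, ENNReal.ofReal ((M * 4 ^ n * √M) ^ p) * schattenNorm p T ^ p :=
        Finset.sum_le_sum fun j _ => hj j
    _ = _ := by rw [Finset.sum_const, Finset.card_univ, nsmul_eq_mul]

open InnerProductSpace in
/-- The lower bound for `Π*_b`, which is that for `Π_b` applied to the adjoint operator. -/
theorem paraStarOp_lower (hs : HalfWeight M s) (hr : HalfWeight M r) (hn : 1 ≤ n) (hM : 1 ≤ M)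
    {p : ℝ} (hp : 2 ≤ p) (b : CubeIndex n → (Fin n → Fin 2) → ℂ) {T : L2 n →L[ℂ] L2 n}
    (hT : ∀ f, HasSum (fun i : CubeIndex n × Canc n => rankOne ℂ
      (b i.1 i.2.1 • hr.vec D i.1 fun _ => (side i.1 ^ n)⁻¹) (hs.vec D i.1 (haarVal i.1 i.2.1)) f)
      (T f)) (ε : Canc n) :
    ∑' Q, ENNReal.ofReal (coefSize D s r Q (b Q ε.1) ^ p) ≤
      Fintype.card (Fin n → Fin 2) * (ENNReal.ofReal ((M * 4 ^ n * √M) ^ p) *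
        schattenNorm p T ^ p) := by
  have hp0 : 0 < p := by linarith
  rw [tsum_child D]
  have hj (j : Fin n → Fin 2) :
      ∑' P, ENNReal.ofReal (coefSize D s r (child D P j) (b (child D P j) ε.1) ^ p) ≤
        ENNReal.ofReal ((M * 4 ^ n * √M) ^ p) * schattenNorm p T ^ p := by
    have h := tsum_enorm_adjoint_apply_rpow_le T (fun P => hr.vec D P (bump D r P j))
      (fun P R hPR => hr.inner_vec_bump_self D hPR j) (fun P => hr.norm_bump_le D P j) hp
    refine le_trans ?_ (mul_le_mul_right h _)
    rw [← ENNReal.tsum_mul_left]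
    refine ENNReal.tsum_le_tsum fun P => ofReal_rpow_le_of_le hp0 (coefSize_nonneg D _ _ _ _)
      (by positivity) ?_
    set Q := child D P j with hQ
    rw [coefSize_symm]
    refine coefSize_le D hr hs (by positivity) (by positivity) (norm_nonneg _) ?_
    have h2 := hs.inner_haarVal D Q Q ε.2 ε.2 1
    simp only [one_mul] at h2
    rw [if_pos ⟨trivial, trivial⟩, Complex.ofReal_one] at h2
    have h1 := inner_hasSum_rankOne (hT (hs.inv.vec D Q (haarVal Q ε.1)))
      (g := hr.vec D P (bump D r P j)) (Q, ε) (fun k hk => by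
        have h2 := hs.inner_haarVal D Q k.1 ε.2 k.2.2 1
        simp only [one_mul] at h2
        rw [if_neg fun h' => hk (Prod.ext h'.1 (Subtype.ext h'.2))] at h2
        rw [h2, zero_mul])
    have h3 := congrArg (fun z : ℂ => ‖z‖) h1
    simp only at h3
    rw [inner_smul_right, norm_mul, norm_mul, norm_inner_symm _ (hr.vec D Q _), h2, norm_one,
      one_mul, hQ, hr.inner_const_bump, Complex.norm_real, ← hQ,
      ← ContinuousLinearMap.adjoint_inner_left] at h3
    have h4 := one_sub_div_ge D hr hn hM P j
    rw [← hQ] at h4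
    have hm := side_pow_pos Q
    calc _ ≤ ‖b Q ε.1‖ *
          ‖(side Q ^ n)⁻¹ * (√(mass D r Q) * (1 - mass D r Q / mass D r P))‖ := by
          gcongr
          refine le_trans ?_ (le_abs_self _)
          calc _ = (side Q ^ n)⁻¹ * (√(mass D r Q) * (M * 4 ^ n)⁻¹) := by field_simp
            _ ≤ _ := by gcongr
      _ = _ := h3.symm
      _ ≤ _ := norm_inner_le_norm _ _
      _ ≤ _ := by
          gcongr
          exact hs.norm_inv_haarVal_le D Q ε.1
  calc _ ≤ ∑ _j : Fin n → Fin 2, ENNReal.ofReal ((M * 4 ^ n * √M) ^ p) * schattenNorm p T ^ p :=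
        Finset.sum_le_sum fun j _ => hj j
    _ = _ := by rw [Finset.sum_const, Finset.card_univ, nsmul_eq_mul]

/-- The values on the children of `Q` of the function `H` for which `s² H` has the same integral
over each child as a multiple of the Haar function of signature `η`. -/
def dualHaar (s : Rn n → ℝ) (M : ℝ) (Q : CubeIndex n) (η j : Fin n → Fin 2) : ℝ :=
  √(mass D s Q / (2 ^ n * (M * 4 ^ n))) * (haarSign η j * (mass D s (child D Q j))⁻¹)

theorem HalfWeight.sum_dualHaar (hs : HalfWeight M s) (Q : CubeIndex n) (η : Fin n → Fin 2)
    (f : (Fin n → Fin 2) → ℝ) :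
    ∑ j, f j * dualHaar D s M Q η j * mass D s (child D Q j) =
      √(mass D s Q / (2 ^ n * (M * 4 ^ n))) * ∑ j, f j * haarSign η j := by
  rw [Finset.mul_sum]
  refine Finset.sum_congr rfl fun j _ => ?_
  have := (hs.mass_pos D (child D Q j)).ne'
  rw [dualHaar]
  field_simp

theorem HalfWeight.norm_dualHaar_le (hs : HalfWeight M s) (hM : 0 < M) (Q : CubeIndex n)
    (η : Fin n → Fin 2) : ‖hs.vec D Q (dualHaar D s M Q η)‖ ≤ 1 := by
  refine le_of_sq_le_sq ?_ zero_le_one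
  have hQ := hs.mass_pos D Q
  rw [hs.norm_vec_sq]
  have h1 (j : Fin n → Fin 2) :
      dualHaar D s M Q η j ^ 2 * mass D s (child D Q j) ≤ 1 / 2 ^ n := by
    have hj := hs.mass_pos D (child D Q j)
    have h2 := hs.mass_le_mass_child D Q j
    have h3 : haarSign η j ^ 2 = 1 := by rw [← sq_abs, abs_haarSign, one_pow]
    rw [dualHaar, mul_pow, mul_pow, h3, Real.sq_sqrt (by positivity)]
    have : mass D s Q / (2 ^ n * (M * 4 ^ n)) * (1 * (mass D s (child D Q j))⁻¹ ^ 2) *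
        mass D s (child D Q j) = mass D s Q / (M * 4 ^ n * mass D s (child D Q j)) * (1 / 2 ^ n) := by
      field_simp
    rw [this]
    refine mul_le_of_le_one_left (by positivity) ?_
    rw [div_le_one (by positivity)]; exact h2
  calc _ ≤ ∑ _j : Fin n → Fin 2, (1 : ℝ) / 2 ^ n := Finset.sum_le_sum fun j _ => h1 j
    _ = _ := by simp

open InnerProductSpace in
/-- The lower bound for `Γ_b`. The test functions `dualHaar` of signature `η` are biorthogonal, with
respect to the measure `s² dx`, to the Haar functions of the same cube, and `ε` is determined by `η`
and the signature of the product of the Haar functions of signatures `ε` and `η`. -/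
theorem gammaOp_lower (hs : HalfWeight M s) (hr : HalfWeight M r) (hM : 1 ≤ M)
    {p : ℝ} (hp : 2 ≤ p) (b : CubeIndex n → (Fin n → Fin 2) → ℂ) {T : L2 n →L[ℂ] L2 n}
    (hT : ∀ f, HasSum (fun i : CubeIndex n × CancPair n => rankOne ℂ
      (b i.1 i.2.1.1.1 • hr.vec D i.1 fun j => haarVal i.1 i.2.1.1.1 j * haarVal i.1 i.2.1.2.1 j)
      (hs.vec D i.1 (haarVal i.1 i.2.1.2.1)) f) (T f)) (e : CancPair n) :
    ∑' Q, ENNReal.ofReal (coefSize D s r Q (b Q e.1.1.1) ^ p) ≤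
      ENNReal.ofReal ((M * 4 ^ n * √M) ^ p) * schattenNorm p T ^ p := by
  have hp0 : 0 < p := by linarith
  obtain ⟨⟨ε, η⟩, hεη⟩ := e
  have hM0 : 0 < M := by linarith
  have hmul (Q : CubeIndex n) (ε η : Fin n → Fin 2) : (fun j => haarVal Q ε j * haarVal Q η j) =
      fun j => (√(side Q ^ n))⁻¹ * haarVal Q (mulSig ε η) j := by
    funext j
    simp only [haarVal]
    rw [← haarSign_mul]; ring
  have hsig {ε η : Canc n} (h : ε ≠ η) : mulSig ε.1 η.1 ≠ 1 :=
    mulSig_ne_one fun h' => h (Subtype.ext h')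
  have h := tsum_enorm_apply_rpow_le T (fun Q => hs.vec D Q (dualHaar D s M Q η.1))
    (fun P R hPR => by
      have h0 (Q : CubeIndex n) :
          ∑ j, dualHaar D s M Q η.1 j * mass D s (child D Q j) = 0 := by
        have := hs.sum_dualHaar D Q η.1 fun _ => 1
        simp only [one_mul] at this
        rw [this, sum_haarSign η.2, mul_zero]
      exact hs.inner_vec_self_of_ne D hPR (h0 P) (h0 R))
    (fun Q => hs.norm_dualHaar_le D hM0 Q η.1) hp
  refine le_trans ?_ (mul_le_mul_right h _)
  rw [← ENNReal.tsum_mul_left]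
  refine ENNReal.tsum_le_tsum fun Q => ofReal_rpow_le_of_le hp0 (coefSize_nonneg D _ _ _ _)
    (by positivity) ?_
  refine coefSize_le D hs hr hM0.le (by positivity) (norm_nonneg _) ?_
  have hm := side_pow_pos Q
  -- the inner products of the test function with the Haar functions of the cube `Q`
  have hin (η' : Canc n) : inner ℂ (hs.vec D Q (haarVal Q η'.1))
      (hs.vec D Q (dualHaar D s M Q η.1)) = ((√(mass D s Q / (2 ^ n * (M * 4 ^ n))) *
        ((√(side Q ^ n))⁻¹ * if η'.1 = η.1 then 2 ^ n else 0) : ℝ) : ℂ) := by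
    rw [hs.inner_vec_vec]
    simp only [← sq (s _)]
    rw [integral_step_mul_step_same D (hs.integrableOn D Q)]
    congr 1
    refine (hs.sum_dualHaar D Q η.1 _).trans ?_
    simp only [haarVal, mul_assoc]
    rw [← Finset.mul_sum, sum_haarSign_mul]
  have h1 := inner_hasSum_rankOne (hT (hs.vec D Q (dualHaar D s M Q η.1)))
    (g := hr.inv.vec D Q (haarVal Q (mulSig ε.1 η.1))) (Q, ⟨(ε, η), hεη⟩) (fun k hk => by
      obtain ⟨R, ⟨⟨ε', η'⟩, hεη'⟩⟩ := k
      have h2 := hr.inner_haarVal D Q R (hsig hεη) (hsig hεη') (√(side R ^ n))⁻¹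
      simp only [hmul]
      rw [inner_smul_right]
      by_cases hc : R = Q ∧ mulSig ε'.1 η'.1 = mulSig ε.1 η.1
      · obtain ⟨rfl, hc⟩ := hc
        have hne : η'.1 ≠ η.1 := by
          intro h3
          refine hk ?_
          have h4 : ε'.1 = ε.1 := by
            rw [← mulSig_mulSig ε'.1 η'.1, hc, h3, mulSig_mulSig]
          have h5 : ε' = ε := Subtype.ext h4
          have h6 : η' = η := Subtype.ext h3
          subst h5; subst h6; rfl
        rw [hin, if_neg hne]; simp
      · rw [if_neg hc] at h2
        rw [inner_eq_zero_symm.1 h2]; simp)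
  have h2 := hr.inner_haarVal D Q Q (hsig hεη) (hsig hεη) (√(side Q ^ n))⁻¹
  rw [if_pos ⟨rfl, rfl⟩] at h2
  have h3 := congrArg (fun z : ℂ => ‖z‖) h1
  simp only [hmul] at h3
  rw [inner_smul_right, norm_mul, norm_mul, norm_inner_symm _ (hr.vec D Q _), h2, hin, if_pos rfl,
    Complex.norm_real, Complex.norm_real, Real.norm_of_nonneg (by positivity),
    Real.norm_of_nonneg (by positivity)] at h3
  have h4 : √(mass D s Q) / (side Q ^ n * (M * 4 ^ n)) ≤
      √(mass D s Q / (2 ^ n * (M * 4 ^ n))) * ((√(side Q ^ n))⁻¹ * 2 ^ n) * (√(side Q ^ n))⁻¹ := by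
    have hK : 1 ≤ M * 4 ^ n := by
      have : (1 : ℝ) ≤ 4 ^ n := one_le_pow₀ (by norm_num)
      nlinarith
    have h5 : √(2 ^ n * (M * 4 ^ n)) ≤ 2 ^ n * (M * 4 ^ n) := by
      have h6 : (1 : ℝ) ≤ 2 ^ n := one_le_pow₀ (by norm_num)
      rw [Real.sqrt_le_left (by positivity)]
      have h7 : 1 ≤ 2 ^ n * (M * 4 ^ n) := by nlinarith
      nlinarith
    have h8 : 0 < √(2 ^ n * (M * 4 ^ n)) := Real.sqrt_pos.2 (by positivity)
    calc _ = √(mass D s Q) / side Q ^ n * (1 / (M * 4 ^ n)) := by field_simp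
      _ ≤ √(mass D s Q) / side Q ^ n * (2 ^ n / √(2 ^ n * (M * 4 ^ n))) := by
        gcongr ?_ * ?_
        rw [div_le_div_iff₀ (by positivity) h8, one_mul]
        exact h5
      _ = √(mass D s Q / (2 ^ n * (M * 4 ^ n))) * 2 ^ n * (√(side Q ^ n) * √(side Q ^ n))⁻¹ := by
        rw [Real.sqrt_div (hs.mass_pos D Q).le, Real.mul_self_sqrt hm.le]
        field_simp
      _ = _ := by rw [mul_inv]; ring
  calc _ ≤ ‖b Q ε.1‖ * (√(mass D s Q / (2 ^ n * (M * 4 ^ n))) * ((√(side Q ^ n))⁻¹ * 2 ^ n) *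
        (√(side Q ^ n))⁻¹) := by gcongr
    _ = _ := by ring
    _ = _ := h3.symm
    _ ≤ _ := norm_inner_le_norm _ _
    _ ≤ _ := by
        rw [mul_comm]
        gcongr
        exact hr.norm_inv_haarVal_le D Q _

end Lower

section Besov

variable {n : ℕ} {M : ℝ} {s r ν : Rn n → ℝ} {b : Rn n → ℂ} (D : DyadicSystem n)

/-! ### Oscillations and Haar coefficients -/

/-- The unweighted oscillation `∫_S |b - ⟨b⟩_S|`. -/
def meanDev (b : Rn n → ℂ) (S : Set (Rn n)) : ℝ := ∫ x in S, ‖b x - ⨍ y in S, b y‖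

theorem meanDev_nonneg (b : Rn n → ℂ) (S : Set (Rn n)) : 0 ≤ meanDev b S :=
  integral_nonneg fun _ => norm_nonneg _

theorem integrableOn_norm_sub {S : Set (Rn n)} (hb : IntegrableOn b S) (hS : volume S ≠ ∞) (c : ℂ) :
    IntegrableOn (fun x => ‖b x - c‖) S :=
  (hb.sub (integrableOn_const hS)).norm

theorem osc_eq {S : Set (Rn n)} (hS : volume S ≠ ∞) (hb : IntegrableOn b S)
    (hν : IntegrableOn ν S) (hν0 : ∀ᵐ x, 0 < ν x) (hpos : 0 < ∫ x in S, ν x) :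
    osc ν b S = ENNReal.ofReal (meanDev b S / ∫ x in S, ν x) := by
  rw [osc, meanDev, ENNReal.ofReal_div_of_pos hpos,
    ofReal_integral_norm_eq_lintegral_enorm
      (show Integrable (fun x => b x - ⨍ y in S, b y) _ from hb.sub (integrableOn_const hS)),
    ofReal_integral_eq_lintegral_ofReal hν (ae_restrict_of_ae (hν0.mono fun _ h => h.le))]

/-- The oscillation over a subset is at most twice that over the whole set. -/
theorem meanDev_le_of_subset {S B : Set (Rn n)} (hSB : S ⊆ B) (hB : volume B ≠ ∞)
    (hb : IntegrableOn b B) : meanDev b S ≤ 2 * meanDev b B := by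
  set c := ⨍ y in B, b y with hc
  have hS : volume S ≠ ∞ := measure_ne_top_of_subset hSB hB
  have hbS := hb.mono_set hSB
  have hint := integrableOn_norm_sub hbS hS c
  have h1 : ∫ x in S, ‖b x - c‖ ≤ meanDev b B :=
    setIntegral_mono_set (hb.sub (integrableOn_const hB)).norm (ae_of_all _ fun _ => norm_nonneg _)
      hSB.eventuallyLE
  have h2 : volume.real S * ‖c - ⨍ y in S, b y‖ ≤ ∫ x in S, ‖b x - c‖ := by
    rcases eq_or_ne (volume.real S) 0 with h0 | h0
    · rw [h0, zero_mul]; exact integral_nonneg fun _ => norm_nonneg _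
    have h3 : (volume.real S : ℂ) * (c - ⨍ y in S, b y) = - ∫ x in S, (b x - c) := by
      rw [integral_sub hbS (integrableOn_const hS), setAverage_eq, setIntegral_const,
        Complex.real_smul, Complex.real_smul, mul_sub, Complex.ofReal_inv,
        mul_inv_cancel_left₀ (Complex.ofReal_ne_zero.2 h0)]
      ring
    calc _ = ‖(volume.real S : ℂ) * (c - ⨍ y in S, b y)‖ := by
          rw [norm_mul, Complex.norm_real, Real.norm_of_nonneg measureReal_nonneg]
      _ = ‖∫ x in S, (b x - c)‖ := by rw [h3, norm_neg]
      _ ≤ _ := norm_integral_le_integral_norm _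
  calc meanDev b S ≤ ∫ x in S, (‖b x - c‖ + ‖c - ⨍ y in S, b y‖) := by
        refine integral_mono (integrableOn_norm_sub hbS hS _) (hint.add (integrableOn_const hS))
          fun x => ?_
        exact norm_sub_le_norm_sub_add_norm_sub _ _ _
    _ = (∫ x in S, ‖b x - c‖) + volume.real S * ‖c - ⨍ y in S, b y‖ := by
        rw [integral_add hint (integrableOn_const hS), setIntegral_const, smul_eq_mul]
    _ ≤ _ := by linarith

theorem haar_eq_haarVal (Q : CubeIndex n) (ε : Fin n → Fin 2) (x : Rn n) :
    haar D Q ε x = step D Q (haarVal Q ε) x := haar_eq_step D Q ε x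

theorem haarCoeff_eq_sum {Q : CubeIndex n} (hb : IntegrableOn b (dyadicCube D Q))
    (ε : Fin n → Fin 2) :
    haarCoeff D b Q ε = ∑ j, (haarVal Q ε j : ℂ) * ∫ x in dyadicCube D (child D Q j), b x := by
  rw [← integral_mul_step D hb, haarCoeff]
  simp only [haar_eq_haarVal]

theorem volume_real_child (Q : CubeIndex n) (j : Fin n → Fin 2) :
    volume.real (dyadicCube D (child D Q j)) = side Q ^ n / 2 ^ n := by
  rw [volume_real_dyadicCube, side_child, div_pow]

theorem volume_dyadicCube_ne_top (Q : CubeIndex n) : volume (dyadicCube D Q) ≠ ∞ :=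
  (volume_cube_lt_top _ _).ne

/-- Haar coefficients are bounded by the oscillation, as `h_Q^ε` has mean zero. -/
theorem norm_haarCoeff_le {Q : CubeIndex n} (hb : IntegrableOn b (dyadicCube D Q))
    {ε : Fin n → Fin 2} (hε : ε ≠ 1) :
    ‖haarCoeff D b Q ε‖ ≤ (√(side Q ^ n))⁻¹ * meanDev b (dyadicCube D Q) := by
  set c := ⨍ y in dyadicCube D Q, b y with hc
  have hbc : IntegrableOn (fun x => b x - c) (dyadicCube D Q) :=
    hb.sub (integrableOn_const (volume_dyadicCube_ne_top D Q))
  have h1 : haarCoeff D b Q ε =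
      ∑ j, (haarVal Q ε j : ℂ) * ∫ x in dyadicCube D (child D Q j), (b x - c) := by
    have h2 (j : Fin n → Fin 2) : ∫ x in dyadicCube D (child D Q j), (b x - c) =
        (∫ x in dyadicCube D (child D Q j), b x) - ((side Q ^ n / 2 ^ n : ℝ) : ℂ) * c := by
      rw [integral_sub (hb.mono_set (child_subset D Q j))
        (integrableOn_const (volume_dyadicCube_ne_top D _)), setIntegral_const,
        volume_real_child, Complex.real_smul]
    simp only [h2, mul_sub, Finset.sum_sub_distrib]
    rw [← Finset.sum_mul, ← Complex.ofReal_sum, sum_haarVal Q hε, Complex.ofReal_zero, zero_mul,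
      sub_zero, haarCoeff_eq_sum D hb]
  rw [h1, meanDev, ← sum_integral_child D hbc.norm, Finset.mul_sum]
  refine norm_sum_le_of_le _ fun j _ => ?_
  rw [norm_mul, Complex.norm_real, Real.norm_eq_abs, abs_haarVal]
  gcongr
  exact norm_integral_le_integral_norm _

/-- The martingale differences of `b` in terms of Haar coefficients. -/
theorem sum_haarCoeff_mul {Q : CubeIndex n} (hb : IntegrableOn b (dyadicCube D Q))
    (j : Fin n → Fin 2) :
    ∑ ε : Canc n, haarCoeff D b Q ε.1 * (haarVal Q ε.1 j : ℂ) =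
      (⨍ x in dyadicCube D (child D Q j), b x) - ⨍ x in dyadicCube D Q, b x := by
  have hm := side_pow_pos Q
  have hmul (ε k : Fin n → Fin 2) : haarVal Q ε k * haarVal Q ε j =
      (side Q ^ n)⁻¹ * (haarSign ε k * haarSign ε j) := by
    rw [haarVal, haarVal, mul_mul_mul_comm, ← mul_inv, Real.mul_self_sqrt hm.le]
  have hall : ∑ ε, haarCoeff D b Q ε * (haarVal Q ε j : ℂ) =
      ⨍ x in dyadicCube D (child D Q j), b x := by
    simp only [haarCoeff_eq_sum D hb, Finset.sum_mul]
    rw [Finset.sum_comm]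
    have h (k : Fin n → Fin 2) : ∑ ε, (haarVal Q ε k : ℂ) *
        (∫ x in dyadicCube D (child D Q k), b x) * (haarVal Q ε j : ℂ) =
        (((side Q ^ n)⁻¹ * if k = j then 2 ^ n else 0 : ℝ) : ℂ) *
          ∫ x in dyadicCube D (child D Q k), b x := by
      rw [← sum_haarSign_mul_right, Finset.mul_sum, Complex.ofReal_sum, Finset.sum_mul]
      refine Finset.sum_congr rfl fun ε _ => ?_
      rw [← hmul]; push_cast; ring
    simp only [h]
    rw [Finset.sum_eq_single j (fun k _ hk => by rw [if_neg hk]; simp) (by simp), if_pos rfl,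
      setAverage_eq, volume_real_child, Complex.real_smul, inv_div, inv_mul_eq_div]
  have hone : haarCoeff D b Q 1 * (haarVal Q 1 j : ℂ) = ⨍ x in dyadicCube D Q, b x := by
    rw [haarCoeff_eq_sum D hb, setAverage_eq, volume_real_dyadicCube, Complex.real_smul,
      ← sum_integral_child D hb, Finset.sum_mul, Finset.mul_sum]
    refine Finset.sum_congr rfl fun k _ => ?_
    have := hmul 1 k
    rw [haarSign_one, haarSign_one, mul_one, mul_one] at this
    rw [← this]; push_cast; ring
  rw [← hall, ← hone, ← Finset.add_sum_erase Finset.univ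
    (fun ε => haarCoeff D b Q ε * (haarVal Q ε j : ℂ)) (Finset.mem_univ 1), add_sub_cancel_left]
  exact (Finset.sum_subtype (p := fun ε : Fin n → Fin 2 => ε ≠ 1) (Finset.univ.erase 1) (by simp)
    fun ε => haarCoeff D b Q ε * (haarVal Q ε j : ℂ)).symm

theorem meanDev_le {Q : CubeIndex n} (hb : IntegrableOn b (dyadicCube D Q)) :
    meanDev b (dyadicCube D Q) ≤ √(side Q ^ n) * (∑ ε : Canc n, ‖haarCoeff D b Q ε.1‖) +
      ∑ j, meanDev b (dyadicCube D (child D Q j)) := by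
  have hm := side_pow_pos Q
  set c := ⨍ y in dyadicCube D Q, b y with hc
  set Y := ∑ ε : Canc n, ‖haarCoeff D b Q ε.1‖ with hY
  have hbc : IntegrableOn (fun x => b x - c) (dyadicCube D Q) :=
    hb.sub (integrableOn_const (volume_dyadicCube_ne_top D Q))
  rw [meanDev, ← sum_integral_child D hbc.norm]
  have hj (j : Fin n → Fin 2) : ∫ x in dyadicCube D (child D Q j), ‖b x - c‖ ≤
      meanDev b (dyadicCube D (child D Q j)) + side Q ^ n / 2 ^ n * ((√(side Q ^ n))⁻¹ * Y) := by
    set c' := ⨍ y in dyadicCube D (child D Q j), b y with hc'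
    have hfin := volume_dyadicCube_ne_top D (child D Q j)
    have hbj := hb.mono_set (child_subset D Q j)
    have h1 : ‖c' - c‖ ≤ (√(side Q ^ n))⁻¹ * Y := by
      rw [← sum_haarCoeff_mul D hb j, hY, Finset.mul_sum]
      refine norm_sum_le_of_le _ fun ε _ => ?_
      rw [norm_mul, Complex.norm_real, Real.norm_eq_abs, abs_haarVal, mul_comm]
    calc ∫ x in dyadicCube D (child D Q j), ‖b x - c‖
        ≤ ∫ x in dyadicCube D (child D Q j), (‖b x - c'‖ + (√(side Q ^ n))⁻¹ * Y) := by
          refine integral_mono (integrableOn_norm_sub hbj hfin _)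
            ((integrableOn_norm_sub hbj hfin _).add (integrableOn_const hfin)) fun x => ?_
          calc ‖b x - c‖ = ‖(b x - c') + (c' - c)‖ := by congr 1; ring
            _ ≤ ‖b x - c'‖ + ‖c' - c‖ := norm_add_le _ _
            _ ≤ _ := by gcongr
      _ = _ := by
          rw [integral_add (integrableOn_norm_sub hbj hfin _) (integrableOn_const hfin),
            setIntegral_const, volume_real_child, smul_eq_mul, meanDev]
  calc _ ≤ ∑ j, (meanDev b (dyadicCube D (child D Q j)) +
        side Q ^ n / 2 ^ n * ((√(side Q ^ n))⁻¹ * Y)) := Finset.sum_le_sum fun j _ => hj j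
    _ = _ := by
        rw [Finset.sum_add_distrib, Finset.sum_const, Finset.card_univ, nsmul_eq_mul, add_comm]
        congr 1
        simp only [Fintype.card_pi, Fintype.card_fin, Finset.prod_const, Finset.card_univ]
        push_cast
        have h2 := Real.mul_self_sqrt hm.le
        have h3 := Real.sqrt_pos.2 hm
        field_simp
        rw [sq, h2]

theorem bloom_pos (hs : HalfWeight M s) (hr : HalfWeight M r)
    (hν : ν =ᵐ[volume] fun x => (s x)⁻¹ * (r x)⁻¹) : ∀ᵐ x, 0 < ν x := by
  filter_upwards [hν, hs.inv.pos, hr.inv.pos] with x hx h1 h2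
  rw [hx]
  exact mul_pos h1 h2

theorem bloom_integrableOn (hs : HalfWeight M s) (hr : HalfWeight M r)
    (hν : ν =ᵐ[volume] fun x => (s x)⁻¹ * (r x)⁻¹) (a : Fin n → ℝ) {l : ℝ} (hl : 0 < l) :
    IntegrableOn ν (cube a l) :=
  (hs.inv.memLp_mul hr.inv a hl).congr (ae_restrict_of_ae hν.symm)

theorem bloom_integral_pos (hs : HalfWeight M s) (hr : HalfWeight M r)
    (hν : ν =ᵐ[volume] fun x => (s x)⁻¹ * (r x)⁻¹) (Q : CubeIndex n) :
    0 < ∫ x in dyadicCube D Q, ν x :=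
  setIntegral_cube_pos (side_pos Q) (bloom_integrableOn hs hr hν _ (side_pos Q))
    (bloom_pos hs hr hν)

theorem osc_dyadicCube (hs : HalfWeight M s) (hr : HalfWeight M r)
    (hν : ν =ᵐ[volume] fun x => (s x)⁻¹ * (r x)⁻¹) (hb : LocallyIntegrable b) (Q : CubeIndex n) :
    osc ν b (dyadicCube D Q) =
      ENNReal.ofReal (meanDev b (dyadicCube D Q) / ∫ x in dyadicCube D Q, ν x) :=
  osc_eq (volume_dyadicCube_ne_top D Q) (integrableOn_cube hb _ (side_pos Q))
    (bloom_integrableOn hs hr hν _ (side_pos Q)) (bloom_pos hs hr hν)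
    (bloom_integral_pos D hs hr hν Q)

/-- The sizes of the Haar coefficients are bounded by the weighted oscillation. -/
theorem coefSize_haarCoeff_le (hs : HalfWeight M s) (hr : HalfWeight M r) (hM : 0 ≤ M)
    (hν : ν =ᵐ[volume] fun x => (s x)⁻¹ * (r x)⁻¹) (hb : LocallyIntegrable b) (Q : CubeIndex n)
    {ε : Fin n → Fin 2} (hε : ε ≠ 1) :
    coefSize D s r Q (haarCoeff D b Q ε) ≤
      M * (meanDev b (dyadicCube D Q) / ∫ x in dyadicCube D Q, ν x) := by
  have h1 := norm_haarCoeff_le D (integrableOn_cube hb _ (side_pos Q)) hε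
  have h2 := (bloom_mul_sqrt hs hr hM hν (corner D Q) (side_pos Q)).2
  have hN := bloom_integral_pos D hs hr hν Q
  have hm := side_pow_pos Q
  have hX := meanDev_nonneg b (dyadicCube D Q)
  change (∫ x in dyadicCube D Q, ν x) * √(mass D s Q * mass D r Q) ≤ _ at h2
  rw [coefSize]
  set X := meanDev b (dyadicCube D Q)
  set N := ∫ x in dyadicCube D Q, ν x
  set m := side Q ^ n
  have hsm : (√m)⁻¹ * (√m)⁻¹ = m⁻¹ := by rw [← mul_inv, Real.mul_self_sqrt hm.le]
  calc _ ≤ (√m)⁻¹ * X * (m⁻¹ * (√m)⁻¹) * √(mass D s Q * mass D r Q) := by gcongr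
    _ = ((√m)⁻¹ * (√m)⁻¹) * m⁻¹ * X * √(mass D s Q * mass D r Q) := by ring
    _ = X / (m ^ 2 * N) * (N * √(mass D s Q * mass D r Q)) := by rw [hsm]; field_simp
    _ ≤ X / (m ^ 2 * N) * (M * m ^ 2) := by gcongr
    _ = _ := by field_simp

/-- The lower bound for `coefSize` in terms of the Bloom weight. -/
theorem le_coefSize (hs : HalfWeight M s) (hr : HalfWeight M r) (hM : 0 ≤ M)
    (hν : ν =ᵐ[volume] fun x => (s x)⁻¹ * (r x)⁻¹) (Q : CubeIndex n) (z : ℂ) :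
    √(side Q ^ n) * ‖z‖ / (∫ x in dyadicCube D Q, ν x) ≤ coefSize D s r Q z := by
  have h2 := (bloom_mul_sqrt hs hr hM hν (corner D Q) (side_pos Q)).1
  have hN := bloom_integral_pos D hs hr hν Q
  have hm := side_pow_pos Q
  change _ ≤ (∫ x in dyadicCube D Q, ν x) * √(mass D s Q * mass D r Q) at h2
  rw [coefSize]
  set N := ∫ x in dyadicCube D Q, ν x
  set m := side Q ^ n
  have h3 := Real.sqrt_pos.2 hm
  have h4 : √m * √m = m := Real.mul_self_sqrt hm.le
  rw [div_le_iff₀ hN]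
  calc √m * ‖z‖ = ‖z‖ * (m⁻¹ * (√m)⁻¹) * m ^ 2 := by
        have : m ^ 2 = m * (√m * √m) := by rw [h4, sq]
        rw [this]; field_simp
    _ ≤ ‖z‖ * (m⁻¹ * (√m)⁻¹) * (N * √(mass D s Q * mass D r Q)) := by gcongr
    _ = _ := by ring

/-- The oscillation over a cube is at most the size of its Haar coefficients, plus the average of the
oscillations over its children. -/
theorem osc_le_add_childAvg (hs : HalfWeight M s) (hr : HalfWeight M r) (hM : 0 ≤ M)
    (hν : ν =ᵐ[volume] fun x => (s x)⁻¹ * (r x)⁻¹) (hb : LocallyIntegrable b) (Q : CubeIndex n) :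
    osc ν b (dyadicCube D Q) ≤
      (∑ ε : Canc n, ENNReal.ofReal (coefSize D s r Q (haarCoeff D b Q ε.1))) +
        childAvg (child D) (fun R => ∫ x in dyadicCube D R, ν x)
          (fun R => osc ν b (dyadicCube D R)) Q := by
  have hN := bloom_integral_pos D hs hr hν
  have hX (R : CubeIndex n) := meanDev_nonneg b (dyadicCube D R)
  have hc := coefSize_nonneg D s r Q
  have h0 (j : Fin n → Fin 2) : 0 ≤ meanDev b (dyadicCube D (child D Q j)) /
      ∫ x in dyadicCube D Q, ν x := div_nonneg (hX _) (hN _).le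
  simp only [childAvg, osc_dyadicCube D hs hr hν hb]
  have hj (j : Fin n → Fin 2) : ENNReal.ofReal ((∫ x in dyadicCube D (child D Q j), ν x) /
      ∫ x in dyadicCube D Q, ν x) * ENNReal.ofReal (meanDev b (dyadicCube D (child D Q j)) /
        ∫ x in dyadicCube D (child D Q j), ν x) = ENNReal.ofReal
          (meanDev b (dyadicCube D (child D Q j)) / ∫ x in dyadicCube D Q, ν x) := by
    rw [← ENNReal.ofReal_mul (div_nonneg (hN _).le (hN _).le)]
    congr 1
    have := (hN (child D Q j)).ne'
    have := (hN Q).ne'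
    field_simp
  simp only [hj]
  rw [← ENNReal.ofReal_sum_of_nonneg fun ε _ => hc _, ← ENNReal.ofReal_sum_of_nonneg fun j _ => h0 j,
    ← ENNReal.ofReal_add (Finset.sum_nonneg fun ε _ => hc _) (Finset.sum_nonneg fun j _ => h0 j)]
  refine ENNReal.ofReal_le_ofReal ?_
  rw [← Finset.sum_div]
  calc _ ≤ (√(side Q ^ n) * (∑ ε : Canc n, ‖haarCoeff D b Q ε.1‖) +
        ∑ j, meanDev b (dyadicCube D (child D Q j))) / ∫ x in dyadicCube D Q, ν x := by
        have := (hN Q).le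
        gcongr
        exact meanDev_le D (integrableOn_cube hb _ (side_pos Q))
    _ ≤ _ := by
        rw [add_div, Finset.mul_sum, Finset.sum_div]
        gcongr with ε
        exact le_coefSize D hs hr hM hν Q _

/-- Vanishing mean oscillation on small balls gives small oscillation on small dyadic cubes, since
`ν` is doubling. -/
theorem MemVMO.exists_osc_le (hs : HalfWeight M s) (hr : HalfWeight M r) (hM : 0 ≤ M)
    (hν : ν =ᵐ[volume] fun x => (s x)⁻¹ * (r x)⁻¹) (hb : MemVMO ν b) {e : ℝ≥0∞} (he : 0 < e) :
    ∃ N : ℤ, ∀ Q : CubeIndex n, N ≤ Q.1 → osc ν b (dyadicCube D Q) ≤ e := by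
  set K : ℝ := 2 * (M * ((2 * (n + 1)) ^ n) ^ 2) with hK
  have hK0 : 0 ≤ K := by positivity
  have hloc := hb.1.1
  -- the comparison with the ball of radius `(n + 1) side Q` about the corner of `Q`
  have hcmp (Q : CubeIndex n) : osc ν b (dyadicCube D Q) ≤ ENNReal.ofReal K *
      osc ν b (Metric.ball (WithLp.toLp 2 (corner D Q)) ((n + 1) * side Q)) := by
    have hl := side_pos Q
    set x : Rn n := WithLp.toLp 2 (corner D Q)
    set ρ := (n + 1) * side Q with hρ
    have hρ0 : 0 < 2 * ρ := by positivity
    set a' : Fin n → ℝ := fun i => x i - ρ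
    have h1 : dyadicCube D Q ⊆ Metric.ball x ρ := cube_subset_ball _ hl
    have h2 : Metric.ball x ρ ⊆ cube a' (2 * ρ) := ball_subset_cube x ρ
    have hbB : IntegrableOn b (Metric.ball x ρ) := (integrableOn_cube hloc _ hρ0).mono_set h2
    have hνB := (bloom_integrableOn hs hr hν a' hρ0).mono_set h2
    have hν0 := bloom_pos hs hr hν
    have hν0' (S : Set (Rn n)) : 0 ≤ᵐ[volume.restrict S] ν :=
      ae_restrict_of_ae (hν0.mono fun _ h => h.le)
    have hN := bloom_integral_pos D hs hr hν Q
    have hNB : ∫ y in dyadicCube D Q, ν y ≤ ∫ y in Metric.ball x ρ, ν y :=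
      setIntegral_mono_set hνB (hν0' _) h1.eventuallyLE
    have hNB' : ∫ y in Metric.ball x ρ, ν y ≤ ∫ y in cube a' (2 * ρ), ν y :=
      setIntegral_mono_set (bloom_integrableOn hs hr hν a' hρ0) (hν0' _) h2.eventuallyLE
    have hd := bloom_doubling hs hr hM hν hl hρ0 (h1.trans h2)
    rw [osc_dyadicCube D hs hr hν hloc, osc_eq measure_ball_lt_top.ne hbB hνB hν0
      (hN.trans_le hNB), ← ENNReal.ofReal_mul hK0]
    refine ENNReal.ofReal_le_ofReal ?_
    have hX := meanDev_le_of_subset h1 measure_ball_lt_top.ne hbB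
    have hX0 := meanDev_nonneg b (Metric.ball x ρ)
    have hm := side_pow_pos Q
    have hd' : ∫ y in Metric.ball x ρ, ν y ≤
        M * ((2 * (n + 1)) ^ n) ^ 2 * ∫ y in dyadicCube D Q, ν y := by
      refine hNB'.trans (le_of_mul_le_mul_left (hd.trans_eq ?_) (pow_pos hm 2))
      rw [hρ, ← mul_assoc 2, mul_pow]
      change _ * (∫ y in dyadicCube D Q, ν y) = _
      ring
    rw [div_le_iff₀ hN]
    calc _ ≤ 2 * meanDev b (Metric.ball x ρ) := hX
      _ = 2 * meanDev b (Metric.ball x ρ) / (∫ y in Metric.ball x ρ, ν y) *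
          ∫ y in Metric.ball x ρ, ν y := (div_mul_cancel₀ _ (hN.trans_le hNB).ne').symm
      _ ≤ 2 * meanDev b (Metric.ball x ρ) / (∫ y in Metric.ball x ρ, ν y) *
          (M * ((2 * (n + 1)) ^ n) ^ 2 * ∫ y in dyadicCube D Q, ν y) := by
          have := (hN.trans_le hNB).le
          gcongr
      _ = _ := by rw [hK]; ring
  have hlim : Tendsto (fun a : ℝ => ENNReal.ofReal K * ⨆ x : Rn n, osc ν b (Metric.ball x a))
      (𝓝[>] 0) (𝓝 0) := by
    simpa using ENNReal.Tendsto.const_mul hb.2.1 (Or.inr ENNReal.ofReal_ne_top)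
  have hev := hlim.eventually (ge_mem_nhds he)
  have hside : Tendsto (fun k : ℤ => ((n : ℝ) + 1) * (2 : ℝ) ^ (-k)) atTop (𝓝[>] 0) := by
    refine tendsto_nhdsWithin_iff.2 ⟨?_, Eventually.of_forall fun k => by
      rw [Set.mem_Ioi]; positivity⟩
    have h1 : Tendsto (fun k : ℤ => (2 : ℝ) ^ (-k)) atTop (𝓝 0) := by
      have h2 := (tendsto_rpow_atTop_of_base_lt_one (2⁻¹ : ℝ) (by norm_num)
        (by norm_num)).comp (tendsto_intCast_atTop_atTop (R := ℝ))
      refine h2.congr fun k => ?_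
      rw [Function.comp_apply, Real.rpow_intCast, inv_zpow, zpow_neg]
    simpa using h1.const_mul ((n : ℝ) + 1)
  obtain ⟨N, hN⟩ := eventually_atTop.1 (hside.eventually hev)
  refine ⟨N, fun Q hQ => (hcmp Q).trans (le_trans ?_ (hN Q.1 hQ))⟩
  gcongr
  exact le_iSup (fun x => osc ν b (Metric.ball x _)) _

/-- Iteration of `osc_le_add_childAvg`; the remainder tends to zero as the cubes shrink. -/
theorem MemVMO.osc_le_descTotal (hs : HalfWeight M s) (hr : HalfWeight M r) (hM : 0 ≤ M)
    (hν : ν =ᵐ[volume] fun x => (s x)⁻¹ * (r x)⁻¹) (hb : MemVMO ν b) (Q : CubeIndex n) :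
    osc ν b (dyadicCube D Q) ≤
      descTotal (child D) (fun R => ∫ x in dyadicCube D R, ν x)
        (fun R => ∑ ε : Canc n, ENNReal.ofReal (coefSize D s r R (haarCoeff D b R ε.1))) Q := by
  refine ENNReal.le_of_forall_pos_le_add fun e he _ => ?_
  obtain ⟨N, hN⟩ := hb.exists_osc_le D hs hr hM hν (e := e) (by exact_mod_cast he)
  set v := fun R => ∫ x in dyadicCube D R, ν x
  set F := fun R => ∑ ε : Canc n, ENNReal.ofReal (coefSize D s r R (haarCoeff D b R ε.1))
  have hv : ∀ R, 0 < v R := bloom_integral_pos D hs hr hν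
  have hadd (R : CubeIndex n) : ∑ j, v (child D R j) = v R :=
    sum_integral_child D (bloom_integrableOn hs hr hν _ (side_pos R))
  have key (k : ℕ) (R : CubeIndex n) (hR : N ≤ R.1 + k) :
      osc ν b (dyadicCube D R) ≤ descSum (child D) v F k R + e := by
    induction k generalizing R with
    | zero => exact (hN R (by simpa using hR)).trans le_add_self
    | succ k ih =>
      refine (osc_le_add_childAvg D hs hr hM hν hb.1.1 R).trans ?_
      rw [descSum, add_assoc]
      gcongr
      calc childAvg (child D) v (fun R => osc ν b (dyadicCube D R)) R
          ≤ childAvg (child D) v (fun R => descSum (child D) v F k R + e) R := by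
            refine Finset.sum_le_sum fun j _ => ?_
            gcongr
            refine ih _ ?_
            have : (child D R j).1 = R.1 + 1 := rfl
            rw [this]; push_cast at hR; omega
        _ = _ := by rw [childAvg_add, childAvg_const hv hadd]
  refine (key (N - Q.1).toNat Q (by omega)).trans ?_
  gcongr
  exact le_iSup (fun k => descSum (child D) v F k Q) _

/-- The Besov norm is bounded by the `ℓ^p` norms of the sizes of the Haar coefficients. -/
theorem MemVMO.tsum_osc_rpow_le (hs : HalfWeight M s) (hr : HalfWeight M r) (hn : 1 ≤ n)
    (hM : 1 ≤ M) (hν : ν =ᵐ[volume] fun x => (s x)⁻¹ * (r x)⁻¹) (hb : MemVMO ν b) {p : ℝ}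
    (hp : 1 ≤ p) :
    ∑' Q, osc ν b (dyadicCube D Q) ^ p ≤ majorantConst n M p *
      ((Fintype.card (Canc n) : ℝ≥0∞) ^ (p - 1) * ∑ ε : Canc n, ∑' Q,
        ENNReal.ofReal (coefSize D s r Q (haarCoeff D b Q ε.1) ^ p)) := by
  have := nontrivial_children hn
  have hv := bloom_integral_pos D hs hr hν
  have hadd (R : CubeIndex n) : ∑ j, ∫ x in dyadicCube D (child D R j), ν x =
      ∫ x in dyadicCube D R, ν x :=
    sum_integral_child D (bloom_integrableOn hs hr hν _ (side_pos R))
  refine (ENNReal.tsum_le_tsum fun Q => ENNReal.rpow_le_rpow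
    (hb.osc_le_descTotal D hs hr (by linarith) hν Q) (by linarith)).trans ?_
  refine (tsum_descTotal_rpow_le (child_bijective D).1 hv hadd
    (decay_pos hn hM) (decay_lt_one hM)
    (child_le_of_doubling hadd hv (K := M * 4 ^ n) (by positivity) fun Q j =>
      le_of_child_doubling D (bloom_doubling hs hr (by linarith) hν (side_pos _) (side_pos Q)
        (child_subset D Q j))) hp _).trans ?_
  refine mul_le_mul_right ?_ _
  rw [← tsum_fintype (L := .unconditional _), ENNReal.tsum_comm, ← ENNReal.tsum_mul_left]
  refine ENNReal.tsum_le_tsum fun Q => ?_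
  rw [tsum_fintype]
  refine (ENNReal.rpow_sum_le_const_mul_sum_rpow Finset.univ _ hp).trans_eq ?_
  rw [Finset.card_univ]
  congr 1
  refine Finset.sum_congr rfl fun ε _ => ?_
  exact ENNReal.ofReal_rpow_of_nonneg (coefSize_nonneg D _ _ _ _) (by linarith)

end Besov

section Series

variable {n : ℕ} {M : ℝ} {s r ν : Rn n → ℝ} {b : Rn n → ℂ} (D : DyadicSystem n)

/-! ### The paraproducts as series of operators of rank one -/

/-- Convergence of the series in the norm of `L²`, for operators `U i` which are given by `t i`. -/
theorem isSeriesSum_iff {ι : Type*} {t : ι → (Rn n → ℂ) → Rn n → ℂ} {U : ι → L2 n →L[ℂ] L2 n}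
    (hU : ∀ i f, U i f =ᵐ[volume] t i f) (T : L2 n →L[ℂ] L2 n) :
    IsSeriesSum t T ↔ ∀ f, HasSum (fun i => U i f) (T f) := by
  refine forall_congr' fun f => ?_
  rw [HasSum, SummationFilter.unconditional_filter, tendsto_iff_edist_tendsto_0]
  refine tendsto_congr fun S => ?_
  rw [edist_comm, Lp.edist_def]
  refine eLpNorm_congr_ae ?_
  have h1 : ⇑(∑ i ∈ S, U i f) =ᵐ[volume] fun x => ∑ i ∈ S, t i f x := by
    classical
    induction S using Finset.induction_on with
    | empty => exact Lp.coeFn_zero ℂ 2 volume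
    | insert i S hi ih =>
      rw [Finset.sum_insert hi]
      filter_upwards [Lp.coeFn_add (U i f) (∑ i ∈ S, U i f), hU i f, ih] with x h1 h2 h3
      rw [h1, Pi.add_apply, h2, h3, Finset.sum_insert hi]
  filter_upwards [h1] with x hx
  rw [Pi.sub_apply, hx]

theorem seriesMemSchatten_iff {ι : Type*} {p : ℝ} {t : ι → (Rn n → ℂ) → Rn n → ℂ} :
    SeriesMemSchatten p t ↔ seriesSchattenNorm p t < ∞ := by
  simp only [SeriesMemSchatten, seriesSchattenNorm, iInf_lt_iff, exists_prop]

theorem seriesMemSchatten_iff_memBesov {ι : Type*} {p : ℝ} {t : ι → (Rn n → ℂ) → Rn n → ℂ} {C : ℝ≥0}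
    (hb : LocallyIntegrable b) (h1 : seriesSchattenNorm p t ≤ C * besovNorm D ν p b)
    (h2 : besovNorm D ν p b ≤ C * seriesSchattenNorm p t) :
    SeriesMemSchatten p t ↔ MemBesov D ν p b := by
  rw [seriesMemSchatten_iff, MemBesov]
  exact ⟨fun h => ⟨hb, h2.trans_lt (ENNReal.mul_lt_top ENNReal.coe_lt_top h)⟩,
    fun h => h1.trans_lt (ENNReal.mul_lt_top ENNReal.coe_lt_top h.2)⟩

open InnerProductSpace in
/-- The pointwise form of the operators of rank one which occur in the three series. -/
theorem rankOne_vec_ae (hs : HalfWeight M s) (hr : HalfWeight M r) (Q : CubeIndex n) (κ : ℂ)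
    (c d : (Fin n → Fin 2) → ℝ) (f : L2 n) :
    rankOne ℂ (κ • hr.vec D Q d) (hs.vec D Q c) f =ᵐ[volume] fun x =>
      (r x : ℂ) * (κ * (∫ y, (s y : ℂ) * f y * (step D Q c y : ℂ)) * (step D Q d x : ℂ)) := by
  have h0 : inner ℂ (hs.vec D Q c) f = ∫ y, (s y : ℂ) * f y * (step D Q c y : ℂ) := by
    rw [hs.inner_vec]
    refine integral_congr_ae (ae_of_all _ fun y => ?_)
    push_cast; ring
  rw [rankOne_apply, h0, smul_smul]
  filter_upwards [Lp.coeFn_smul ((∫ y, (s y : ℂ) * f y * (step D Q c y : ℂ)) * κ)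
    (hr.vec D Q d), hr.coeFn_vec D Q d] with x h1 h2
  rw [h1, Pi.smul_apply, h2, smul_eq_mul]
  push_cast; ring

theorem integral_mul_haar (f : Rn n → ℂ) (Q : CubeIndex n) (ε : Fin n → Fin 2) :
    haarCoeff D f Q ε = ∫ y, f y * (step D Q (haarVal Q ε) y : ℂ) := by
  simp only [haarCoeff, haar_eq_haarVal]

theorem setAverage_eq_integral_step (f : Rn n → ℂ) (Q : CubeIndex n) :
    ⨍ y in dyadicCube D Q, f y = ∫ y, f y * (step D Q (fun _ => (side Q ^ n)⁻¹) y : ℂ) := by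
  rw [setAverage_eq, volume_real_dyadicCube, ← integral_smul,
    ← integral_indicator (measurableSet_dyadicCube D Q)]
  refine integral_congr_ae (ae_of_all _ fun y => ?_)
  by_cases hy : y ∈ dyadicCube D Q
  · simp only [step_const, Set.indicator_of_mem hy]
    rw [Complex.real_smul, mul_comm]
  · simp only [step_const, Set.indicator_of_notMem hy]
    simp

open InnerProductSpace in
/-- The Schatten norm is bounded by the Besov norm, for series of the type considered in
`exists_schattenNorm_tsum_le`. -/
theorem exists_seriesSchattenNorm_le (n : ℕ) (hn : 1 ≤ n) {M : ℝ} (hM : 1 ≤ M) {p : ℝ} (hp : 1 ≤ p)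
    (F : Type) [Fintype F] : ∃ C : ℝ≥0, ∀ (D : DyadicSystem n) (s r ν : Rn n → ℝ)
      (b : Rn n → ℂ) (hs : HalfWeight M s) (hr : HalfWeight M r),
      (ν =ᵐ[volume] fun x => (s x)⁻¹ * (r x)⁻¹) → LocallyIntegrable b →
      besovNorm D ν p b < ∞ →
      ∀ (ε : F → Canc n) (c d : CubeIndex n × F → (Fin n → Fin 2) → ℝ)
        (A B : CubeIndex n × F → ℝ), (∀ i j, |c i j| ≤ A i) → (∀ i j, |d i j| ≤ B i) →
      (∀ i, A i * B i = (side i.1 ^ n)⁻¹ * (√(side i.1 ^ n))⁻¹) →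
      ∀ t : CubeIndex n × F → (Rn n → ℂ) → Rn n → ℂ,
      (∀ i (f : L2 n), rankOne ℂ (haarCoeff D b i.1 (ε i.2).1 • hr.vec D i.1 (d i))
        (hs.vec D i.1 (c i)) f =ᵐ[volume] t i f) →
      seriesSchattenNorm p t ≤ C * besovNorm D ν p b := by
  obtain ⟨C, hC, h⟩ := exists_schattenNorm_tsum_le n hn hM hp F
  have hp0 : 0 < p := by linarith
  refine ⟨((C * ENNReal.ofReal (M ^ p)) ^ (1 / p)).toNNReal, ?_⟩
  intro D s r ν b hs hr hν hb hfin ε c d A B hc hd hAB t ht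
  have hM0 : 0 ≤ M := by linarith
  set x := fun Q => meanDev b (dyadicCube D Q) / ∫ y in dyadicCube D Q, ν y
  have hx0 (Q : CubeIndex n) : 0 ≤ x Q :=
    div_nonneg (meanDev_nonneg _ _) (bloom_integral_pos D hs hr hν Q).le
  have hsum : ∑' Q, ENNReal.ofReal ((M * x Q) ^ p) =
      ENNReal.ofReal (M ^ p) * ∑' Q, osc ν b (dyadicCube D Q) ^ p := by
    rw [← ENNReal.tsum_mul_left]
    refine tsum_congr fun Q => ?_
    rw [Real.mul_rpow hM0 (hx0 Q), ENNReal.ofReal_mul (by positivity), osc_dyadicCube D hs hr hν hb,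
      ENNReal.ofReal_rpow_of_nonneg (hx0 Q) hp0.le]
  have hfin' : ∑' Q, osc ν b (dyadicCube D Q) ^ p ≠ ∞ := by
    intro htop
    rw [besovNorm, htop, ENNReal.top_rpow_of_pos (by positivity)] at hfin
    exact lt_irrefl _ hfin
  obtain ⟨hS, hle⟩ := h D s r hs hr (fun i => haarCoeff D b i.1 (ε i.2).1) c d A B
    (fun Q => M * x Q) hc hd (fun Q => mul_nonneg hM0 (hx0 Q)) (fun i => by
      rw [hAB]
      exact coefSize_haarCoeff_le D hs hr hM0 hν hb i.1 (ε i.2).2)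
    (by rw [hsum]; exact ENNReal.mul_ne_top ENNReal.ofReal_ne_top hfin')
  set T := ∑' i, rankOne ℂ (haarCoeff D b i.1 (ε i.2).1 • hr.vec D i.1 (d i)) (hs.vec D i.1 (c i))
  have hT : IsSeriesSum t T := (isSeriesSum_iff ht T).2 fun f =>
    hS.hasSum.mapL (ContinuousLinearMap.apply ℂ (L2 n) f)
  refine (iInf₂_le T hT).trans ?_
  rw [ENNReal.coe_toNNReal (ENNReal.rpow_ne_top_of_nonneg (by positivity)
    (ENNReal.mul_ne_top hC ENNReal.ofReal_ne_top)), besovNorm,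
    ← ENNReal.mul_rpow_of_nonneg _ _ (by positivity), mul_assoc, ← hsum,
    one_div, ENNReal.le_rpow_inv_iff hp0]
  exact hle

/-- The Besov norm is bounded by the Schatten norm, if the `ℓ^p` norms of the sizes of the Haar
coefficients are. -/
theorem MemVMO.besovNorm_le (hs : HalfWeight M s) (hr : HalfWeight M r) (hn : 1 ≤ n)
    (hM : 1 ≤ M) (hν : ν =ᵐ[volume] fun x => (s x)⁻¹ * (r x)⁻¹) (hb : MemVMO ν b) {p : ℝ}
    (hp : 1 ≤ p) {C K : ℝ≥0}
    (hC : majorantConst n M p * ((Fintype.card (Canc n) : ℝ≥0∞) ^ (p - 1) *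
      (Fintype.card (Canc n) * K)) ≤ (C : ℝ≥0∞) ^ p) (hC0 : 0 < C)
    {ι : Type*} {t : ι → (Rn n → ℂ) → Rn n → ℂ}
    (h : ∀ T, IsSeriesSum t T → ∀ ε : Canc n,
      ∑' Q, ENNReal.ofReal (coefSize D s r Q (haarCoeff D b Q ε.1) ^ p) ≤ K * schattenNorm p T ^ p) :
    besovNorm D ν p b ≤ C * seriesSchattenNorm p t := by
  have hp0 : 0 < p := by linarith
  have hC0' : (C : ℝ≥0∞) ≠ 0 := by exact_mod_cast hC0.ne'
  rw [← ENNReal.inv_mul_le_iff hC0' ENNReal.coe_ne_top]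
  refine le_iInf₂ fun T hT => ?_
  rw [ENNReal.inv_mul_le_iff hC0' ENNReal.coe_ne_top, besovNorm, one_div, ENNReal.rpow_inv_le_iff hp0,
    ENNReal.mul_rpow_of_nonneg _ _ hp0.le]
  refine (hb.tsum_osc_rpow_le D hs hr hn hM hν hp).trans ?_
  calc _ ≤ majorantConst n M p * ((Fintype.card (Canc n) : ℝ≥0∞) ^ (p - 1) *
        ∑ _ε : Canc n, K * schattenNorm p T ^ p) := by
        gcongr with ε
        exact h T hT ε
    _ = majorantConst n M p * ((Fintype.card (Canc n) : ℝ≥0∞) ^ (p - 1) *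
      (Fintype.card (Canc n) * K)) * schattenNorm p T ^ p := by
        rw [Finset.sum_const, Finset.card_univ, nsmul_eq_mul]; ring
    _ ≤ _ := by gcongr

theorem exists_canc_ne (hn : 2 ≤ n) (ε : Canc n) : ∃ η : Canc n, ε ≠ η := by
  let i : Fin n := ⟨0, by omega⟩
  let j : Fin n := ⟨1, by omega⟩
  have hij : j ≠ i := by simp [i, j]
  let η₁ : Canc n := ⟨0, fun h => by simpa using congrFun h i⟩
  let η₂ : Canc n := ⟨Function.update 1 i 0, fun h => by simpa using congrFun h i⟩
  by_cases h : ε = η₁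
  · refine ⟨η₂, fun h2 => ?_⟩
    have := congrFun (congrArg Subtype.val (h.symm.trans h2)) j
    simp [η₁, η₂, hij] at this
  · exact ⟨η₁, h⟩

end Series

end Paraproduct

end

open Paraproduct in
theorem proposition4p2 (n : ℕ) (hn : 2 ≤ n) (p : ℝ) (hp : (n : ℝ) < p) (M : ℝ≥0) :
    ∃ C : ℝ≥0, 0 < C ∧
      ∀ (μ lam : Rn n → ℝ), IsWeight μ → IsWeight lam → A2const μ ≤ M → A2const lam ≤ M →
      ∀ b : Rn n → ℂ, MemVMO (bloom μ lam) b →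
      ∀ D : DyadicSystem n,
        ((SeriesMemSchatten p (weighted μ lam (paraTerm D b)) ↔ MemBesov D (bloom μ lam) p b) ∧
          seriesSchattenNorm p (weighted μ lam (paraTerm D b))
            ≤ C * besovNorm D (bloom μ lam) p b ∧
          besovNorm D (bloom μ lam) p b
            ≤ C * seriesSchattenNorm p (weighted μ lam (paraTerm D b))) ∧
        ((SeriesMemSchatten p (weighted μ lam (paraStarTerm D b)) ↔ MemBesov D (bloom μ lam) p b) ∧
          seriesSchattenNorm p (weighted μ lam (paraStarTerm D b))
            ≤ C * besovNorm D (bloom μ lam) p b ∧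
          besovNorm D (bloom μ lam) p b
            ≤ C * seriesSchattenNorm p (weighted μ lam (paraStarTerm D b))) ∧
        ((SeriesMemSchatten p (weighted μ lam (gammaTerm D b)) ↔ MemBesov D (bloom μ lam) p b) ∧
          seriesSchattenNorm p (weighted μ lam (gammaTerm D b))
            ≤ C * besovNorm D (bloom μ lam) p b ∧
          besovNorm D (bloom μ lam) p b
            ≤ C * seriesSchattenNorm p (weighted μ lam (gammaTerm D b))) := by
  have hn1 : 1 ≤ n := by omega
  have hp2 : 2 ≤ p := (by exact_mod_cast hn : (2 : ℝ) ≤ n).trans hp.le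
  have hp1 : 1 ≤ p := by linarith
  have hp0 : 0 < p := by linarith
  -- an `A₂` constant is at least `1`, so this only excludes bounds `M` without any weights
  set M' : ℝ := max M 1 with hM'
  have hM1 : 1 ≤ M' := le_max_right _ _
  obtain ⟨C₁, hC₁⟩ := exists_seriesSchattenNorm_le n hn1 hM1 hp1 (Canc n)
  obtain ⟨C₂, hC₂⟩ := exists_seriesSchattenNorm_le n hn1 hM1 hp1 (CancPair n)
  set K : ℝ≥0 := Fintype.card (Fin n → Fin 2) * Real.toNNReal ((M' * 4 ^ n * √M') ^ p) with hK
  have hKe : (K : ℝ≥0∞) = Fintype.card (Fin n → Fin 2) *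
      ENNReal.ofReal ((M' * 4 ^ n * √M') ^ p) := by
    rw [hK, ENNReal.coe_mul, ENNReal.coe_natCast]; rfl
  have hK2 : ENNReal.ofReal ((M' * 4 ^ n * √M') ^ p) ≤ K := by
    rw [hKe]
    exact le_mul_of_one_le_left zero_le (by exact_mod_cast Fintype.card_pos)
  set L : ℝ≥0∞ := majorantConst n M' p * ((Fintype.card (Canc n) : ℝ≥0∞) ^ (p - 1) *
      (Fintype.card (Canc n) * K)) with hL
  have hLT : L ≠ ∞ := by
    refine ENNReal.mul_ne_top (majorantConst_ne_top hn1 hM1 hp0) (ENNReal.mul_ne_top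
      (ENNReal.rpow_ne_top_of_nonneg (by linarith) (by simp)) (by finiteness))
  set C₃ : ℝ≥0 := (L ^ (1 / p)).toNNReal with hC₃
  set C : ℝ≥0 := C₁ + C₂ + C₃ + 1 with hC
  have hC0 : 0 < C := by positivity
  have hLC : L ≤ (C : ℝ≥0∞) ^ p := by
    rw [← ENNReal.rpow_inv_le_iff hp0, ← one_div]
    calc L ^ (1 / p) = (C₃ : ℝ≥0∞) := by
          rw [hC₃, ENNReal.coe_toNNReal (ENNReal.rpow_ne_top_of_nonneg (by positivity) hLT)]
      _ ≤ C := by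
          rw [hC]
          exact_mod_cast le_add_right le_add_self
  have hC1C : C₁ ≤ C := by rw [hC, add_assoc, add_assoc]; exact le_self_add
  have hC2C : C₂ ≤ C := by rw [hC, add_assoc, add_assoc, add_left_comm]; exact le_self_add
  refine ⟨C, hC0, fun μ lam hμ hlam hμA hlamA b hb D => ?_⟩
  have hr : HalfWeight M' fun x => lam x ^ (1 / 2 : ℝ) :=
    (isWeight_halfWeight hlam hlamA).mono (le_max_left _ _)
  have hneg {w : Rn n → ℝ} (hw : IsWeight w) :
      (fun x => (w x ^ (1 / 2 : ℝ))⁻¹) =ᵐ[volume] fun x => w x ^ (-(1 / 2) : ℝ) := by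
    filter_upwards [hw.2] with x hx
    rw [Real.rpow_neg hx.le]
  have hs : HalfWeight M' fun x => μ x ^ (-(1 / 2) : ℝ) :=
    ((isWeight_halfWeight hμ hμA).mono (le_max_left _ _)).inv.congr (hneg hμ)
  have hν : bloom μ lam =ᵐ[volume] fun x =>
      (μ x ^ (-(1 / 2) : ℝ))⁻¹ * (lam x ^ (1 / 2 : ℝ))⁻¹ := by
    filter_upwards [hneg hμ, hneg hlam] with x h1 h2
    rw [← h1, h2, inv_inv, bloom]
  have hloc := hb.1.1
  have habs (Q : CubeIndex n) : |(side Q ^ n)⁻¹| ≤ (side Q ^ n)⁻¹ :=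
    (abs_of_pos (inv_pos.2 (side_pow_pos Q))).le
  have hupper {ι : Type} {t : ι → (Rn n → ℂ) → Rn n → ℂ} {C' : ℝ≥0} (hC' : C' ≤ C)
      (h : besovNorm D (bloom μ lam) p b < ∞ →
        seriesSchattenNorm p t ≤ C' * besovNorm D (bloom μ lam) p b) :
      seriesSchattenNorm p t ≤ C * besovNorm D (bloom μ lam) p b := by
    rcases eq_or_ne (besovNorm D (bloom μ lam) p b) ∞ with htop | htop
    · rw [htop, ENNReal.mul_top (by exact_mod_cast hC0.ne')]
      exact le_top
    · exact (h htop.lt_top).trans (by gcongr)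
  have hdone {ι : Type} {t : ι → (Rn n → ℂ) → Rn n → ℂ}
      (h1 : seriesSchattenNorm p t ≤ C * besovNorm D (bloom μ lam) p b)
      (h2 : besovNorm D (bloom μ lam) p b ≤ C * seriesSchattenNorm p t) :
      (SeriesMemSchatten p t ↔ MemBesov D (bloom μ lam) p b) ∧
        seriesSchattenNorm p t ≤ C * besovNorm D (bloom μ lam) p b ∧
        besovNorm D (bloom μ lam) p b ≤ C * seriesSchattenNorm p t :=
    ⟨seriesMemSchatten_iff_memBesov D hloc h1 h2, h1, h2⟩
  refine ⟨?_, ?_, ?_⟩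
  · have ht (i : CubeIndex n × Canc n) (f : L2 n) := rankOne_vec_ae D hs hr i.1
      (haarCoeff D b i.1 i.2.1) (fun _ => (side i.1 ^ n)⁻¹) (haarVal i.1 i.2.1) f
    have ht' (i : CubeIndex n × Canc n) (f : L2 n) : _ =ᵐ[volume]
        weighted μ lam (paraTerm D b) i f := (ht i f).trans <| ae_of_all _ fun x => by
      simp only [weighted, paraTerm, setAverage_eq_integral_step, haar_eq_haarVal]
    refine hdone (hupper hC1C fun hfin => hC₁ D _ _ _ b hs hr hν hloc hfin id _ _ _ _
      (fun i _ => habs i.1) (fun i j => (abs_haarVal i.1 i.2.1 j).le) (fun i => rfl) _ ht') ?_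
    refine hb.besovNorm_le D hs hr hn1 hM1 hν hp1 hLC hC0 fun T hT ε => ?_
    rw [hKe, mul_assoc]
    exact paraOp_lower D hs hr hn1 hM1 hp2 (haarCoeff D b) ((isSeriesSum_iff ht' T).1 hT) ε
  · have ht (i : CubeIndex n × Canc n) (f : L2 n) := rankOne_vec_ae D hs hr i.1
      (haarCoeff D b i.1 i.2.1) (haarVal i.1 i.2.1) (fun _ => (side i.1 ^ n)⁻¹) f
    have ht' (i : CubeIndex n × Canc n) (f : L2 n) : _ =ᵐ[volume]
        weighted μ lam (paraStarTerm D b) i f := (ht i f).trans <| ae_of_all _ fun x => by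
      simp only [weighted, paraStarTerm, integral_mul_haar, step_const, volume_real_dyadicCube]
      by_cases hx : x ∈ dyadicCube D i.1
      · simp only [Set.indicator_of_mem hx]
        push_cast; simp
      · simp only [Set.indicator_of_notMem hx]
        simp
    refine hdone (hupper hC1C fun hfin => hC₁ D _ _ _ b hs hr hν hloc hfin id _ _ _ _
      (fun i j => (abs_haarVal i.1 i.2.1 j).le) (fun i _ => habs i.1)
      (fun i => mul_comm _ _) _ ht') ?_
    refine hb.besovNorm_le D hs hr hn1 hM1 hν hp1 hLC hC0 fun T hT ε => ?_
    rw [hKe, mul_assoc]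
    exact paraStarOp_lower D hs hr hn1 hM1 hp2 (haarCoeff D b) ((isSeriesSum_iff ht' T).1 hT) ε
  · have ht (i : CubeIndex n × CancPair n) (f : L2 n) := rankOne_vec_ae D hs hr i.1
      (haarCoeff D b i.1 i.2.1.1.1) (haarVal i.1 i.2.1.2.1)
      (fun j => haarVal i.1 i.2.1.1.1 j * haarVal i.1 i.2.1.2.1 j) f
    have ht' (i : CubeIndex n × CancPair n) (f : L2 n) : _ =ᵐ[volume]
        weighted μ lam (gammaTerm D b) i f := (ht i f).trans <| ae_of_all _ fun x => by
      simp only [weighted, gammaTerm, ← step_mul_step, Complex.ofReal_mul, haar_eq_haarVal,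
        integral_mul_haar D (fun y => _ * f y)]
    refine hdone (hupper hC2C fun hfin => hC₂ D _ _ _ b hs hr hν hloc hfin (fun e => e.1.1) _ _ _
      (fun i => (side i.1 ^ n)⁻¹) (fun i j => (abs_haarVal i.1 i.2.1.2.1 j).le) (fun i j => ?_)
      (fun i => mul_comm _ _) _ ht') ?_
    · rw [abs_mul, abs_haarVal, abs_haarVal, ← mul_inv, Real.mul_self_sqrt (side_pow_pos i.1).le]
    refine hb.besovNorm_le D hs hr hn1 hM1 hν hp1 hLC hC0 fun T hT ε => ?_
    obtain ⟨η, hη⟩ := exists_canc_ne hn ε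
    refine (gammaOp_lower D hs hr hM1 hp2 (haarCoeff D b) ((isSeriesSum_iff ht' T).1 hT)
      ⟨(ε, η), hη⟩).trans ?_
    gcongr
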